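/- Let $c\ge 2$ and let $K$ be an infinite field. A pair $(\lambda,\mu)$ consists of two partitions $\lambda=(\lambda_1\ge\lambda_2\ge\cdots)$ and $\mu=(\mu_1\ge\mu_2\ge\cdots)$, each with finitely many positive parts and possibly empty; put $k=|\mu|=\sum_i\mu_i$. The linkage formula in codimension $c$ is the following operation: choose a sublist $\lambda'=(\lambda'_1,\dots,\lambda'_c)$ of $\lambda$, where $\lambda$ is extended by infinitely many zeros, and set $p=(c-2)k+1-\sum_{i=1}^c\lambda'_i$; the new pair is $(\lambda^{\rm link},\mu^{\rm link})$, where $\mu^{\rm link}=\lambda\setminus\lambda'$ and $\lambda^{\rm link}$ is the list $(\lambda'_1+p,\dots,\lambda'_c+p,\mu_1,\mu_2,\dots)$ sorted in non-increasing order (zeros being discarded). The decorations of codimension $c$ are the pairs of partitions obtained by finitely many applications of the linkage formula from the pair $F_1=((1),\varnothing)$. Let $R=K[x_1,\dots,x_c]$ with the standard grading. Two homogeneous ideals $I,J\subset R$ are homogeneously linked if there is a regular sequence $\alpha$ of homogeneous elements in $I\cap J$ with $I=(\alpha):J$ and $J=(\alpha):I$. An ideal is homogeneously licci if it is joined by a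 finite chain of such links to an ideal generated by a regular sequence of homogeneous elements. **Theorem.** Let $(\lambda,\mu)$ be a decoration of codimension $c$ other than $F_1=((1),\varnothing)$, with positive parts $\lambda=(\lambda_1,\dots,\lambda_{c+d})$ and $\mu=(\mu_1,\dots,\mu_t)$, and let $k=\sum_{i=1}^t\mu_i$. Then there is a homogeneous ideal $I\subset R=K[x_1,\dots,x_c]$ of codimension (height) $c$ such that 1. $I$ is homogeneously licci; 2. $R/I$ has a graded free resolution of length $c$ by finitely generated graded free modules, of the form $$0\to\bigoplus_{i=1}^{t}R\bigl(-(k+c-2+\mu_i)\bigr)\to F_{c-1}\to\cdots\to F_2\to\bigoplus_{i=1}^{c+d}R\bigl(-(k+1-\lambda_i)\bigr)\to R.$$ For $c=2$ the two displayed sums are the modules $F_2$ and $F_1$ of the resolution $0\to F_2\to F_1\to R$. -/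

import Mathlib

/-- A partition is represented by the multiset of its (positive) parts. `LinkOfPartitions c lam mu lam₂ mu₂`
says that the pair of partitions `(lam₂, mu₂)` is obtained from `(lam, mu)` by the linkage formula in
codimension `c`: choose a sublist `lam'` of length `c` of `lam` followed by infinitely many zeros
(so the nonzero parts of `lam'` form a sub-multiset of `lam`), put `k = |mu|` and
`p = (c - 2) k + 1 - |lam'|`; then `mu₂ = lam \ lam'`, and `lam₂` consists of the nonzero ones among
the numbers `lam'_1 + p, …, lam'_c + p` and the parts of `mu`. -/
def LinkOfPartitions (c : ℕ) (lam mu lam₂ mu₂ : Multiset ℕ) : Prop :=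
  ∃ (lam' : Multiset ℕ) (p : ℤ),
    lam'.card = c ∧ lam'.filter (· ≠ 0) ≤ lam ∧
    p = ((c : ℤ) - 2) * (mu.sum : ℤ) + 1 - (lam'.sum : ℤ) ∧
    mu₂ = lam - lam'.filter (· ≠ 0) ∧
    0 ∉ lam₂ ∧
    lam₂.map (fun a : ℕ => (a : ℤ)) =
      (lam'.map (fun a : ℕ => (a : ℤ) + p) + mu.map (fun a : ℕ => (a : ℤ))).filter (· ≠ 0)

/-- The decorations in codimension `c`: the pairs of partitions obtained from the decoration
`F₁`, that is `((1), ∅)`, by finitely many applications of the linkage formula. -/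
inductive IsDecoration (c : ℕ) : Multiset ℕ → Multiset ℕ → Prop
  | unit : IsDecoration c {1} 0
  | link {lam mu lam₂ mu₂ : Multiset ℕ} :
      IsDecoration c lam mu → LinkOfPartitions c lam mu lam₂ mu₂ → IsDecoration c lam₂ mu₂

section Linkage

variable {K : Type*} [Field K] {n : ℕ}

/-- An ideal of `K[x_1, …, x_n]` that is homogeneous for the standard grading. -/
def IsHomogeneousIdeal (I : Ideal (MvPolynomial (Fin n) K)) : Prop :=
  letI : GradedAlgebra (MvPolynomial.homogeneousSubmodule (Fin n) K) :=
    MvPolynomial.gradedAlgebra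
  I.IsHomogeneous (MvPolynomial.homogeneousSubmodule (Fin n) K)

/-- A regular sequence of homogeneous elements in the standard graded ring `K[x_1, …, x_n]`. -/
def IsHomogeneousRegularSequence (α : List (MvPolynomial (Fin n) K)) : Prop :=
  RingTheory.Sequence.IsRegular (MvPolynomial (Fin n) K) α ∧
    ∀ f ∈ α, ∃ m : ℕ, f.IsHomogeneous m

/-- A homogeneous complete intersection: an ideal generated by a homogeneous regular sequence. -/
def IsHomogeneousCompleteIntersection (I : Ideal (MvPolynomial (Fin n) K)) : Prop :=
  ∃ α : List (MvPolynomial (Fin n) K), IsHomogeneousRegularSequence α ∧ I = Ideal.ofList α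

/-- Two homogeneous ideals are (directly) homogeneously linked if there is a homogeneous regular
sequence `α` in `I ∩ J` with `I = (α) : J` and `J = (α) : I`. -/
def HomogeneouslyLinked (I J : Ideal (MvPolynomial (Fin n) K)) : Prop :=
  IsHomogeneousIdeal I ∧ IsHomogeneousIdeal J ∧
  ∃ α : List (MvPolynomial (Fin n) K), IsHomogeneousRegularSequence α ∧
    Ideal.ofList α ≤ I ⊓ J ∧
    I = (Ideal.ofList α).colon (J : Set (MvPolynomial (Fin n) K)) ∧
    J = (Ideal.ofList α).colon (I : Set (MvPolynomial (Fin n) K))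

/-- An ideal is homogeneously licci if finitely many homogeneous links lead from it to a
homogeneous complete intersection. -/
def IsHomogeneouslyLicci (I : Ideal (MvPolynomial (Fin n) K)) : Prop :=
  ∃ J : Ideal (MvPolynomial (Fin n) K),
    Relation.ReflTransGen HomogeneouslyLinked I J ∧ IsHomogeneousCompleteIntersection J

/-- `f` is homogeneous of degree `e : ℤ`; for negative `e` this forces `f = 0`. -/
def IsHomogeneousOfIntDegree (f : MvPolynomial (Fin n) K) (e : ℤ) : Prop :=
  f = 0 ∨ ∃ m : ℕ, (m : ℤ) = e ∧ f.IsHomogeneous m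

/-- A graded free resolution
`0 → F_len → ⋯ → F_1 → F_0 = R → R/I → 0` of `R/I` over `R = K[x_1, …, x_n]`
by finitely generated graded free modules. The module `F_i = ⨁_{j ∈ ι i} R(-deg i j)` has a
homogeneous basis indexed by the finite type `ι i`, with `deg i j` the degree of the
`j`-th basis element, and the map `F_{i+1} → F_i`, homogeneous of degree zero, is given by the
matrix `d i`. -/
structure GradedFreeResolution (I : Ideal (MvPolynomial (Fin n) K)) (len : ℕ) where
  ι : ℕ → Type
  [fintype : ∀ i, Fintype (ι i)]
  deg : ∀ i, ι i → ℤ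
  d : ∀ i, Matrix (ι i) (ι (i + 1)) (MvPolynomial (Fin n) K)
  homogeneous : ∀ i a b, IsHomogeneousOfIntDegree (d i a b) (deg (i + 1) b - deg i a)
  /-- `F_0 = R`, with its generator in degree zero. -/
  card_zero : Fintype.card (ι 0) = 1
  deg_zero : ∀ a, deg 0 a = 0
  /-- `F_i = 0` for `i > len`. -/
  isEmpty_of_lt : ∀ i, len < i → IsEmpty (ι i)
  exact : ∀ i, Function.Exact (d (i + 1)).mulVecLin (d i).mulVecLin
  /-- The image of `F_1 → F_0 = R` is `I`. -/
  mem_iff : ∀ f : MvPolynomial (Fin n) K,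
    f ∈ I ↔ (fun _ : ι 0 => f) ∈ LinearMap.range (d 0).mulVecLin

/-- The multiset of the degrees of the basis elements of `F_i`, so that
`F_i = ⨁_{e ∈ F.degrees i} R(-e)`. -/
def GradedFreeResolution.degrees {I : Ideal (MvPolynomial (Fin n) K)} {len : ℕ}
    (F : GradedFreeResolution I len) (i : ℕ) : Multiset ℤ :=
  letI := F.fintype i
  (Finset.univ : Finset (F.ι i)).val.map (F.deg i)

end Linkage

/-! The linkage formula is the numerical shadow of the mapping cone. Let `F` resolve `R/I` and let
`α` be a homogeneous regular sequence of length `c` in `I`. Comparing the Koszul complex of `α` with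
`F` and dualising the cone gives a resolution of `R/J` for `J = (α) : I` (`LinkData.isResolution`),
and `I = (α) : J` (`LinkData.I_eq_colon`). Elements of `α` that are basis generators of `I` cancel
against those generators. The new top module then comes from the generators left out, and the new
generators are `α` together with the old top. Degree by degree this is the formula: a nonzero part
`l` of `λ'` is a generator of degree `k + 1 - l` used in the link, a zero part is a form of degree
`k + 1`.

Such a link requires a regular sequence made of prescribed generators. Over an infinite field this
is possible if `I` has `c` generators `T i` of lowest degrees that form a regular sequence: each
chosen generator `x` is replaced by `x + g * T i` with `g` general, which is only a change of basis
(`RegularGenerators.exists_linkData`). The linked ideal has such generators again, namely `α`,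
provided the parts `λ'_i + p` are the largest parts of the new `λ`. This is
`Realization.exists_link`.

It remains to reach every decoration by links of this kind. Backwards, one links `(λ, μ)` along the
`c` largest parts of `λ`, realizes the resulting decoration by induction on `|μ| + |μ_link|`, and
links back (`exists_realization`). The descent ends at `((1), ∅)`, the unit ideal; its link along
the variables is the maximal ideal and starts the construction.

Two facts about decorations make this work. The first is positivity, `λ_i ≤ k` and `λ'_i + p ≥ 0`
(`IsDecoration.le_sum`). A decoration together with a link is a vector on which reordering `λ` acts
by simple reflections of a simply laced diagram with three arms, while linking acts by a diagram
automorphism. All such vectors lie in the orbit of one antidominant vector; they are reached from it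
by increasing reflections alone (`Ascent.reflect`), and these preserve positivity. The second is
that the measure drops (`GreedyLink.exists_lt`), by comparing the invariants `|λ| = (c - 1) k + 1`
and `Σ λ_i² + Σ μ_j² = (c - 2) k² + 2k + 1` with estimates on each part. -/

/-! ### Complexes as single matrices; lifting and homotopy -/

/-- A bounded complex of finite free modules, presented by a single square matrix `d` on the
disjoint union `ι` of the bases; `lvl` is the homological degree of a basis element. -/
structure LevelComplex (R : Type*) [CommRing R] where
  ι : Type
  [fintype : Fintype ι]
  [decEq : DecidableEq ι]
  lvl : ι → ℕ
  d : Matrix ι ι R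
  lvl_eq : ∀ a b, d a b ≠ 0 → lvl b = lvl a + 1
  d_mul_d : d * d = 0

namespace LevelComplex

open Matrix

attribute [instance] LevelComplex.fintype LevelComplex.decEq

variable {R : Type*} [CommRing R]

/-- The vector `v` is supported in homological degree `n`. -/
def Supp (C : LevelComplex R) (n : ℕ) (v : C.ι → R) : Prop := ∀ a, C.lvl a ≠ n → v a = 0

/-- Exactness in all homological degrees greater than `q`. -/
def ExactAbove (C : LevelComplex R) (q : ℕ) : Prop :=
  ∀ n, q < n → ∀ v, C.Supp n v → C.d *ᵥ v = 0 → ∃ w, C.Supp (n + 1) w ∧ C.d *ᵥ w = v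

theorem d_eq_zero (C : LevelComplex R) {a b : C.ι} (h : C.lvl b ≠ C.lvl a + 1) : C.d a b = 0 := by
  by_contra h'
  exact h (C.lvl_eq a b h')

theorem d_mulVec_d_mulVec (C : LevelComplex R) (v : C.ι → R) : C.d *ᵥ (C.d *ᵥ v) = 0 := by
  rw [mulVec_mulVec, C.d_mul_d, zero_mulVec]

theorem Supp.d_mulVec {C : LevelComplex R} {n : ℕ} {v : C.ι → R} (h : C.Supp (n + 1) v) :
    C.Supp n (C.d *ᵥ v) := by
  intro a ha
  refine Finset.sum_eq_zero fun b _ => ?_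
  change C.d a b * v b = 0
  by_cases hb : C.lvl b = n + 1
  · rw [C.d_eq_zero (by omega), zero_mul]
  · rw [h b hb, mul_zero]

theorem Supp.d_mulVec_eq_zero {C : LevelComplex R} {v : C.ι → R} (h : C.Supp 0 v) :
    C.d *ᵥ v = 0 := by
  funext a
  refine Finset.sum_eq_zero fun b _ => ?_
  change C.d a b * v b = 0
  by_cases hb : C.lvl b = 0
  · rw [C.d_eq_zero (by omega), zero_mul]
  · rw [h b hb, mul_zero]

theorem Supp.add {C : LevelComplex R} {n : ℕ} {v w : C.ι → R} (hv : C.Supp n v)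
    (hw : C.Supp n w) : C.Supp n (v + w) := fun a ha => by simp [hv a ha, hw a ha]

theorem Supp.sub {C : LevelComplex R} {n : ℕ} {v w : C.ι → R} (hv : C.Supp n v)
    (hw : C.Supp n w) : C.Supp n (v - w) := fun a ha => by simp [hv a ha, hw a ha]

theorem Supp.neg {C : LevelComplex R} {n : ℕ} {v : C.ι → R} (hv : C.Supp n v) :
    C.Supp n (-v) := fun a ha => by simp [hv a ha]

theorem Supp.smul {C : LevelComplex R} {n : ℕ} {v : C.ι → R} (r : R) (hv : C.Supp n v) :
    C.Supp n (r • v) := fun a ha => by simp [hv a ha]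

theorem supp_single (C : LevelComplex R) (x : C.ι) (r : R) : C.Supp (C.lvl x) (Pi.single x r) := by
  intro a ha
  rw [Pi.single_apply, if_neg]
  rintro rfl
  exact ha rfl

/-- A preimage of a vector supported in one degree may be chosen supported in the next one. -/
theorem exists_supp_of_mulVec_eq (C : LevelComplex R) {n : ℕ} {v w : C.ι → R} (hv : C.Supp n v)
    (h : C.d *ᵥ w = v) : ∃ w', C.Supp (n + 1) w' ∧ C.d *ᵥ w' = v := by
  refine ⟨fun b => if C.lvl b = n + 1 then w b else 0, fun a ha => if_neg ha, ?_⟩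
  funext a
  by_cases ha : C.lvl a = n
  · rw [← h]
    refine Finset.sum_congr rfl fun b _ => ?_
    by_cases hb : C.lvl b = n + 1
    · simp [hb]
    · have : C.d a b = 0 := C.d_eq_zero (by omega)
      simp [this]
  · rw [hv a ha]
    refine Finset.sum_eq_zero fun b _ => ?_
    by_cases hb : C.lvl b = n + 1
    · have : C.d a b = 0 := C.d_eq_zero (by omega)
      simp [this]
    · simp [hb]

/-- The lifting lemma: a solution `X` of `Q.d * X = f + ε X * P.d` given in homological degrees at
most `m` extends to all degrees. It yields both comparison maps and homotopies. -/
theorem exists_lift (P Q : LevelComplex R) (q m t : ℕ) (hQ : Q.ExactAbove q) (hq : q < m + t)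
    (ε : R) (f : Matrix Q.ι P.ι R)
    (hfs : ∀ a x, f a x ≠ 0 → Q.lvl a + 1 = P.lvl x + t)
    (hf : Q.d * f + ε • (f * P.d) = 0) (X₀ : Matrix Q.ι P.ι R)
    (hX₀s : ∀ a x, X₀ a x ≠ 0 → Q.lvl a = P.lvl x + t)
    (hX₀ : ∀ x, P.lvl x ≤ m → ∀ a, (Q.d * X₀) a x = (f + ε • (X₀ * P.d)) a x) :
    ∃ X : Matrix Q.ι P.ι R, (∀ a x, X a x ≠ 0 → Q.lvl a = P.lvl x + t) ∧
      Q.d * X = f + ε • (X * P.d) ∧ ∀ x, P.lvl x ≤ m → ∀ a, X a x = X₀ a x := by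
  -- The solution is extended one homological degree of `P` at a time.
  have key : ∀ N : ℕ, ∃ X : Matrix Q.ι P.ι R, (∀ a x, X a x ≠ 0 → Q.lvl a = P.lvl x + t) ∧
      (∀ x, P.lvl x ≤ m + N → ∀ a, (Q.d * X) a x = (f + ε • (X * P.d)) a x) ∧
      ∀ x, P.lvl x ≤ m → ∀ a, X a x = X₀ a x := by
    intro N
    induction N with
    | zero => exact ⟨X₀, hX₀s, hX₀, fun _ _ _ => rfl⟩
    | succ N ih =>
      obtain ⟨X, hXs, hX, hXX⟩ := ih
      have hw : ∀ x, P.lvl x = m + N + 1 →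
          ∃ w, Q.Supp (P.lvl x + t) w ∧ Q.d *ᵥ w = fun a => (f + ε • (X * P.d)) a x := by
        intro x hx
        have h1 : Q.Supp (m + N + t) (fun a => (f + ε • (X * P.d)) a x) := by
          intro a ha
          have e1 : f a x = 0 := by
            by_contra h
            have := hfs a x h
            omega
          have e2 : (X * P.d) a x = 0 := by
            refine Finset.sum_eq_zero fun b _ => ?_
            by_contra h
            have h1 := hXs a b (left_ne_zero_of_mul h)
            have h2 := P.lvl_eq b x (right_ne_zero_of_mul h)
            omega
          simp [Matrix.add_apply, Matrix.smul_apply, e1, e2]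
        -- The right-hand side is a cycle: `hf` combined with the equation already solved one degree
        -- lower. Exactness of `Q` then supplies the new column.
        have h2 : Q.d *ᵥ (fun a => (f + ε • (X * P.d)) a x) = 0 := by
          have e1 : Q.d * (X * P.d) = fun a y => ((Q.d * X) * P.d) a y := by
            rw [Matrix.mul_assoc]
          have e2 : ∀ a, ((Q.d * X) * P.d) a x = ((f + ε • (X * P.d)) * P.d) a x := by
            intro a
            refine Finset.sum_congr rfl fun b _ => ?_
            by_cases hb : P.d b x = 0
            · simp [hb]
            · have := P.lvl_eq b x hb
              show (Q.d * X) a b * _ = (f + ε • (X * P.d)) a b * _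
              rw [hX b (by omega) a]
          have e3 : (f + ε • (X * P.d)) * P.d = f * P.d := by
            rw [Matrix.add_mul, Matrix.smul_mul, Matrix.mul_assoc, P.d_mul_d]
            simp
          funext a
          show (Q.d * (f + ε • (X * P.d))) a x = 0
          rw [Matrix.mul_add, Matrix.mul_smul, ← Matrix.mul_assoc, Matrix.add_apply,
            Matrix.smul_apply, e2, e3]
          exact congrFun (congrFun hf a) x
        obtain ⟨w, hw1, hw2⟩ := hQ (m + N + t) (by omega) _ h1 h2
        refine ⟨w, ?_, hw2⟩
        rwa [hx, show m + N + 1 + t = m + N + t + 1 by omega]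
      choose w hw1 hw2 using hw
      let X' : Matrix Q.ι P.ι R := fun a x => if h : P.lvl x = m + N + 1 then w x h a else X a x
      have hlow : ∀ x, P.lvl x ≠ m + N + 1 → ∀ a, X' a x = X a x := fun x hx a => dif_neg hx
      have htop : ∀ x (hx : P.lvl x = m + N + 1), ∀ a, X' a x = w x hx a := fun x hx a =>
        dif_pos hx
      have hXd : ∀ x, P.lvl x ≤ m + N + 1 → ∀ a, (X' * P.d) a x = (X * P.d) a x := by
        intro x hx a
        refine Finset.sum_congr rfl fun b _ => ?_
        by_cases hb : P.d b x = 0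
        · simp [hb]
        · have := P.lvl_eq b x hb
          show X' a b * _ = X a b * _
          rw [hlow b (by omega)]
      refine ⟨X', ?_, ?_, ?_⟩
      · intro a x h
        by_cases hx : P.lvl x = m + N + 1
        · rw [htop x hx] at h
          by_contra h'
          exact h (hw1 x hx a h')
        · rw [hlow x hx] at h
          exact hXs a x h
      · intro x hx a
        have e : (f + ε • (X' * P.d)) a x = (f + ε • (X * P.d)) a x := by
          simp only [Matrix.add_apply, Matrix.smul_apply, hXd x (by omega) a]
        rw [e]
        by_cases hx' : P.lvl x = m + N + 1
        · rw [← congrFun (hw2 x hx') a]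
          exact Finset.sum_congr rfl fun b _ => congrArg (Q.d a b * ·) (htop x hx' b)
        · rw [← hX x (by omega) a]
          exact Finset.sum_congr rfl fun b _ => congrArg (Q.d a b * ·) (hlow x hx' b)
      · intro x hx a
        rw [hlow x (by omega), hXX x hx a]
  -- The sum of all levels bounds every level, so this many extensions suffice.
  obtain ⟨X, h1, h2, h3⟩ := key (∑ x, P.lvl x)
  refine ⟨X, h1, ?_, h3⟩
  ext a x
  exact h2 x ((Finset.single_le_sum (fun _ _ => Nat.zero_le _) (Finset.mem_univ x)).trans
    (Nat.le_add_left _ _)) a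

/-- If multiplication by `y` kills the homology in the lowest degree `q` of a complex that is
exact in all other degrees, then it is homotopic to zero. -/
theorem exists_homotopy (C : LevelComplex R) (q : ℕ) (hq : ∀ x, q ≤ C.lvl x)
    (hC : C.ExactAbove q) (y : R)
    (hy : ∀ x, C.lvl x = q → ∃ w, C.d *ᵥ w = Pi.single x y) :
    ∃ s : Matrix C.ι C.ι R, (∀ a x, s a x ≠ 0 → C.lvl a = C.lvl x + 1) ∧
      C.d * s + s * C.d = y • (1 : Matrix C.ι C.ι R) := by
  have h : ∀ x, ∃ w, C.Supp (q + 1) w ∧ (C.lvl x = q → C.d *ᵥ w = Pi.single x y) ∧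
      (C.lvl x ≠ q → w = 0) := by
    intro x
    by_cases hx : C.lvl x = q
    · obtain ⟨w, hw⟩ := hy x hx
      obtain ⟨w', h1, h2⟩ := C.exists_supp_of_mulVec_eq (n := q)
        (by rw [← hx]; exact C.supp_single x y) hw
      exact ⟨w', h1, fun _ => h2, fun h => absurd hx h⟩
    · exact ⟨0, fun _ _ => rfl, fun h => absurd h hx, fun _ => rfl⟩
  choose w hw1 hw2 hw3 using h
  -- A homotopy is a lifting problem with sign `-1` and shift `1`; the given preimages in degree `q`
  -- start it.
  obtain ⟨s, h1, h2, -⟩ := exists_lift C C q q 1 hC (by omega) (-1)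
    (y • (1 : Matrix C.ι C.ι R))
    (by
      intro a x h
      have : a = x := by
        by_contra h'
        exact h (by simp [Matrix.one_apply_ne h'])
      rw [this])
    (by simp) (Matrix.of fun a x => w x a)
    (by
      intro a x h
      have e1 : C.lvl a = q + 1 := by
        by_contra h'
        exact h (hw1 x a h')
      have e2 : C.lvl x = q := by
        by_contra h'
        exact h (congrFun (hw3 x h') a)
      omega)
    (by
      intro x hx a
      have hx' : C.lvl x = q := le_antisymm hx (hq x)
      have e1 : ((Matrix.of fun a x => w x a : Matrix C.ι C.ι R) * C.d) a x = 0 := by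
        refine Finset.sum_eq_zero fun b _ => ?_
        have : C.d b x = 0 := C.d_eq_zero (by have := hq b; omega)
        exact mul_eq_zero_of_right _ this
      have e2 : (C.d * (Matrix.of fun a x => w x a : Matrix C.ι C.ι R)) a x
          = (Pi.single x y : C.ι → R) a := congrFun (hw2 x hx') a
      rw [Matrix.add_apply, Matrix.smul_apply, Matrix.smul_apply, e1, e2]
      simp [Pi.single_apply, Matrix.one_apply])
  refine ⟨s, h1, ?_⟩
  rw [h2]
  simp

end LevelComplex

/-! ### Regular sequences and exactness of the dual complex -/

/-- An elementwise form of weak regularity for a finite sequence. -/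
def WeaklyRegularSeq {R : Type*} [CommRing R] {n : ℕ} (α : Fin n → R) : Prop :=
  ∀ i : Fin n, ∀ r, r * α i ∈ Ideal.span (α '' {j | j < i}) → r ∈ Ideal.span (α '' {j | j < i})

namespace LevelComplex

open Matrix

variable {R : Type*} [CommRing R]

theorem span_image_lt_succ {n : ℕ} (α : Fin n → R) {j : ℕ} (hj : j < n) :
    Ideal.span (α '' {i | (i : ℕ) < j + 1}) =
      Ideal.span (α '' {i | (i : ℕ) < j}) ⊔ Ideal.span {α ⟨j, hj⟩} := by
  rw [← Ideal.span_union]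
  congr 1
  ext r
  simp only [Set.mem_image, Set.mem_ofPred_eq, Set.union_singleton, Set.mem_insert_iff]
  constructor
  · rintro ⟨i, hi, rfl⟩
    by_cases h : (i : ℕ) = j
    · left; congr 1; exact Fin.ext h
    · right; exact ⟨i, by omega, rfl⟩
  · rintro (rfl | ⟨i, hi, rfl⟩)
    · exact ⟨_, Nat.lt_succ_self j, rfl⟩
    · exact ⟨i, by omega, rfl⟩

theorem mulVec_mem_ideal {ι κ : Type*} [Fintype κ] (A : Matrix ι κ R) (Q : Ideal R)
    {v : κ → R} (hv : ∀ a, v a ∈ Q) (a : ι) : (A *ᵥ v) a ∈ Q :=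
  Q.sum_mem fun b _ => Q.mul_mem_left _ (hv b)

/-- If a weakly regular sequence of length `c` annihilates the lowest homology of a complex exact
in all other degrees, the dual complex is exact in the `c` lowest degrees. -/
theorem dual_exact_of_weaklyRegularSeq (C : LevelComplex R) (q : ℕ) (hq : ∀ x, q ≤ C.lvl x)
    (hC : C.ExactAbove q) {c : ℕ} (α : Fin c → R) (hα : WeaklyRegularSeq α)
    (hy : ∀ i x, C.lvl x = q → ∃ w, C.d *ᵥ w = Pi.single x (α i)) (n : ℕ) (hn : n < q + c)
    (u : C.ι → R) (hu : C.Supp n u) (hdu : C.dᵀ *ᵥ u = 0) :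
    ∃ w, (∀ a, C.lvl a + 1 ≠ n → w a = 0) ∧ C.dᵀ *ᵥ w = u := by
  -- Double induction modulo the first `j` elements. A null homotopy `s` of `α_j` gives `sᵀ dᵀ u +
  -- dᵀ sᵀ u = α_j u`, so `sᵀ u` is a cocycle modulo one more element and lies one degree lower.
  -- There it is `dᵀ w + α_j z`; applying `dᵀ` and cancelling the regular element `α_j` leaves `u =
  -- dᵀ z` modulo the first `j` elements.
  have key : ∀ i j : ℕ, i + j < c → ∀ u, C.Supp (q + i) u →
      (∀ a, (C.dᵀ *ᵥ u) a ∈ Ideal.span (α '' {l | (l : ℕ) < j})) →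
      ∃ w, (∀ a, C.lvl a + 1 ≠ q + i → w a = 0) ∧
        ∀ a, u a - (C.dᵀ *ᵥ w) a ∈ Ideal.span (α '' {l | (l : ℕ) < j}) := by
    intro i
    induction i with
    | zero =>
      intro j hj u hu hdu
      refine ⟨0, fun _ _ => rfl, fun a => ?_⟩
      obtain ⟨s, hs1, hs2⟩ := C.exists_homotopy q hq hC (α ⟨j, by omega⟩) (hy _)
      have e := congrArg (fun M => (Mᵀ *ᵥ u) a) hs2
      simp only [transpose_add, transpose_mul, transpose_smul, transpose_one, add_mulVec,
        ← mulVec_mulVec, smul_mulVec, one_mulVec, Pi.add_apply, Pi.smul_apply, smul_eq_mul] at e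
      have e0 : sᵀ *ᵥ u = 0 := by
        funext x
        refine Finset.sum_eq_zero fun b _ => ?_
        by_contra h
        have h1 := hs1 b x (left_ne_zero_of_mul h)
        have h2 := hq x
        have h3 : C.lvl b = q + 0 := by
          by_contra h'
          exact right_ne_zero_of_mul h (hu b h')
        omega
      rw [e0] at e
      simp only [mulVec_zero, Pi.zero_apply, add_zero, sub_zero] at e ⊢
      refine hα ⟨j, by omega⟩ _ ?_
      rw [mul_comm, ← e]
      exact mulVec_mem_ideal _ _ hdu a
    | succ i ih =>
      intro j hj u hu hdu
      obtain ⟨s, hs1, hs2⟩ := C.exists_homotopy q hq hC (α ⟨j, by omega⟩) (hy _)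
      have e : ∀ a, (sᵀ *ᵥ (C.dᵀ *ᵥ u)) a + (C.dᵀ *ᵥ (sᵀ *ᵥ u)) a = α ⟨j, by omega⟩ * u a := by
        intro a
        have e := congrArg (fun M => (Mᵀ *ᵥ u) a) hs2
        simpa only [transpose_add, transpose_mul, transpose_smul, transpose_one, add_mulVec,
          ← mulVec_mulVec, smul_mulVec, one_mulVec, Pi.add_apply, Pi.smul_apply,
          smul_eq_mul] using e
      have hw : C.Supp (q + i) (sᵀ *ᵥ u) := by
        intro x hx
        refine Finset.sum_eq_zero fun b _ => ?_
        by_contra h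
        have h1 := hs1 b x (left_ne_zero_of_mul h)
        have h3 : C.lvl b = q + (i + 1) := by
          by_contra h'
          exact right_ne_zero_of_mul h (hu b h')
        omega
      have hs : ∀ a, (sᵀ *ᵥ (C.dᵀ *ᵥ u)) a ∈ Ideal.span (α '' {l | (l : ℕ) < j}) :=
        mulVec_mem_ideal _ _ hdu
      have hle := span_image_lt_succ α (j := j) (by omega)
      obtain ⟨w, hw1, hw2⟩ := ih (j + 1) (by omega) (sᵀ *ᵥ u) hw (by
        intro a
        rw [hle, ← add_sub_cancel_left ((sᵀ *ᵥ (C.dᵀ *ᵥ u)) a) ((C.dᵀ *ᵥ (sᵀ *ᵥ u)) a), e a]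
        exact Ideal.sub_mem _ (Ideal.mem_sup_right (Ideal.mul_mem_right _ _
          (Ideal.mem_span_singleton_self _))) (Ideal.mem_sup_left (hs a)))
      have hsplit : ∀ a, ∃ z, (sᵀ *ᵥ u) a - (C.dᵀ *ᵥ w) a - α ⟨j, by omega⟩ * z ∈
          Ideal.span (α '' {l | (l : ℕ) < j}) := by
        intro a
        have := hw2 a
        rw [hle] at this
        obtain ⟨p, hp, r, hr, hpr⟩ := Submodule.mem_sup.1 this
        obtain ⟨z, rfl⟩ := Ideal.mem_span_singleton'.1 hr
        refine ⟨z, ?_⟩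
        rw [← hpr, mul_comm, add_sub_cancel_right]
        exact hp
      choose z hz using hsplit
      refine ⟨fun a => if C.lvl a = q + i then z a else 0, fun a ha => if_neg (by omega), ?_⟩
      have hz' : ∀ a, (sᵀ *ᵥ u) a - (C.dᵀ *ᵥ w) a -
          α ⟨j, by omega⟩ * (if C.lvl a = q + i then z a else 0) ∈
          Ideal.span (α '' {l | (l : ℕ) < j}) := by
        intro a
        by_cases ha : C.lvl a = q + i
        · simpa [ha] using hz a
        · have e1 : (C.dᵀ *ᵥ w) a = 0 := by
            refine Finset.sum_eq_zero fun b _ => ?_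
            by_contra h
            have h1 := C.lvl_eq b a (left_ne_zero_of_mul h)
            have h3 : C.lvl b + 1 = q + i := by
              by_contra h'
              exact right_ne_zero_of_mul h (hw1 b h')
            omega
          simp [ha, hw a ha, e1]
      intro a
      refine hα ⟨j, by omega⟩ _ ?_
      have h1 := mulVec_mem_ideal C.dᵀ _ hz' a
      have e2 : (C.dᵀ *ᵥ fun a => (sᵀ *ᵥ u) a - (C.dᵀ *ᵥ w) a -
          α ⟨j, by omega⟩ * (if C.lvl a = q + i then z a else 0)) =
          C.dᵀ *ᵥ (sᵀ *ᵥ u) - α ⟨j, by omega⟩ •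
            (C.dᵀ *ᵥ fun a => (if C.lvl a = q + i then z a else 0)) := by
        have : (fun a => (sᵀ *ᵥ u) a - (C.dᵀ *ᵥ w) a -
          α ⟨j, by omega⟩ * (if C.lvl a = q + i then z a else 0)) =
          sᵀ *ᵥ u - C.dᵀ *ᵥ w - α ⟨j, by omega⟩ • (fun a => if C.lvl a = q + i then z a else 0) :=
          rfl
        rw [this, mulVec_sub, mulVec_sub, mulVec_mulVec w, ← transpose_mul, C.d_mul_d,
          mulVec_smul]
        simp
      rw [e2] at h1
      have h2 := Ideal.add_mem _ h1 (hs a)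
      simp only [Pi.sub_apply, Pi.smul_apply, smul_eq_mul] at h2
      have e3 : ∀ y : R, (u a - y) * α ⟨j, by omega⟩ = (C.dᵀ *ᵥ (sᵀ *ᵥ u)) a -
          α ⟨j, by omega⟩ * y + (sᵀ *ᵥ (C.dᵀ *ᵥ u)) a := fun y => by linear_combination -(e a)
      have h3 := h2
      rw [← e3] at h3
      exact h3
  by_cases hnq : n < q
  · refine ⟨0, fun _ _ => rfl, ?_⟩
    funext a
    rw [mulVec_zero, hu a (by have := hq a; omega)]
    rfl
  · obtain ⟨i, rfl⟩ := Nat.exists_eq_add_of_le (not_lt.1 hnq)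
    obtain ⟨w, h1, h2⟩ := key i 0 (by omega) u hu (by rw [hdu]; simp)
    refine ⟨w, h1, ?_⟩
    funext a
    have := h2 a
    simp only [not_lt_zero, Set.ofPred_false, Set.image_empty, Ideal.span_empty, Ideal.mem_bot] at this
    exact (sub_eq_zero.1 this).symm

end LevelComplex

/-! ### Forms of integer degree -/

section HomogeneousDegree

variable {K : Type*} [Field K] {n : ℕ}

theorem IsHomogeneousOfIntDegree.zero (e : ℤ) :
    IsHomogeneousOfIntDegree (0 : MvPolynomial (Fin n) K) e := Or.inl rfl

theorem IsHomogeneousOfIntDegree.one :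
    IsHomogeneousOfIntDegree (1 : MvPolynomial (Fin n) K) 0 :=
  Or.inr ⟨0, rfl, MvPolynomial.isHomogeneous_one _ _⟩

theorem IsHomogeneousOfIntDegree.neg {f : MvPolynomial (Fin n) K} {e : ℤ}
    (h : IsHomogeneousOfIntDegree f e) : IsHomogeneousOfIntDegree (-f) e := by
  obtain rfl | ⟨m, hm, hf⟩ := h
  · exact Or.inl neg_zero
  · exact Or.inr ⟨m, hm, hf.neg⟩

theorem IsHomogeneousOfIntDegree.add {f g : MvPolynomial (Fin n) K} {e : ℤ}
    (hf : IsHomogeneousOfIntDegree f e) (hg : IsHomogeneousOfIntDegree g e) :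
    IsHomogeneousOfIntDegree (f + g) e := by
  obtain rfl | ⟨m, hm, hf⟩ := hf
  · simpa using hg
  · obtain rfl | ⟨m', hm', hg⟩ := hg
    · exact Or.inr ⟨m, hm, by simpa using hf⟩
    · obtain rfl : m = m' := by omega
      exact Or.inr ⟨m, hm, hf.add hg⟩

theorem IsHomogeneousOfIntDegree.mul {f g : MvPolynomial (Fin n) K} {e e' : ℤ}
    (hf : IsHomogeneousOfIntDegree f e) (hg : IsHomogeneousOfIntDegree g e') :
    IsHomogeneousOfIntDegree (f * g) (e + e') := by
  obtain rfl | ⟨m, hm, hf⟩ := hf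
  · exact Or.inl (zero_mul g)
  · obtain rfl | ⟨m', hm', hg⟩ := hg
    · exact Or.inl (mul_zero f)
    · exact Or.inr ⟨m + m', by push_cast; omega, hf.mul hg⟩

theorem IsHomogeneousOfIntDegree.sum {ι : Type*} (s : Finset ι)
    (f : ι → MvPolynomial (Fin n) K) {e : ℤ} (h : ∀ i ∈ s, IsHomogeneousOfIntDegree (f i) e) :
    IsHomogeneousOfIntDegree (∑ i ∈ s, f i) e := by
  classical
  induction s using Finset.induction_on with
  | empty => exact Or.inl rfl
  | insert i s hi ih =>
    rw [Finset.sum_insert hi]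
    exact (h i (Finset.mem_insert_self i s)).add
      (ih fun j hj => h j (Finset.mem_insert_of_mem hj))

theorem IsHomogeneousOfIntDegree.exists_isHomogeneous {f : MvPolynomial (Fin n) K} {e : ℤ}
    (h : IsHomogeneousOfIntDegree f e) : ∃ m : ℕ, f.IsHomogeneous m := by
  obtain rfl | ⟨m, -, hf⟩ := h
  · exact ⟨0, MvPolynomial.isHomogeneous_zero _ _ _⟩
  · exact ⟨m, hf⟩

end HomogeneousDegree

/-! ### Graded complexes and the Koszul complex -/

/-- A bounded complex of finitely generated graded free modules over `K[x_1, …, x_n]`. -/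
structure GradedComplex (n : ℕ) (K : Type*) [Field K] extends
    LevelComplex (MvPolynomial (Fin n) K) where
  deg : ι → ℤ
  homogeneous : ∀ a b, IsHomogeneousOfIntDegree (d a b) (deg b - deg a)

/-- The properties of the Koszul complex `C` of a weakly regular sequence `α` of forms of degrees
`δ`; `o` and `t` are its bottom and top basis elements, `a` and `b` its bases next to them. -/
structure IsKoszul {n : ℕ} {K : Type*} [Field K] {m : ℕ} (C : GradedComplex n K)
    (α : Fin m → MvPolynomial (Fin n) K) (δ : Fin m → ℤ) (o t : C.ι) (a b : Fin m → C.ι) :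
    Prop where
  exact : C.ExactAbove 0
  lvl_le : ∀ x, C.lvl x ≤ m
  lvl_eq_zero : ∀ x, C.lvl x = 0 ↔ x = o
  lvl_eq_top : ∀ x, C.lvl x = m ↔ x = t
  lvl_eq_one : ∀ x, C.lvl x = 1 ↔ ∃ i, a i = x
  lvl_add_one : ∀ x, C.lvl x + 1 = m ↔ ∃ i, b i = x
  a_injective : Function.Injective a
  b_injective : Function.Injective b
  deg_o : C.deg o = 0
  deg_t : C.deg t = ∑ i, δ i
  deg_a : ∀ i, C.deg (a i) = δ i
  deg_b : ∀ i, C.deg (b i) = ∑ j, δ j - δ i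
  d_a : ∀ i, C.d o (a i) = α i
  d_t : ∀ i, C.d (b i) t = α i ∨ C.d (b i) t = -α i

section Koszul

open Matrix

variable {K : Type*} [Field K] {n : ℕ}

theorem span_castSucc_image {R : Type*} [CommRing R] {m : ℕ} (α : Fin (m + 1) → R) (i : Fin m) :
    (fun j : Fin m => α j.castSucc) '' {j | j < i} = α '' {j | j < i.castSucc} := by
  ext r
  simp only [Set.mem_image, Set.mem_ofPred_eq]
  constructor
  · rintro ⟨j, hj, rfl⟩
    exact ⟨j.castSucc, by simpa using hj, rfl⟩
  · rintro ⟨j, hj, rfl⟩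
    have hjm : (j : ℕ) < m := by
      have h1 : (j : ℕ) < (i : ℕ) := hj
      omega
    exact ⟨⟨j, hjm⟩, hj, rfl⟩

theorem WeaklyRegularSeq.castSucc {R : Type*} [CommRing R] {m : ℕ} {α : Fin (m + 1) → R}
    (h : WeaklyRegularSeq α) : WeaklyRegularSeq fun j : Fin m => α j.castSucc := by
  intro i r hr
  rw [span_castSucc_image] at hr ⊢
  exact h i.castSucc r hr

theorem WeaklyRegularSeq.mem_of_mul_last_mem {R : Type*} [CommRing R] {m : ℕ}
    {α : Fin (m + 1) → R} (h : WeaklyRegularSeq α) {r : R}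
    (hr : r * α (Fin.last m) ∈ Ideal.span (Set.range fun j : Fin m => α j.castSucc)) :
    r ∈ Ideal.span (Set.range fun j : Fin m => α j.castSucc) := by
  have : (Set.range fun j : Fin m => α j.castSucc) = α '' {j | j < Fin.last m} := by
    ext r
    simp only [Set.mem_image, Set.mem_ofPred_eq, Set.mem_range]
    constructor
    · rintro ⟨j, rfl⟩
      exact ⟨j.castSucc, Fin.castSucc_lt_last j, rfl⟩
    · rintro ⟨j, hj, rfl⟩
      exact ⟨⟨j, hj⟩, rfl⟩
  rw [this] at hr ⊢
  exact h _ _ hr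

theorem IsKoszul.mulVec_apply {m : ℕ} {C : GradedComplex n K}
    {α : Fin m → MvPolynomial (Fin n) K} {δ : Fin m → ℤ} {o t : C.ι} {a b : Fin m → C.ι}
    (h : IsKoszul C α δ o t a b) (w : C.ι → MvPolynomial (Fin n) K) :
    (C.d *ᵥ w) o = ∑ i, α i * w (a i) := by
  have e : ∑ x ∈ Finset.univ.image a, C.d o x * w x = ∑ x, C.d o x * w x := by
    refine Finset.sum_subset (Finset.subset_univ _) fun x _ hx => ?_
    rw [C.d_eq_zero, zero_mul]
    rw [(h.lvl_eq_zero o).2 rfl]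
    intro hl
    obtain ⟨i, hi⟩ := (h.lvl_eq_one x).1 hl
    exact hx (Finset.mem_image.2 ⟨i, Finset.mem_univ i, hi⟩)
  rw [Finset.sum_image fun i _ j _ hij => h.a_injective hij] at e
  simp only [h.d_a] at e
  exact e.symm

theorem IsKoszul.mem_span_iff {m : ℕ} {C : GradedComplex n K}
    {α : Fin m → MvPolynomial (Fin n) K} {δ : Fin m → ℤ} {o t : C.ι} {a b : Fin m → C.ι}
    (h : IsKoszul C α δ o t a b) (f : MvPolynomial (Fin n) K) :
    f ∈ Ideal.span (Set.range α) ↔ ∃ w, C.Supp 1 w ∧ C.d *ᵥ w = Pi.single o f := by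
  have ho : C.lvl o = 0 := (h.lvl_eq_zero o).2 rfl
  constructor
  · intro hf
    obtain ⟨g, rfl⟩ := (Ideal.mem_span_range_iff_exists_fun).1 hf
    have hs : C.Supp 1 (∑ i, Pi.single (a i) (g i)) := by
      intro x hx
      rw [Finset.sum_apply]
      refine Finset.sum_eq_zero fun i _ => ?_
      rw [Pi.single_apply, if_neg]
      rintro rfl
      exact hx ((h.lvl_eq_one _).2 ⟨i, rfl⟩)
    refine ⟨_, hs, ?_⟩
    funext x
    by_cases hx : x = o
    · subst hx
      rw [h.mulVec_apply, Pi.single_eq_same]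
      refine Finset.sum_congr rfl fun i _ => ?_
      rw [Finset.sum_apply, Finset.sum_eq_single i, Pi.single_eq_same, mul_comm]
      · intro j _ hj
        rw [Pi.single_apply, if_neg fun h' => hj (h.a_injective h').symm]
      · exact fun h' => absurd (Finset.mem_univ i) h'
    · rw [Pi.single_eq_of_ne hx]
      exact hs.d_mulVec x fun h' => hx ((h.lvl_eq_zero x).1 h')
  · rintro ⟨w, -, hw⟩
    have := congrFun hw o
    rw [h.mulVec_apply, Pi.single_eq_same] at this
    rw [← this]
    exact Ideal.sum_mem _ fun i _ => Ideal.mul_mem_right _ _ (Ideal.subset_span ⟨i, rfl⟩)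

theorem eq_single_of_supp_zero {C : LevelComplex (MvPolynomial (Fin n) K)} {o : C.ι}
    (ho : ∀ x, C.lvl x = 0 ↔ x = o) {v : C.ι → MvPolynomial (Fin n) K} (hv : C.Supp 0 v) :
    v = Pi.single o (v o) := by
  funext x
  by_cases hx : x = o
  · subst hx; simp
  · rw [Pi.single_eq_of_ne hx, hv x fun h => hx ((ho x).1 h)]

/-- The mapping cone of multiplication by a form `f` of degree `e` on a complex. -/
noncomputable def GradedComplex.mulCone (C : GradedComplex n K) (f : MvPolynomial (Fin n) K) (e : ℤ)
    (hf : IsHomogeneousOfIntDegree f e) : GradedComplex n K where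
  ι := C.ι ⊕ C.ι
  lvl := Sum.elim C.lvl fun x => C.lvl x + 1
  d := fromBlocks C.d (f • (1 : Matrix C.ι C.ι _)) 0 (-C.d)
  lvl_eq := by
    rintro (x | x) (y | y) h
    · exact C.lvl_eq x y h
    · have : x = y := by
        by_contra h'
        exact h (by simp [Matrix.one_apply_ne h'])
      simp [this]
    · exact absurd rfl h
    · have := C.lvl_eq x y fun h' => h (by simp [h'])
      simp [this]
  d_mul_d := by
    rw [fromBlocks_multiply]
    simp [C.d_mul_d]
  deg := Sum.elim C.deg fun x => C.deg x + e
  homogeneous := by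
    rintro (x | x) (y | y)
    · exact C.homogeneous x y
    · by_cases h : x = y
      · subst h
        simpa using hf
      · refine Or.inl ?_
        simp [Matrix.one_apply_ne h]
    · exact Or.inl rfl
    · have := (C.homogeneous x y).neg
      simpa using this

theorem GradedComplex.mulCone_mulVec (C : GradedComplex n K) (f : MvPolynomial (Fin n) K) (e : ℤ)
    (hf : IsHomogeneousOfIntDegree f e) (u w : C.ι → MvPolynomial (Fin n) K) :
    (C.mulCone f e hf).d *ᵥ (Sum.elim u w : C.ι ⊕ C.ι → _) =
      (Sum.elim (C.d *ᵥ u + f • w) (-(C.d *ᵥ w)) : C.ι ⊕ C.ι → _) := by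
  refine (fromBlocks_mulVec _ _ _ _ _).trans ?_
  simp [smul_mulVec, neg_mulVec]

/-- Each further element is added by coning off multiplication by it. The second copy carries the
differential with the opposite sign, which is why `d_t` is known only up to sign. -/
theorem exists_isKoszul {m : ℕ} (α : Fin m → MvPolynomial (Fin n) K) (δ : Fin m → ℤ)
    (hα : WeaklyRegularSeq α) (hδ : ∀ i, IsHomogeneousOfIntDegree (α i) (δ i)) :
    ∃ (C : GradedComplex n K) (o t : C.ι) (a b : Fin m → C.ι), IsKoszul C α δ o t a b := by
  induction m with
  | zero =>
    refine ⟨{ ι := Unit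
              lvl := fun _ => 0
              d := 0
              lvl_eq := fun _ _ h => absurd rfl h
              d_mul_d := mul_zero _
              deg := fun _ => 0
              homogeneous := fun _ _ => Or.inl rfl }, (), (), Fin.elim0, Fin.elim0, ?_⟩
    constructor
    · intro n hn v hv _
      exact ⟨0, fun _ _ => rfl, funext fun x => (hv x (by simpa using hn.ne)).symm ▸ by simp⟩
    all_goals simp [Function.Injective]
  | succ m ih =>
    obtain ⟨C, o, t, a, b, h⟩ := ih _ (fun i => δ i.castSucc) hα.castSucc fun i => hδ i.castSucc
    have hlo : C.lvl o = 0 := (h.lvl_eq_zero o).2 rfl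
    have hlt : C.lvl t = m := (h.lvl_eq_top t).2 rfl
    have hla : ∀ i, C.lvl (a i) = 1 := fun i => (h.lvl_eq_one _).2 ⟨i, rfl⟩
    have hlb : ∀ i, C.lvl (b i) + 1 = m := fun i => (h.lvl_add_one _).2 ⟨i, rfl⟩
    refine ⟨C.mulCone (α (Fin.last m)) (δ (Fin.last m)) (hδ _), Sum.inl o, Sum.inr t,
      Fin.snoc (fun i => Sum.inl (a i)) (Sum.inr o),
      Fin.snoc (fun i => Sum.inr (b i)) (Sum.inl t), ?_⟩
    constructor
    · intro l hl v hv hdv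
      obtain ⟨v₁, v₂, rfl⟩ : ∃ v₁ v₂ : C.ι → MvPolynomial (Fin n) K, v = Sum.elim v₁ v₂ :=
        ⟨fun x => v (Sum.inl x), fun x => v (Sum.inr x), by funext x; rcases x with x | x <;> rfl⟩
      have hv1 : C.Supp l v₁ := fun x hx => hv (Sum.inl x) hx
      have hv2 : C.Supp (l - 1) v₂ := fun x hx =>
        hv (Sum.inr x) (by show C.lvl x + 1 ≠ l; omega)
      rw [C.mulCone_mulVec] at hdv
      have e1 : C.d *ᵥ v₁ + α (Fin.last m) • v₂ = 0 := funext fun x => congrFun hdv (Sum.inl x)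
      have e2 : C.d *ᵥ v₂ = 0 :=
        neg_eq_zero.1 (funext fun x => congrFun hdv (Sum.inr x))
      obtain ⟨w, hw1, hw2⟩ : ∃ w, C.Supp l w ∧ C.d *ᵥ w = v₂ := by
        -- In degree one exactness is the regularity of the last element modulo the earlier ones; in
        -- higher degrees it is inherited from `C`.
        by_cases hl1 : l = 1
        · subst hl1
          have hv3 := eq_single_of_supp_zero h.lvl_eq_zero hv2
          rw [hv3]
          refine (h.mem_span_iff _).1 (hα.mem_of_mul_last_mem ?_)
          refine (h.mem_span_iff _).2 ⟨-v₁, hv1.neg, ?_⟩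
          rw [mulVec_neg, ← eq_neg_of_add_eq_zero_right e1, hv3]
          funext x
          by_cases hx : x = o
          · subst hx; simp [mul_comm]
          · simp [hx]
        · obtain ⟨w, hw1, hw2⟩ := h.exact (l - 1) (by omega) _ hv2 e2
          exact ⟨w, by rwa [show l - 1 + 1 = l by omega] at hw1, hw2⟩
      obtain ⟨u, hu1, hu2⟩ := h.exact l hl (v₁ + α (Fin.last m) • w)
        (hv1.add (hw1.smul _)) (by rw [mulVec_add, mulVec_smul, hw2, e1])
      refine ⟨(Sum.elim u (-w) : C.ι ⊕ C.ι → _), ?_, ?_⟩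
      · rintro (x | x) hx
        · exact hu1 x hx
        · have : C.lvl x ≠ l := fun h' => hx (by show C.lvl x + 1 = _; omega)
          simp [hw1 x this]
      · rw [C.mulCone_mulVec, hu2, mulVec_neg, hw2, neg_neg, smul_neg, add_neg_cancel_right]
    · rintro (x | x)
      · exact (h.lvl_le x).trans (Nat.le_succ m)
      · exact Nat.succ_le_succ (h.lvl_le x)
    · rintro (x | x)
      · exact (h.lvl_eq_zero x).trans Sum.inl_injective.eq_iff.symm
      · simp [GradedComplex.mulCone]
    · rintro (x | x)
      · have := h.lvl_le x
        simp only [GradedComplex.mulCone, Sum.elim_inl, reduceCtorEq, iff_false]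
        omega
      · have := h.lvl_eq_top x
        simp [GradedComplex.mulCone, this]
    · rintro (x | x)
      · simp only [GradedComplex.mulCone, Sum.elim_inl, h.lvl_eq_one x, Fin.exists_fin_succ']
        simp
      · have := h.lvl_eq_zero x
        simp [GradedComplex.mulCone, this, Fin.exists_fin_succ', eq_comm]
    · rintro (x | x)
      · have := h.lvl_eq_top x
        simp [GradedComplex.mulCone, this, Fin.exists_fin_succ', eq_comm]
      · have := h.lvl_add_one x
        simp [GradedComplex.mulCone, this, Fin.exists_fin_succ']
    · exact Fin.snoc_injective_iff.2 ⟨Sum.inl_injective.comp h.a_injective, fun ⟨_, h'⟩ => Sum.inl_ne_inr h'⟩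
    · exact Fin.snoc_injective_iff.2 ⟨Sum.inr_injective.comp h.b_injective, fun ⟨_, h'⟩ => Sum.inr_ne_inl h'⟩
    · exact h.deg_o
    · simp [GradedComplex.mulCone, h.deg_t, Fin.sum_univ_castSucc]
    · intro i
      refine Fin.lastCases ?_ (fun i => ?_) i
      · simp [GradedComplex.mulCone, h.deg_o]
      · simp [GradedComplex.mulCone, h.deg_a]
    · intro i
      refine Fin.lastCases ?_ (fun i => ?_) i
      · simp [GradedComplex.mulCone, h.deg_t, Fin.sum_univ_castSucc]
      · simp only [GradedComplex.mulCone, Fin.snoc_castSucc, Sum.elim_inr, h.deg_b,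
          Fin.sum_univ_castSucc]
        ring
    · intro i
      refine Fin.lastCases ?_ (fun i => ?_) i
      · simp [GradedComplex.mulCone]
      · simp [GradedComplex.mulCone, h.d_a]
    · intro i
      refine Fin.lastCases ?_ (fun i => ?_) i
      · simp [GradedComplex.mulCone]
      · simp only [GradedComplex.mulCone, Fin.snoc_castSucc, fromBlocks_apply₂₂, Matrix.neg_apply]
        rcases h.d_t i with h | h
        · right; rw [h]
        · left; rw [h, neg_neg]

end Koszul

open Matrix

/-! ### Homogeneous components of integer degree -/

section IntComponent

variable {K : Type*} [Field K] {n : ℕ}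

/-- The homogeneous component of degree `e : ℤ`, zero for negative `e`. -/
noncomputable def intComponent (e : ℤ) (f : MvPolynomial (Fin n) K) : MvPolynomial (Fin n) K :=
  if 0 ≤ e then MvPolynomial.homogeneousComponent e.toNat f else 0

theorem intComponent_isHomogeneous (e : ℤ) (f : MvPolynomial (Fin n) K) :
    IsHomogeneousOfIntDegree (intComponent e f) e := by
  unfold intComponent
  split_ifs with h
  · exact Or.inr ⟨e.toNat, by omega, MvPolynomial.homogeneousComponent_isHomogeneous _ _⟩
  · exact Or.inl rfl

theorem intComponent_sum {ι : Type*} (s : Finset ι) (e : ℤ) (f : ι → MvPolynomial (Fin n) K) :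
    intComponent e (∑ i ∈ s, f i) = ∑ i ∈ s, intComponent e (f i) := by
  unfold intComponent
  split_ifs with h
  · exact map_sum _ _ _
  · simp

theorem intComponent_eq_self {e : ℤ} {f : MvPolynomial (Fin n) K}
    (h : IsHomogeneousOfIntDegree f e) : intComponent e f = f := by
  unfold intComponent
  obtain rfl | ⟨m, hm, hf⟩ := h
  · simp
  · rw [if_pos (by omega), MvPolynomial.homogeneousComponent_of_mem hf, if_pos (by omega)]

theorem homogeneousComponent_mul_of_isHomogeneous {f : MvPolynomial (Fin n) K} {m : ℕ}
    (hf : f.IsHomogeneous m) (g : MvPolynomial (Fin n) K) (k : ℕ) :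
    MvPolynomial.homogeneousComponent (m + k) (f * g) =
      f * MvPolynomial.homogeneousComponent k g := by
  conv_lhs => rw [← MvPolynomial.sum_homogeneousComponent g, Finset.mul_sum, map_sum]
  have h : ∀ i, MvPolynomial.homogeneousComponent (m + k)
      (f * MvPolynomial.homogeneousComponent i g) =
        if i = k then f * MvPolynomial.homogeneousComponent k g else 0 := by
    intro i
    rw [MvPolynomial.homogeneousComponent_of_mem
      (hf.mul (MvPolynomial.homogeneousComponent_isHomogeneous i g))]
    by_cases hi : i = k
    · subst hi; simp
    · rw [if_neg (by omega), if_neg hi]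
  simp only [h, Finset.sum_ite_eq', Finset.mem_range]
  split_ifs with hk
  · rfl
  · rw [MvPolynomial.homogeneousComponent_eq_zero k g (by omega), mul_zero]

theorem homogeneousComponent_mul_of_lt {f : MvPolynomial (Fin n) K} {m : ℕ}
    (hf : f.IsHomogeneous m) (g : MvPolynomial (Fin n) K) {k : ℕ} (hk : k < m) :
    MvPolynomial.homogeneousComponent k (f * g) = 0 := by
  rw [← MvPolynomial.sum_homogeneousComponent g, Finset.mul_sum, map_sum]
  refine Finset.sum_eq_zero fun i _ => ?_
  rw [MvPolynomial.homogeneousComponent_of_mem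
      (hf.mul (MvPolynomial.homogeneousComponent_isHomogeneous i g)), if_neg (by omega)]

/-- This allows components to be taken entrywise in an identity between products with homogeneous
matrices. -/
theorem intComponent_mul {f : MvPolynomial (Fin n) K} {e : ℤ}
    (hf : IsHomogeneousOfIntDegree f e) (e' : ℤ) (g : MvPolynomial (Fin n) K) :
    intComponent e' (f * g) = f * intComponent (e' - e) g := by
  obtain rfl | ⟨m, hm, hf⟩ := hf
  · simp [intComponent]
  · unfold intComponent
    by_cases h : 0 ≤ e' - e
    · rw [if_pos (by omega), if_pos h, show e'.toNat = m + (e' - e).toNat by omega,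
        homogeneousComponent_mul_of_isHomogeneous hf]
    · rw [if_neg h, mul_zero]
      split_ifs with h'
      · exact homogeneousComponent_mul_of_lt hf g (by omega)
      · rfl

end IntComponent

/-! ### Resolutions of cyclic modules and comparison maps -/

/-- `F` is a graded free resolution of `R/I` of length at most `c`, with `F_0` generated by `o`. -/
structure IsResolution {n : ℕ} {K : Type*} [Field K] (F : GradedComplex n K)
    (I : Ideal (MvPolynomial (Fin n) K)) (c : ℕ) (o : F.ι) : Prop where
  exact : F.ExactAbove 0
  lvl_le : ∀ x, F.lvl x ≤ c
  lvl_eq_zero : ∀ x, F.lvl x = 0 ↔ x = o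
  deg_o : F.deg o = 0
  mem_iff : ∀ f, f ∈ I ↔ ∃ w, F.d *ᵥ w = Pi.single o f

section Resolution

variable {K : Type*} [Field K] {n : ℕ}

theorem LevelComplex.supp_iff {R : Type*} [CommRing R] (C : LevelComplex R) {m : ℕ}
    {v : C.ι → R} : C.Supp m v ↔ ∀ a, v a ≠ 0 → C.lvl a = m :=
  forall_congr' fun _ => not_imp_comm

theorem IsResolution.mulVec_single {F : GradedComplex n K} {I : Ideal (MvPolynomial (Fin n) K)}
    {c : ℕ} {o : F.ι} (h : IsResolution F I c o) {x : F.ι} (hx : F.lvl x = 1)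
    (r : MvPolynomial (Fin n) K) : F.d *ᵥ Pi.single x r = Pi.single o (F.d o x * r) := by
  have hs : F.Supp 1 (Pi.single x r) := hx ▸ F.supp_single x r
  rw [eq_single_of_supp_zero h.lvl_eq_zero hs.d_mulVec, Matrix.mulVec_single]
  simp [mul_comm]

theorem IsResolution.d_mem {F : GradedComplex n K} {I : Ideal (MvPolynomial (Fin n) K)}
    {c : ℕ} {o : F.ι} (h : IsResolution F I c o) (x : F.ι) : F.d o x ∈ I := by
  by_cases hx : F.lvl x = 1
  · exact (h.mem_iff _).2 ⟨_, by rw [h.mulVec_single hx 1, mul_one]⟩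
  · rw [F.d_eq_zero (by rw [(h.lvl_eq_zero o).2 rfl]; exact hx)]
    exact zero_mem _

theorem IsResolution.eq_span {F : GradedComplex n K} {I : Ideal (MvPolynomial (Fin n) K)}
    {c : ℕ} {o : F.ι} (h : IsResolution F I c o) : I = Ideal.span (Set.range (F.d o)) := by
  apply le_antisymm
  · intro f hf
    obtain ⟨w, hw⟩ := (h.mem_iff f).1 hf
    have := congrFun hw o
    rw [Pi.single_eq_same] at this
    rw [← this]
    exact Ideal.sum_mem _ fun x _ => Ideal.mul_mem_right _ _ (Ideal.subset_span ⟨x, rfl⟩)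
  · rw [Ideal.span_le]
    rintro _ ⟨x, rfl⟩
    exact h.d_mem x

theorem IsResolution.isHomogeneousIdeal {F : GradedComplex n K}
    {I : Ideal (MvPolynomial (Fin n) K)} {c : ℕ} {o : F.ι} (h : IsResolution F I c o) :
    IsHomogeneousIdeal I := by
  rw [h.eq_span]
  let _ : GradedAlgebra (MvPolynomial.homogeneousSubmodule (Fin n) K) :=
    MvPolynomial.gradedAlgebra
  refine Ideal.homogeneous_span _ _ ?_
  rintro _ ⟨x, rfl⟩
  obtain ⟨m, hm⟩ := (F.homogeneous o x).exists_isHomogeneous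
  exact ⟨m, hm⟩

/-- A homogeneous comparison map from the Koszul complex of a regular sequence in `I` to a
resolution of `R/I`, with prescribed values on the degree-one basis elements. -/
theorem exists_comparison {F C : GradedComplex n K} {I : Ideal (MvPolynomial (Fin n) K)}
    {c m : ℕ} {o' : F.ι} (hF : IsResolution F I c o') {α : Fin m → MvPolynomial (Fin n) K}
    {δ : Fin m → ℤ} {o t : C.ι} {a b : Fin m → C.ι} (hC : IsKoszul C α δ o t a b)
    (g : Fin m → F.ι → MvPolynomial (Fin n) K) (hgs : ∀ i, F.Supp 1 (g i))
    (hg : ∀ i, F.d *ᵥ g i = Pi.single o' (α i))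
    (hgh : ∀ i x, IsHomogeneousOfIntDegree (g i x) (δ i - F.deg x)) :
    ∃ φ : Matrix F.ι C.ι (MvPolynomial (Fin n) K),
      (∀ x y, φ x y ≠ 0 → F.lvl x = C.lvl y) ∧ F.d * φ = φ * C.d ∧
      (∀ x y, IsHomogeneousOfIntDegree (φ x y) (C.deg y - F.deg x)) ∧
      φ o' o = 1 ∧ ∀ i x, φ x (a i) = g i x := by
  have hlo : C.lvl o = 0 := (hC.lvl_eq_zero o).2 rfl
  have hlo' : F.lvl o' = 0 := (hF.lvl_eq_zero o').2 rfl
  have hla : ∀ i, C.lvl (a i) = 1 := fun i => (hC.lvl_eq_one _).2 ⟨i, rfl⟩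
  have hao : ∀ i, a i ≠ o := fun i h => by have := hla i; rw [h, hlo] at this; omega
  let X₀ : Matrix F.ι C.ι (MvPolynomial (Fin n) K) := Matrix.of fun x y =>
    if y = o then (Pi.single o' 1 : F.ι → MvPolynomial (Fin n) K) x
    else ∑ i, if y = a i then g i x else 0
  have hX₀o : ∀ x, X₀ x o = (Pi.single o' 1 : F.ι → MvPolynomial (Fin n) K) x :=
    fun x => if_pos rfl
  have hX₀a : ∀ i x, X₀ x (a i) = g i x := by
    intro i x
    refine (if_neg (hao i)).trans ?_
    rw [Finset.sum_eq_single i]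
    · simp
    · intro j _ hj
      rw [if_neg fun h => hj (hC.a_injective h).symm]
    · exact fun h => absurd (Finset.mem_univ i) h
  obtain ⟨φ, h1, h2, h3⟩ := LevelComplex.exists_lift C.toLevelComplex F.toLevelComplex 0 1 0
    hF.exact (by omega) 1 0 (fun _ _ h => absurd rfl h) (by simp) X₀ (by
      intro x y h
      by_cases hy : y = o
      · subst hy
        rw [hX₀o, Pi.single_apply] at h
        have hx : x = o' := by
          by_contra h'
          exact h (if_neg h')
        rw [hx, hlo, hlo']
      · by_cases hy1 : ∃ i, a i = y
        · obtain ⟨i, rfl⟩ := hy1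
          rw [hX₀a] at h
          rw [hla, add_zero]
          by_contra h'
          exact h (hgs i x h')
        · refine absurd ?_ h
          refine (if_neg hy).trans (Finset.sum_eq_zero fun i _ => if_neg fun h' => hy1 ⟨i, h'.symm⟩))
    (by
      intro y hy x
      have e : ((0 : Matrix F.ι C.ι (MvPolynomial (Fin n) K)) +
        (1 : MvPolynomial (Fin n) K) • (X₀ * C.d)) x y = (X₀ * C.d) x y := by simp
      rw [e]
      by_cases hy0 : y = o
      · subst hy0
        have e1 : (X₀ * C.d) x y = 0 :=
          Finset.sum_eq_zero fun z _ => mul_eq_zero_of_right _ (C.d_eq_zero (by omega))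
        have e2 : (F.d * X₀) x y = 0 := by
          refine Finset.sum_eq_zero fun z _ => ?_
          by_cases hz : z = o'
          · subst hz
            exact mul_eq_zero_of_left (F.d_eq_zero (by omega)) _
          · refine mul_eq_zero_of_right _ ?_
            show X₀ z y = 0
            rw [hX₀o, Pi.single_eq_of_ne hz]
        rw [e1, e2]
      · have hy1 : C.lvl y = 1 := by
          have : ¬C.lvl y = 0 := fun h => hy0 ((hC.lvl_eq_zero y).1 h)
          omega
        obtain ⟨i, rfl⟩ := (hC.lvl_eq_one y).1 hy1
        have e2 : (F.d * X₀) x (a i) = (F.d *ᵥ g i) x :=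
          Finset.sum_congr rfl fun z _ => congrArg (F.d x z * ·) (hX₀a i z)
        have e1 : (X₀ * C.d) x (a i) = X₀ x o * C.d o (a i) := by
          refine Finset.sum_eq_single o (fun z _ hz => mul_eq_zero_of_right _ (C.d_eq_zero ?_))
            (fun h => absurd (Finset.mem_univ o) h)
          have : ¬C.lvl z = 0 := fun h => hz ((hC.lvl_eq_zero z).1 h)
          omega
        rw [e1, e2, hg, hX₀o, hC.d_a, Pi.single_apply, Pi.single_apply]
        split_ifs <;> simp)
  have h2' : F.d * φ = φ * C.d := by simpa using h2
  -- Every entry is cut down to its component of the right degree. Commutation survives because both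
  -- differentials are homogeneous, and the prescribed entries already have that degree.
  refine ⟨Matrix.of fun x y => intComponent (C.deg y - F.deg x) (φ x y), ?_, ?_, ?_, ?_, ?_⟩
  · intro x y h
    refine h1 x y fun h' => h ?_
    simp [h', intComponent]
  · ext1 x y
    have e := congrArg (intComponent (C.deg y - F.deg x)) (congrFun (congrFun h2' x) y)
    rw [Matrix.mul_apply, Matrix.mul_apply, intComponent_sum, intComponent_sum] at e
    rw [Matrix.mul_apply, Matrix.mul_apply]
    refine Eq.trans (Finset.sum_congr rfl fun z _ => ?_) (e.trans (Finset.sum_congr rfl fun z _ => ?_))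
    · rw [intComponent_mul (F.homogeneous x z)]
      simp only [of_apply]
      congr 2
      ring
    · rw [mul_comm, intComponent_mul (C.homogeneous z y), mul_comm]
      simp only [of_apply]
      congr 2
      ring
  · exact fun x y => intComponent_isHomogeneous _ _
  · simp only [of_apply]
    rw [h3 o (by omega), hX₀o, Pi.single_eq_same, hC.deg_o, hF.deg_o]
    exact intComponent_eq_self IsHomogeneousOfIntDegree.one
  · intro i x
    simp only [of_apply]
    rw [h3 _ (hla i).le, hX₀a, hC.deg_a]
    exact intComponent_eq_self (hgh i x)

end Resolution

/-! ### The reduced mapping cone of a link -/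

/-- The data for a direct link: a resolution `F` of `R/I`, the Koszul complex `C` of a regular
sequence `α` in `I`, and a comparison map `φ` sending some of the degree-one basis elements of `C`
to basis elements of `F`, as recorded by the partial injection `U`. -/
structure LinkData (n : ℕ) (K : Type*) [Field K] (c : ℕ) where
  I : Ideal (MvPolynomial (Fin n) K)
  F : GradedComplex n K
  o' : F.ι
  res : IsResolution F I c o'
  α : Fin c → MvPolynomial (Fin n) K
  regular : WeaklyRegularSeq α
  δ : Fin c → ℤ
  C : GradedComplex n K
  o : C.ι
  t : C.ι
  a : Fin c → C.ι
  b : Fin c → C.ι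
  koszul : IsKoszul C α δ o t a b
  φ : Matrix F.ι C.ι (MvPolynomial (Fin n) K)
  φ_lvl : ∀ x y, φ x y ≠ 0 → F.lvl x = C.lvl y
  φ_comm : F.d * φ = φ * C.d
  φ_hom : ∀ x y, IsHomogeneousOfIntDegree (φ x y) (C.deg y - F.deg x)
  φ_o : φ o' o = 1
  U : Fin c → Option F.ι
  U_lvl : ∀ i x, U i = some x → F.lvl x = 1
  U_inj : ∀ i j x, U i = some x → U j = some x → i = j
  φ_U : ∀ i x, U i = some x → ∀ y, φ y (a i) = (Pi.single x 1 : F.ι → _) y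
  two_le : 2 ≤ c
  U_eq_none : c = 2 → ∀ i, U i = none

namespace LinkData

variable {K : Type*} [Field K] {n c : ℕ} (L : LinkData n K c)

/-- The basis elements of `F` surviving in the reduced mapping cone. -/
def KeepF (x : L.F.ι) : Prop := 1 ≤ L.F.lvl x ∧ ∀ i, L.U i ≠ some x

/-- The basis elements of `C` surviving in the reduced mapping cone. -/
def KeepC (y : L.C.ι) : Prop := 1 ≤ L.C.lvl y ∧ ∀ i, y = L.a i → L.U i = none

/-- The basis of the reduced mapping cone of `φ`. -/
abbrev ConeIdx : Type := {x // L.KeepF x} ⊕ {y // L.KeepC y}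

theorem lvl_o : L.C.lvl L.o = 0 := (L.koszul.lvl_eq_zero _).2 rfl

theorem lvl_o' : L.F.lvl L.o' = 0 := (L.res.lvl_eq_zero _).2 rfl

theorem lvl_t : L.C.lvl L.t = c := (L.koszul.lvl_eq_top _).2 rfl

theorem lvl_a (i : Fin c) : L.C.lvl (L.a i) = 1 := (L.koszul.lvl_eq_one _).2 ⟨i, rfl⟩

theorem lvl_b (i : Fin c) : L.C.lvl (L.b i) + 1 = c := (L.koszul.lvl_add_one _).2 ⟨i, rfl⟩

theorem keepF_of_two_le {x : L.F.ι} (h : 2 ≤ L.F.lvl x) : L.KeepF x :=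
  ⟨by omega, fun i hi => by have := L.U_lvl i x hi; omega⟩

theorem keepC_of_two_le {y : L.C.ι} (h : 2 ≤ L.C.lvl y) : L.KeepC y :=
  ⟨by omega, fun i hi => by have := L.lvl_a i; rw [← hi] at this; omega⟩

/-- For `c ≥ 3` these elements lie above level one and never cancel. For `c = 2` they are the
level-one elements themselves, which is why `U_eq_none` forbids cancellation there: they must
survive as generators of the linked ideal. -/
theorem keepC_of_lvl_add_one {y : L.C.ι} (h : L.C.lvl y + 1 = c) : L.KeepC y := by
  have := L.two_le
  by_cases hc : c = 2
  · exact ⟨by omega, fun i _ => L.U_eq_none hc i⟩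
  · exact L.keepC_of_two_le (by omega)

theorem φ_mulVec_supp {m : ℕ} {v : L.C.ι → MvPolynomial (Fin n) K} (hv : L.C.Supp m v) :
    L.F.Supp m (L.φ *ᵥ v) := by
  intro x hx
  refine Finset.sum_eq_zero fun y _ => ?_
  by_contra h
  have h1 := L.φ_lvl x y (left_ne_zero_of_mul h)
  exact right_ne_zero_of_mul h (hv y (by omega))

theorem φ_d (v : L.C.ι → MvPolynomial (Fin n) K) :
    L.F.d *ᵥ (L.φ *ᵥ v) = L.φ *ᵥ (L.C.d *ᵥ v) := by
  rw [mulVec_mulVec, L.φ_comm, ← mulVec_mulVec]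

/-- Restriction of a pair of vectors to the basis of the reduced cone. -/
def restrict (f : L.F.ι → MvPolynomial (Fin n) K) (k : L.C.ι → MvPolynomial (Fin n) K) :
    L.ConeIdx → MvPolynomial (Fin n) K := Sum.elim (fun x => f x.1) (fun y => k y.1)

open Classical in
/-- Extension by zero. -/
noncomputable def extF (v : L.ConeIdx → MvPolynomial (Fin n) K) (x : L.F.ι) :
    MvPolynomial (Fin n) K := if h : L.KeepF x then v (Sum.inl ⟨x, h⟩) else 0

open Classical in
/-- Extension by zero. -/
noncomputable def extC (v : L.ConeIdx → MvPolynomial (Fin n) K) (y : L.C.ι) :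
    MvPolynomial (Fin n) K := if h : L.KeepC y then v (Sum.inr ⟨y, h⟩) else 0

theorem restrict_ext (v : L.ConeIdx → MvPolynomial (Fin n) K) :
    L.restrict (L.extF v) (L.extC v) = v := by
  funext x
  rcases x with ⟨x, hx⟩ | ⟨y, hy⟩
  · exact dif_pos hx
  · exact dif_pos hy

/-- The matrix of the reduced cone. -/
noncomputable def coneMatrix : Matrix L.ConeIdx L.ConeIdx (MvPolynomial (Fin n) K) :=
  fromBlocks (L.F.d.submatrix Subtype.val Subtype.val) (L.φ.submatrix Subtype.val Subtype.val) 0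
    (-(L.C.d.submatrix Subtype.val Subtype.val))

noncomputable instance : Fintype L.ConeIdx := by
  classical exact inferInstance

theorem sum_subtype_eq {ι : Type*} [Fintype ι] (p : ι → Prop) [Fintype {x // p x}]
    (g : ι → MvPolynomial (Fin n) K) (h : ∀ x, ¬p x → g x = 0) :
    ∑ x : {x // p x}, g x.1 = ∑ x, g x := by
  refine Finset.sum_of_injOn Subtype.val Subtype.val_injective.injOn (fun _ _ => by simp)
    (fun x _ hx => h x fun hp => hx ?_) fun _ _ => rfl
  exact ⟨⟨x, hp⟩, by simp, rfl⟩

/-- Restriction commutes with the differentials. -/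
theorem coneMatrix_mulVec_restrict (f : L.F.ι → MvPolynomial (Fin n) K)
    (k : L.C.ι → MvPolynomial (Fin n) K) :
    L.coneMatrix *ᵥ L.restrict f k =
      L.restrict (L.F.d *ᵥ f + L.φ *ᵥ k) (-(L.C.d *ᵥ k)) := by
  classical
  have hsum : ∀ (g : L.ConeIdx → MvPolynomial (Fin n) K), ∑ p, g p =
      ∑ x : {x // L.KeepF x}, g (Sum.inl x) + ∑ y : {y // L.KeepC y}, g (Sum.inr y) := by
    intro g
    rw [← Fintype.sum_sum_type]
  funext p
  refine (hsum _).trans ?_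
  rcases p with ⟨x, hx⟩ | ⟨y, hy⟩
  · refine congrArg₂ (· + ·) ?_ ?_
    · refine sum_subtype_eq _ (fun z => L.F.d x z * f z) fun z hz => ?_
      refine mul_eq_zero_of_left (L.F.d_eq_zero fun h => hz (L.keepF_of_two_le ?_)) _
      have := hx.1
      omega
    · refine sum_subtype_eq _ (fun z => L.φ x z * k z) fun z hz => ?_
      refine mul_eq_zero_of_left ?_ _
      by_contra h
      refine hz ⟨?_, fun i hi => ?_⟩
      · rw [← L.φ_lvl x z h]
        exact hx.1
      · by_contra hU
        obtain ⟨x', hx'⟩ := Option.ne_none_iff_exists'.1 hU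
        rw [hi, L.φ_U i x' hx'] at h
        refine hx.2 i ?_
        rw [hx']
        by_contra h'
        exact h (Pi.single_eq_of_ne (fun e => h' (by rw [e])) _)
  · have e1 : ∑ x : {x // L.KeepF x}, L.coneMatrix (Sum.inr ⟨y, hy⟩) (Sum.inl x) *
        L.restrict f k (Sum.inl x) = 0 := Finset.sum_eq_zero fun _ _ => zero_mul _
    refine (congrArg₂ (· + ·) e1 ?_).trans (zero_add _)
    refine (sum_subtype_eq _ (fun z => -L.C.d y z * k z) fun z hz => ?_).trans ?_
    · refine mul_eq_zero_of_left (neg_eq_zero.2 (L.C.d_eq_zero fun h => hz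
        (L.keepC_of_two_le ?_))) _
      have := hy.1
      omega
    · simp only [neg_mul, Finset.sum_neg_distrib]
      rfl

theorem coneMatrix_mul_self : L.coneMatrix * L.coneMatrix = 0 := by
  classical
  refine ext_of_mulVec_single fun p => ?_
  rw [zero_mulVec, ← mulVec_mulVec, ← L.restrict_ext (Pi.single p 1),
    coneMatrix_mulVec_restrict, coneMatrix_mulVec_restrict, mulVec_add, L.F.d_mulVec_d_mulVec,
    mulVec_neg, mulVec_neg, L.C.d_mulVec_d_mulVec, L.φ_d]
  funext p
  rcases p with p | p <;> simp [restrict]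

/-- The reduced mapping cone of `φ`, a free resolution of `I/(α)` starting in degree one. -/
noncomputable def cone : LevelComplex (MvPolynomial (Fin n) K) where
  ι := L.ConeIdx
  decEq := Classical.decEq _
  lvl := Sum.elim (fun x => L.F.lvl x.1) fun y => L.C.lvl y.1 + 1
  d := L.coneMatrix
  lvl_eq := by
    rintro (x | x) (y | y) h
    · exact L.F.lvl_eq x.1 y.1 h
    · simp [L.φ_lvl x.1 y.1 h]
    · exact absurd rfl h
    · have := L.C.lvl_eq x.1 y.1 fun h' => h (neg_eq_zero.2 h')
      simp [this]
  d_mul_d := L.coneMatrix_mul_self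

theorem one_le_cone_lvl (p : L.cone.ι) : 1 ≤ L.cone.lvl p := by
  rcases p with x | y
  · exact x.2.1
  · exact Nat.succ_le_succ (Nat.zero_le _)

theorem cone_lvl_le (p : L.cone.ι) : L.cone.lvl p ≤ c + 1 := by
  rcases p with x | y
  · exact (L.res.lvl_le x.1).trans (Nat.le_succ c)
  · exact Nat.succ_le_succ (L.koszul.lvl_le y.1)

/-- Both complexes have homology only in level zero, so that of the cone is the kernel of `R/(α) →
R/I`. Discarding `o`, `o'` and the pairs `U i`, `a i` removes contractible pieces, since `φ` is the
identity on them. A vector extended by zero need not be a cycle of the full cone; it is corrected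
first, then exactness of `C` and of `F` is used in turn. -/
theorem cone_exactAbove : L.cone.ExactAbove 1 := by
  intro m hm v hv hdv
  have hf : L.F.Supp m (L.extF v) := by
    intro x hx
    unfold extF
    split_ifs with h
    · exact hv (Sum.inl ⟨x, h⟩) hx
    · rfl
  have hk : L.C.Supp (m - 1) (L.extC v) := by
    intro x hx
    unfold extC
    split_ifs with h
    · exact hv (Sum.inr ⟨x, h⟩) (by show L.C.lvl x + 1 ≠ m; omega)
    · rfl
  rw [← L.restrict_ext v] at hdv ⊢
  generalize L.extF v = f at *
  generalize L.extC v = k at *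
  have hdv' := (L.coneMatrix_mulVec_restrict f k).symm.trans hdv
  have e1 : ∀ x, L.KeepF x → (L.F.d *ᵥ f + L.φ *ᵥ k) x = 0 := fun x hx =>
    congrFun hdv' (Sum.inl ⟨x, hx⟩)
  have e2 : ∀ y, L.KeepC y → (L.C.d *ᵥ k) y = 0 := fun y hy =>
    neg_eq_zero.1 (congrFun hdv' (Sum.inr ⟨y, hy⟩))
  obtain ⟨m, rfl⟩ : ∃ m', m = m' + 1 := ⟨m - 1, by omega⟩
  rw [Nat.add_sub_cancel] at hk
  have hz : L.F.Supp m (L.F.d *ᵥ f + L.φ *ᵥ k) := (hf.d_mulVec).add (L.φ_mulVec_supp hk)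
  generalize hzdef : L.F.d *ᵥ f + L.φ *ᵥ k = z at *
  -- The defect `z` of the cycle condition is supported on the discarded `U i`; the vector `k'` on
  -- the discarded `a i` satisfies `φ k' = z` and absorbs it.
  let g : Fin c → MvPolynomial (Fin n) K := fun i => (L.U i).elim 0 z
  have hg : ∀ i x, L.U i = some x → g i = z x := fun i x h => by simp [g, h]
  have hg0 : ∀ i, L.U i = none → g i = 0 := fun i h => by simp [g, h]
  let k' : L.C.ι → MvPolynomial (Fin n) K := ∑ i, Pi.single (L.a i) (g i)
  have hgm : m ≠ 1 → ∀ i, g i = 0 := by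
    intro hm1 i
    rcases h : L.U i with _ | x
    · exact hg0 i h
    · rw [hg i x h]
      exact hz x (by rw [L.U_lvl i x h]; exact hm1.symm)
  have hk'0 : m ≠ 1 → k' = 0 := fun hm1 =>
    Finset.sum_eq_zero fun i _ => by rw [hgm hm1 i, Pi.single_zero]
  have hk's : L.C.Supp m k' := by
    by_cases hm1 : m = 1
    · subst hm1
      intro y hy
      refine (Finset.sum_apply _ _ _).trans (Finset.sum_eq_zero fun i _ => ?_)
      refine Pi.single_eq_of_ne ?_ _
      rintro rfl
      exact hy (L.lvl_a i)
    · rw [hk'0 hm1]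
      exact fun _ _ => rfl
  have hk'keep : ∀ y, L.KeepC y → k' y = 0 := by
    intro y hy
    refine (Finset.sum_apply _ _ _).trans (Finset.sum_eq_zero fun i _ => ?_)
    by_cases h : y = L.a i
    · rw [hg0 i (hy.2 i h), Pi.single_zero]; rfl
    · exact Pi.single_eq_of_ne h _
  have hφk' : L.φ *ᵥ k' = z := by
    have h1 : L.φ *ᵥ k' = ∑ i, L.φ *ᵥ Pi.single (L.a i) (g i) := by
      simp only [k', ← mulVecLin_apply, map_sum]
    funext x
    rw [h1, Finset.sum_apply]
    simp only [mulVec_single, Pi.smul_apply, col_apply, MulOpposite.smul_eq_mul_unop,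
      MulOpposite.unop_op]
    by_cases hx : ∃ i, L.U i = some x
    · obtain ⟨i, hi⟩ := hx
      rw [Finset.sum_eq_single i, L.φ_U i x hi, Pi.single_eq_same, one_mul, hg i x hi]
      · intro j _ hj
        rcases h : L.U j with _ | x'
        · rw [hg0 j h, mul_zero]
        · rw [L.φ_U j x' h, Pi.single_eq_of_ne, zero_mul]
          rintro rfl
          exact hj (L.U_inj j i _ h hi)
      · exact fun h => absurd (Finset.mem_univ i) h
    · rw [Finset.sum_eq_zero]
      · by_cases hxm : L.F.lvl x = m
        · exact (e1 x ⟨by omega, fun i hi => hx ⟨i, hi⟩⟩).symm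
        · exact (hz x hxm).symm
      · intro j _
        rcases h : L.U j with _ | x'
        · rw [hg0 j h, mul_zero]
        · rw [L.φ_U j x' h, Pi.single_eq_of_ne, zero_mul]
          rintro rfl
          exact hx ⟨j, h⟩
  have hks : L.C.Supp m (k - k') := hk.sub hk's
  have e3 : L.F.d *ᵥ f = -(L.φ *ᵥ (k - k')) := by
    rw [mulVec_sub, hφk', ← hzdef]
    abel
  have e4 : L.φ *ᵥ (L.C.d *ᵥ (k - k')) = 0 := by
    rw [← L.φ_d, ← neg_eq_zero, ← mulVec_neg, ← e3, L.F.d_mulVec_d_mulVec]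
  -- `φ` kills this vector. In level zero `φ_o` makes it zero; elsewhere the kept coordinates vanish
  -- by `e2`, and a discarded coordinate `a i` is read off from row `U i` of `φ`.
  have e5 : L.C.d *ᵥ (k - k') = 0 := by
    obtain ⟨m, rfl⟩ : ∃ m', m = m' + 1 := ⟨m - 1, by omega⟩
    by_cases hm0 : m = 0
    · subst hm0
      have h1 := eq_single_of_supp_zero L.koszul.lvl_eq_zero hks.d_mulVec
      have h2 := congrFun e4 L.o'
      rw [h1, mulVec_single] at h2
      simp only [Pi.smul_apply, col_apply, L.φ_o, MulOpposite.smul_eq_mul_unop,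
        MulOpposite.unop_op, one_mul, Pi.zero_apply] at h2
      rw [h1, h2, Pi.single_zero]
    · have hk0 := hk'0 (by omega)
      rw [hk0, sub_zero] at e4 ⊢
      funext y
      by_cases hy : L.KeepC y
      · exact e2 y hy
      by_cases hym : L.C.lvl y = m
      · have hy' : ∃ i, y = L.a i ∧ L.U i ≠ none := by
          by_contra h
          push Not at h
          exact hy ⟨by omega, h⟩
        obtain ⟨i, rfl, hU⟩ := hy'
        obtain ⟨x, hx⟩ := Option.ne_none_iff_exists'.1 hU
        have h2 := congrFun e4 x
        have h3 : (L.φ *ᵥ (L.C.d *ᵥ k)) x = L.φ x (L.a i) * (L.C.d *ᵥ k) (L.a i) := by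
          refine Finset.sum_eq_single (L.a i) (fun y' _ hy' => ?_)
            fun h => absurd (Finset.mem_univ _) h
          by_cases hk' : L.KeepC y'
          · exact mul_eq_zero_of_right _ (e2 y' hk')
          · by_cases hl : 1 ≤ L.C.lvl y'
            · have hy' : ∃ i, y' = L.a i ∧ L.U i ≠ none := by
                by_contra h
                push Not at h
                exact hk' ⟨hl, h⟩
              obtain ⟨j, rfl, hU'⟩ := hy'
              obtain ⟨x', hx'⟩ := Option.ne_none_iff_exists'.1 hU'
              refine mul_eq_zero_of_left ?_ _
              change L.φ x (L.a j) = 0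
              rw [L.φ_U j x' hx', Pi.single_eq_of_ne]
              rintro rfl
              exact hy' (by rw [L.U_inj i j _ hx hx'])
            · refine mul_eq_zero_of_left ?_ _
              by_contra h
              have h1 := L.φ_lvl _ _ h
              have h2 := L.U_lvl i x hx
              omega
        rw [h3, L.φ_U i x hx, Pi.single_eq_same, one_mul] at h2
        exact h2
      · exact (hk.d_mulVec) y hym
  obtain ⟨k₂, hk₂, hk₂'⟩ := L.koszul.exact m (by omega) _ hks e5
  obtain ⟨f₃, hf₃, hf₃'⟩ := L.res.exact (m + 1) (by omega) (f + L.φ *ᵥ k₂)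
    (hf.add (L.φ_mulVec_supp hk₂)) (by rw [mulVec_add, e3, L.φ_d, hk₂', neg_add_cancel])
  refine ⟨L.restrict f₃ (-k₂), ?_, ?_⟩
  · rintro (x | y) hp
    · exact hf₃ x.1 hp
    · refine neg_eq_zero.2 (hk₂ y.1 fun h => hp ?_)
      show L.C.lvl y.1 + 1 = _
      rw [h]
  · refine (L.coneMatrix_mulVec_restrict _ _).trans ?_
    rw [hf₃', mulVec_neg, mulVec_neg, hk₂', neg_neg, add_neg_cancel_right]
    funext p
    rcases p with x | y
    · rfl
    · show (k - k') y.1 = k y.1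
      rw [Pi.sub_apply, hk'keep _ y.2, sub_zero]

theorem d_mulVec_φ_col (i : Fin c) :
    L.F.d *ᵥ (fun x => L.φ x (L.a i)) = Pi.single L.o' (L.α i) := by
  have hs : L.F.Supp 1 (fun x => L.φ x (L.a i)) := by
    rw [L.F.supp_iff]
    intro x hx
    rw [L.φ_lvl _ _ hx, L.lvl_a]
  rw [eq_single_of_supp_zero L.res.lvl_eq_zero hs.d_mulVec]
  congr 1
  have e := congrFun (congrFun L.φ_comm L.o') (L.a i)
  refine e.trans ?_
  refine (Finset.sum_eq_single L.o (fun z _ hz => ?_)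
    fun h => absurd (Finset.mem_univ _) h).trans ?_
  · refine mul_eq_zero_of_right _ (L.C.d_eq_zero ?_)
    have : ¬L.C.lvl z = 0 := fun h => hz ((L.koszul.lvl_eq_zero z).1 h)
    have := L.lvl_a i
    omega
  · show L.φ L.o' L.o * L.C.d L.o (L.a i) = _
    rw [L.φ_o, L.koszul.d_a, one_mul]

theorem α_mem (i : Fin c) : L.α i ∈ L.I := (L.res.mem_iff _).2 ⟨_, L.d_mulVec_φ_col i⟩

theorem span_le : Ideal.span (Set.range L.α) ≤ L.I := by
  rw [Ideal.span_le]
  rintro _ ⟨i, rfl⟩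
  exact L.α_mem i

/-- The regular sequence annihilates the lowest homology of the reduced cone. -/
theorem exists_cone_preimage (i : Fin c) (p : L.cone.ι) (hp : L.cone.lvl p = 1) :
    ∃ w, L.cone.d *ᵥ w = Pi.single p (L.α i) := by
  classical
  rcases p with ⟨x, hx⟩ | y
  swap
  · have h1 : L.C.lvl y.1 + 1 = 1 := hp
    have h2 := y.2.1
    omega
  have hx1 : L.F.lvl x = 1 := hp
  -- Both terms of the difference have boundary `d(x) α_i` in `F_0`, so the difference is a cycle.
  obtain ⟨g, -, hg⟩ := L.res.exact 1 (by omega)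
    (Pi.single x (L.α i) - L.F.d L.o' x • fun z => L.φ z (L.a i))
    ((hx1 ▸ L.F.supp_single x _).sub (LevelComplex.Supp.smul _ (by
      rw [L.F.supp_iff]
      intro x hx
      rw [L.φ_lvl _ _ hx, L.lvl_a])))
    (by
      rw [mulVec_sub, L.res.mulVec_single hx1, mulVec_smul, L.d_mulVec_φ_col, ← Pi.single_smul,
        smul_eq_mul, sub_self])
  refine ⟨L.restrict g (Pi.single (L.a i) (L.F.d L.o' x)), ?_⟩
  refine (L.coneMatrix_mulVec_restrict _ _).trans ?_
  have e : L.φ *ᵥ Pi.single (L.a i) (L.F.d L.o' x) =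
      L.F.d L.o' x • fun z => L.φ z (L.a i) := by
    rw [mulVec_single]
    funext z
    simp [mul_comm]
  rw [hg, e, sub_add_cancel]
  funext p
  rcases p with z | y
  · show (Pi.single x (L.α i) : L.F.ι → _) z.1 = _
    by_cases h : z = ⟨x, hx⟩
    · subst h
      exact (Pi.single_eq_same _ _).trans (Pi.single_eq_same (M := fun _ : L.cone.ι => _) _ _).symm
    · refine (Pi.single_eq_of_ne (fun h' => h (Subtype.ext h')) _).trans
        (Pi.single_eq_of_ne (M := fun _ : L.cone.ι => _) ?_ _).symm
      exact fun h' => h (Sum.inl_injective h')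
  · refine Eq.trans ?_ (Pi.single_eq_of_ne (M := fun _ : L.cone.ι => _) Sum.inr_ne_inl _).symm
    refine neg_eq_zero.2 ?_
    have hs : L.C.Supp 1 (Pi.single (L.a i) (L.F.d L.o' x)) := L.lvl_a i ▸ L.C.supp_single _ _
    refine hs.d_mulVec y.1 ?_
    have := y.2.1
    omega

/-- The lowest homology of the cone is `I/(α)`, killed by the regular sequence `α`; this is the
vanishing of `Ext^j(I/(α), R)` for `j < c`, shifted by one because the cone starts in degree one. -/
theorem cone_dual_exact (m : ℕ) (hm : m < 1 + c) (u : L.cone.ι → MvPolynomial (Fin n) K)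
    (hu : L.cone.Supp m u) (hdu : L.cone.dᵀ *ᵥ u = 0) :
    ∃ w, (∀ p, L.cone.lvl p + 1 ≠ m → w p = 0) ∧ L.cone.dᵀ *ᵥ w = u :=
  L.cone.dual_exact_of_weaklyRegularSeq 1 L.one_le_cone_lvl L.cone_exactAbove L.α L.regular
    L.exists_cone_preimage m hm u hu hdu

end LinkData

/-! ### The dual cone and the linked ideal -/

namespace LevelComplex

variable {R : Type*} [CommRing R]

/-- The dual complex, with homological degrees counted from `m` downwards. -/
def dual (C : LevelComplex R) (m : ℕ) (hm : ∀ x, C.lvl x ≤ m) : LevelComplex R where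
  ι := C.ι
  lvl x := m - C.lvl x
  d := C.dᵀ
  lvl_eq x y h := by
    have h1 := C.lvl_eq y x h
    have h2 := hm x
    omega
  d_mul_d := by rw [← transpose_mul, C.d_mul_d, transpose_zero]

theorem dual_exactAbove (C : LevelComplex R) (m : ℕ) (hm : ∀ x, C.lvl x ≤ m)
    (h : ∀ l < m, ∀ u, C.Supp l u → C.dᵀ *ᵥ u = 0 →
      ∃ w, (∀ a, C.lvl a + 1 ≠ l → w a = 0) ∧ C.dᵀ *ᵥ w = u) : (C.dual m hm).ExactAbove 0 := by
  intro l hl v hv hdv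
  by_cases hlm : l ≤ m
  · obtain ⟨w, hw, hw'⟩ := h (m - l) (by omega) v (fun x hx => hv x (by
      show m - C.lvl x ≠ l
      have := hm x
      omega)) hdv
    refine ⟨w, fun x hx => hw x fun h' => hx ?_, hw'⟩
    show m - C.lvl x = l + 1
    omega
  · refine ⟨0, fun _ _ => rfl, ?_⟩
    rw [mulVec_zero]
    funext x
    refine (hv x ?_).symm
    show m - C.lvl x ≠ l
    omega

end LevelComplex

namespace LinkData

variable {K : Type*} [Field K] {n c : ℕ} (L : LinkData n K c)

/-- The ideal linked to `I` by the regular sequence `α`. -/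
noncomputable def J : Ideal (MvPolynomial (Fin n) K) :=
  (Ideal.span (Set.range L.α)).colon (L.I : Set (MvPolynomial (Fin n) K))

/-- The dual of the reduced mapping cone, which resolves `R/J`. -/
noncomputable def G : GradedComplex n K where
  toLevelComplex := L.cone.dual (c + 1) L.cone_lvl_le
  deg := Sum.elim (fun x => ∑ i, L.δ i - L.F.deg x.1) fun y => ∑ i, L.δ i - L.C.deg y.1
  homogeneous := by
    rintro (x | x) (y | y)
    · have := L.F.homogeneous y.1 x.1
      rwa [show L.F.deg x.1 - L.F.deg y.1 = (∑ i, L.δ i - L.F.deg y.1) -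
        (∑ i, L.δ i - L.F.deg x.1) by ring] at this
    · exact Or.inl rfl
    · have := L.φ_hom y.1 x.1
      rwa [show L.C.deg x.1 - L.F.deg y.1 = (∑ i, L.δ i - L.F.deg y.1) -
        (∑ i, L.δ i - L.C.deg x.1) by ring] at this
    · have := (L.C.homogeneous y.1 x.1).neg
      rwa [show L.C.deg x.1 - L.C.deg y.1 = (∑ i, L.δ i - L.C.deg y.1) -
        (∑ i, L.δ i - L.C.deg x.1) by ring] at this

theorem keepC_t : L.KeepC L.t :=
  L.keepC_of_two_le (by rw [L.lvl_t]; exact L.two_le)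

/-- The bottom basis element of the resolution of `R/J`. -/
def bot : L.cone.ι := Sum.inr ⟨L.t, L.keepC_t⟩

theorem cone_lvl_eq_top (p : L.cone.ι) : L.cone.lvl p = c + 1 ↔ p = L.bot := by
  rcases p with x | y
  · have := L.res.lvl_le x.1
    refine iff_of_false (fun h => ?_) Sum.inl_ne_inr
    have h' : L.F.lvl x.1 = c + 1 := h
    omega
  · refine Iff.trans ?_ (Sum.inr_injective.eq_iff.trans Subtype.ext_iff).symm
    rw [← L.koszul.lvl_eq_top]
    exact Nat.succ_inj

theorem G_lvl_eq_zero (p : L.G.ι) : L.G.lvl p = 0 ↔ p = L.bot := by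
  refine Iff.trans ?_ (L.cone_lvl_eq_top p)
  have := L.cone_lvl_le p
  show c + 1 - L.cone.lvl p = 0 ↔ _
  omega

theorem d_b_mem (y : L.C.ι) : L.C.d y L.t ∈ Ideal.span (Set.range L.α) := by
  by_cases hy : L.C.lvl y + 1 = c
  · obtain ⟨i, rfl⟩ := (L.koszul.lvl_add_one y).1 hy
    have : L.α i ∈ Ideal.span (Set.range L.α) := Ideal.subset_span ⟨i, rfl⟩
    rcases L.koszul.d_t i with h | h
    · rwa [h]
    · rw [h]
      exact neg_mem this
  · rw [L.C.d_eq_zero (by rw [L.lvl_t]; omega)]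
    exact zero_mem _

open Classical in
theorem cone_sum (g : L.ConeIdx → MvPolynomial (Fin n) K) : ∑ p : L.cone.ι, g p =
    ∑ x : {x // L.KeepF x}, g (Sum.inl x) + ∑ y : {y // L.KeepC y}, g (Sum.inr y) := by
  rw [← Fintype.sum_sum_type]
  refine Finset.sum_congr ?_ fun _ _ => rfl
  ext
  exact iff_of_true (Finset.mem_univ _) (Finset.mem_univ _)

/-- The image of the last map of the dual cone is thus generated by the entries `φ x t` and by the
entries of the Koszul differential at `t`, which are `±α i` or zero. -/
theorem cone_sum_eq (f : L.F.ι → MvPolynomial (Fin n) K) (k : L.C.ι → MvPolynomial (Fin n) K) :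
    (L.cone.dᵀ *ᵥ (L.restrict f k : L.cone.ι → _)) L.bot =
      ∑ x, L.φ x L.t * f x - ∑ y, L.C.d y L.t * k y := by
  classical
  have h2 := L.two_le
  refine (L.cone_sum _).trans ?_
  rw [sub_eq_add_neg]
  refine congrArg₂ (· + ·) ?_ ?_
  · refine sum_subtype_eq _ (fun z => L.φ z L.t * f z) fun z hz => ?_
    refine mul_eq_zero_of_left ?_ _
    by_contra h
    have := L.φ_lvl _ _ h
    rw [L.lvl_t] at this
    exact hz (L.keepF_of_two_le (by omega))
  · refine (sum_subtype_eq _ (fun z => -L.C.d z L.t * k z) fun z hz => ?_).trans ?_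
    · refine mul_eq_zero_of_left (neg_eq_zero.2 (L.C.d_eq_zero fun h => hz
        (L.keepC_of_lvl_add_one ?_))) _
      rw [L.lvl_t] at h
      exact h.symm
    · simp only [neg_mul, Finset.sum_neg_distrib]

/-- Multiplication by `r ∈ I` is zero on `R/I`, so `r • φ` is null homotopic. At the top of the
Koszul complex one term of the homotopy lands above the length of `F` and vanishes; the other passes
through the differential at `t`, whose entries lie in `(α)`. -/
theorem φ_t_mul_mem (x : L.F.ι) {r : MvPolynomial (Fin n) K} (hr : r ∈ L.I) :
    r * L.φ x L.t ∈ Ideal.span (Set.range L.α) := by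
  classical
  obtain ⟨w, hw⟩ := (L.res.mem_iff r).1 hr
  have hw0 : L.F.Supp 0 (Pi.single L.o' r) := L.lvl_o' ▸ L.F.supp_single _ _
  obtain ⟨w, hws, hw⟩ := L.F.exists_supp_of_mulVec_eq hw0 hw
  let X₀ : Matrix L.F.ι L.C.ι (MvPolynomial (Fin n) K) :=
    Matrix.of fun x y => if y = L.o then w x else 0
  obtain ⟨s, hs1, hs2, -⟩ := LevelComplex.exists_lift L.C.toLevelComplex L.F.toLevelComplex 0 0 1
    L.res.exact (by omega) (-1) (r • L.φ)
    (by
      intro a y h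
      rw [L.φ_lvl a y fun h' => h (by simp [h'])])
    (by rw [Matrix.mul_smul, Matrix.smul_mul, L.φ_comm]; simp) X₀
    (by
      intro x y h
      by_cases hy : y = L.o
      · subst hy
        rw [L.lvl_o]
        by_contra h'
        exact h ((if_pos rfl).trans (hws x h'))
      · exact absurd (if_neg hy) h)
    (by
      intro y hy x
      have hy' : y = L.o := (L.koszul.lvl_eq_zero y).1 (by omega)
      subst hy'
      have e1 : (X₀ * L.C.d) x L.o = 0 := Finset.sum_eq_zero fun z _ =>
        mul_eq_zero_of_right _ (L.C.d_eq_zero (by rw [L.lvl_o]; omega))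
      have e2 : (L.F.d * X₀) x L.o = (L.F.d *ᵥ w) x :=
        Finset.sum_congr rfl fun z _ => congrArg (L.F.d x z * ·) (if_pos rfl)
      rw [Matrix.add_apply, Matrix.smul_apply, Matrix.smul_apply, e1, e2, hw, smul_zero, add_zero]
      by_cases hx : x = L.o'
      · subst hx
        rw [Pi.single_eq_same, L.φ_o, smul_eq_mul, mul_one]
      · rw [Pi.single_eq_of_ne hx]
        have : L.φ x L.o = 0 := by
          by_contra h
          exact hx ((L.res.lvl_eq_zero x).1 (by rw [L.φ_lvl _ _ h, L.lvl_o]))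
        rw [this, smul_zero])
  have e := congrFun (congrFun hs2 x) L.t
  have e1 : (L.F.d * s) x L.t = 0 := Finset.sum_eq_zero fun z _ => by
    refine mul_eq_zero_of_right _ ?_
    by_contra h
    have h1 := hs1 z L.t h
    have h2 := L.res.lvl_le z
    rw [L.lvl_t] at h1
    omega
  rw [e1] at e
  simp only [Matrix.add_apply, Matrix.smul_apply, smul_eq_mul, neg_mul, one_mul] at e
  rw [eq_neg_of_add_eq_zero_left e.symm, neg_neg]
  exact Ideal.sum_mem _ fun y _ => Ideal.mul_mem_left _ _ (L.d_b_mem y)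

/-- Multiplication by `f` is a map `R/I → R/(α)` and lifts to `χ : F → C`. The composite `χ φ` and
`f` induce the same map on `R/(α)`, hence are homotopic, and the homotopy read at `t` expresses `f`
by the last column of the cone. -/
theorem exists_of_mul_mem {f : MvPolynomial (Fin n) K}
    (hf : ∀ r ∈ L.I, f * r ∈ Ideal.span (Set.range L.α)) :
    ∃ (u : L.F.ι → MvPolynomial (Fin n) K) (v : L.C.ι → MvPolynomial (Fin n) K),
      L.F.Supp c u ∧ (∀ y, L.C.lvl y + 1 ≠ c → v y = 0) ∧
      ∑ x, L.φ x L.t * u x - ∑ y, L.C.d y L.t * v y = f := by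
  classical
  have hw : ∀ x, ∃ w, L.C.Supp 1 w ∧ L.C.d *ᵥ w = Pi.single L.o (f * L.F.d L.o' x) := fun x =>
    (L.koszul.mem_span_iff _).1 (hf _ (L.res.d_mem x))
  choose w hws hw using hw
  let X₀ : Matrix L.C.ι L.F.ι (MvPolynomial (Fin n) K) :=
    Matrix.of fun y x => if x = L.o' then (Pi.single L.o f : L.C.ι → _) y
      else if L.F.lvl x = 1 then w x y else 0
  have hX0 : ∀ y, X₀ y L.o' = (Pi.single L.o f : L.C.ι → _) y := fun y => if_pos rfl
  have hX1 : ∀ x, L.F.lvl x = 1 → ∀ y, X₀ y x = w x y := by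
    intro x hx y
    refine (if_neg ?_).trans (if_pos hx)
    rintro rfl
    have := L.lvl_o'
    omega
  obtain ⟨χ, hχ1, hχ2, hχ3⟩ := LevelComplex.exists_lift L.F.toLevelComplex L.C.toLevelComplex 0 1 0
    L.koszul.exact (by omega) 1 0 (fun _ _ h => absurd rfl h) (by simp) X₀
    (by
      intro y x h
      by_cases hx : x = L.o'
      · subst hx
        rw [hX0, Pi.single_apply] at h
        have : y = L.o := by
          by_contra h'
          exact h (if_neg h')
        rw [this, L.lvl_o, L.lvl_o']
      · by_cases hx1 : L.F.lvl x = 1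
        · rw [hX1 x hx1] at h
          rw [hx1]
          by_contra h'
          exact h (hws x y h')
        · exact absurd ((if_neg hx).trans (if_neg hx1)) h)
    (by
      intro x hx y
      rw [zero_add, one_smul]
      by_cases hx0 : x = L.o'
      · subst hx0
        have e1 : (X₀ * L.F.d) y L.o' = 0 := Finset.sum_eq_zero fun z _ =>
          mul_eq_zero_of_right _ (L.F.d_eq_zero (by rw [L.lvl_o']; omega))
        have e2 : (L.C.d * X₀) y L.o' = (L.C.d *ᵥ Pi.single L.o f) y :=
          Finset.sum_congr rfl fun z _ => congrArg (L.C.d y z * ·) (hX0 z)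
        have hs : L.C.Supp 0 (Pi.single L.o f) := L.lvl_o ▸ L.C.supp_single _ _
        rw [e1, e2, hs.d_mulVec_eq_zero]
        rfl
      · have hx1 : L.F.lvl x = 1 := by
          have : ¬L.F.lvl x = 0 := fun h => hx0 ((L.res.lvl_eq_zero x).1 h)
          omega
        have e2 : (L.C.d * X₀) y x = (L.C.d *ᵥ w x) y :=
          Finset.sum_congr rfl fun z _ => congrArg (L.C.d y z * ·) (hX1 x hx1 z)
        have e1 : (X₀ * L.F.d) y x = X₀ y L.o' * L.F.d L.o' x := by
          refine Finset.sum_eq_single L.o' (fun z _ hz => mul_eq_zero_of_right _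
            (L.F.d_eq_zero ?_)) (fun h => absurd (Finset.mem_univ _) h)
          have : ¬L.F.lvl z = 0 := fun h => hz ((L.res.lvl_eq_zero z).1 h)
          omega
        rw [e1, e2, hw, hX0, Pi.single_apply, Pi.single_apply]
        split_ifs <;> simp)
  rw [zero_add, one_smul] at hχ2
  have hχo : χ L.o L.o' = f := by
    rw [hχ3 _ (by rw [L.lvl_o']; omega), hX0, Pi.single_eq_same]
  -- The homotopy between `χ φ` and `f` can start from zero, since the two agree exactly on `o`.
  obtain ⟨s, hs1, hs2, -⟩ := LevelComplex.exists_lift L.C.toLevelComplex L.C.toLevelComplex 0 0 1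
    L.koszul.exact (by omega) (-1) (χ * L.φ - f • 1)
    (by
      intro y z h
      by_contra h'
      have h1 : (χ * L.φ) y z = 0 := Finset.sum_eq_zero fun x _ => by
        by_contra h2
        have h3 := hχ1 y x (left_ne_zero_of_mul h2)
        have h4 := L.φ_lvl x z (right_ne_zero_of_mul h2)
        omega
      have h2 : (1 : Matrix L.C.ι L.C.ι (MvPolynomial (Fin n) K)) y z = 0 :=
        Matrix.one_apply_ne fun h => h' (by rw [h])
      exact h (by rw [Matrix.sub_apply, Matrix.smul_apply, h1, h2]; simp))
    (by
      rw [Matrix.mul_sub, Matrix.sub_mul, ← Matrix.mul_assoc, hχ2, Matrix.mul_assoc,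
        Matrix.mul_assoc, L.φ_comm]
      simp) 0 (fun _ _ h => absurd rfl h)
    (by
      intro y hy z
      have hy' : y = L.o := (L.koszul.lvl_eq_zero y).1 (by omega)
      subst hy'
      have e1 : (χ * L.φ) z L.o = χ z L.o' := by
        refine (Finset.sum_eq_single L.o' (fun x _ hx => mul_eq_zero_of_right _ ?_)
          (fun h => absurd (Finset.mem_univ _) h)).trans ?_
        · by_contra h
          exact hx ((L.res.lvl_eq_zero x).1 (by rw [L.φ_lvl _ _ h, L.lvl_o]))
        · show χ z L.o' * L.φ L.o' L.o = _
          rw [L.φ_o, mul_one]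
      have e2 : χ z L.o' = (f • (1 : Matrix L.C.ι L.C.ι (MvPolynomial (Fin n) K))) z L.o := by
        rw [hχ3 _ (by rw [L.lvl_o']; omega), hX0, Matrix.smul_apply, Pi.single_apply,
          Matrix.one_apply]
        split_ifs <;> simp
      rw [Matrix.mul_zero, Matrix.zero_mul, smul_zero, add_zero, Matrix.sub_apply, e1, e2,
        sub_self]
      rfl)
  have e := congrFun (congrFun hs2 L.t) L.t
  have e1 : (L.C.d * s) L.t L.t = 0 := Finset.sum_eq_zero fun z _ => by
    refine mul_eq_zero_of_right _ ?_
    by_contra h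
    have h1 := hs1 z L.t h
    have h2 := L.koszul.lvl_le z
    rw [L.lvl_t] at h1
    omega
  rw [e1] at e
  refine ⟨fun x => χ L.t x, fun y => s L.t y, ?_, ?_, ?_⟩
  · rw [L.F.supp_iff]
    intro x hx
    have := hχ1 _ _ hx
    rw [L.lvl_t] at this
    omega
  · intro y hy
    by_contra h
    have := hs1 _ _ h
    rw [L.lvl_t] at this
    omega
  · have e2 : ∑ x, L.φ x L.t * χ L.t x = (χ * L.φ) L.t L.t :=
      Finset.sum_congr rfl fun x _ => mul_comm _ _
    have e3 : ∑ y, L.C.d y L.t * s L.t y = (s * L.C.d) L.t L.t :=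
      Finset.sum_congr rfl fun x _ => mul_comm _ _
    rw [e2, e3]
    simp only [Matrix.add_apply, Matrix.sub_apply, Matrix.smul_apply, Matrix.one_apply_eq,
      smul_eq_mul, neg_mul, one_mul, mul_one] at e
    linear_combination -e

theorem mem_J_iff_mul {f : MvPolynomial (Fin n) K} :
    f ∈ L.J ↔ ∀ r ∈ L.I, f * r ∈ Ideal.span (Set.range L.α) := Submodule.mem_colon

theorem G_supp_zero {v : L.G.ι → MvPolynomial (Fin n) K} (hv : L.G.Supp 0 v) :
    ∀ r, v L.bot = r → v = (Pi.single L.bot r : L.G.ι → _) := by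
  rintro r rfl
  exact eq_single_of_supp_zero L.G_lvl_eq_zero hv

theorem G_supp_restrict {f : L.F.ι → MvPolynomial (Fin n) K}
    {k : L.C.ι → MvPolynomial (Fin n) K} (hf : L.F.Supp c f)
    (hk : ∀ y, L.C.lvl y + 1 ≠ c → k y = 0) : L.G.Supp 1 (L.restrict f k) := by
  rintro (x | y) h
  · refine hf x.1 fun h' => h ?_
    show c + 1 - L.F.lvl x.1 = 1
    omega
  · refine hk y.1 fun h' => h ?_
    show c + 1 - (L.C.lvl y.1 + 1) = 1
    omega

/-- The linked ideal is resolved by the dual of the reduced mapping cone. -/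
theorem isResolution : IsResolution L.G L.J c L.bot where
  exact := L.cone.dual_exactAbove (c + 1) L.cone_lvl_le fun l hl u hu hdu =>
    L.cone_dual_exact l (by omega) u hu hdu
  lvl_le p := by
    have := L.one_le_cone_lvl p
    show c + 1 - L.cone.lvl p ≤ c
    omega
  lvl_eq_zero := L.G_lvl_eq_zero
  deg_o := by
    show ∑ i, L.δ i - L.C.deg L.t = 0
    rw [L.koszul.deg_t, sub_self]
  mem_iff f := by
    rw [L.mem_J_iff_mul]
    constructor
    · intro hf
      obtain ⟨u, v, hu, hv, huv⟩ := L.exists_of_mul_mem hf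
      refine ⟨L.restrict u v, ?_⟩
      refine L.G_supp_zero (LevelComplex.Supp.d_mulVec (L.G_supp_restrict hu hv)) _ ?_
      rw [← huv]
      exact L.cone_sum_eq u v
    · rintro ⟨w, hw⟩ r hr
      have e := (congrFun hw L.bot).trans (Pi.single_eq_same (M := fun _ : L.G.ι => _) _ _)
      have e' : (L.cone.dᵀ *ᵥ (L.restrict (L.extF w) (L.extC w) : L.cone.ι → _)) L.bot = f := by
        rw [L.restrict_ext w]
        exact e
      rw [L.cone_sum_eq] at e'
      rw [← e', sub_mul]
      refine Ideal.sub_mem _ ?_ ?_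
      · rw [Finset.sum_mul]
        refine Ideal.sum_mem _ fun x _ => ?_
        rw [mul_right_comm, mul_comm (L.φ x L.t)]
        exact Ideal.mul_mem_right _ _ (L.φ_t_mul_mem x hr)
      · rw [Finset.sum_mul]
        exact Ideal.sum_mem _ fun y _ => Ideal.mul_mem_right _ _
          (Ideal.mul_mem_right _ _ (L.d_b_mem y))

theorem exists_F_preimage (i : Fin c) (x : L.F.ι) (hx : L.F.lvl x = 0) :
    ∃ w, L.F.d *ᵥ w = Pi.single x (L.α i) := by
  obtain rfl := (L.res.lvl_eq_zero x).1 hx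
  exact ⟨_, L.d_mulVec_φ_col i⟩

theorem φ_t_mem_J (x : L.F.ι) : L.φ x L.t ∈ L.J :=
  L.mem_J_iff_mul.2 fun r hr => by rw [mul_comm]; exact L.φ_t_mul_mem x hr

/-- Since `φ x t ∈ J`, the product `y * φ x t` is a combination of the `α i`. Hence `y` at `x`
extends by Koszul coordinates to a cocycle of the cone in degree `c`, and the `F`-part of a
cobounding vector is the required preimage. -/
theorem exists_top_preimage {y : MvPolynomial (Fin n) K}
    (hy : ∀ j ∈ L.J, y * j ∈ Ideal.span (Set.range L.α)) (x : L.F.ι) (hx : L.F.lvl x = c) :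
    ∃ w, L.F.dᵀ *ᵥ w = Pi.single x y := by
  classical
  have h2 := L.two_le
  obtain ⟨g, hg⟩ := (Ideal.mem_span_range_iff_exists_fun).1 (hy _ (L.φ_t_mem_J x))
  have hσ : ∀ i, ∃ ε : MvPolynomial (Fin n) K, L.C.d (L.b i) L.t * ε = L.α i := by
    intro i
    rcases L.koszul.d_t i with h | h
    · exact ⟨1, by rw [h, mul_one]⟩
    · exact ⟨-1, by rw [h]; ring⟩
  choose ε hε using hσ
  let k : L.C.ι → MvPolynomial (Fin n) K := fun z => ∑ i, if z = L.b i then ε i * g i else 0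
  have hk : ∀ z, L.C.lvl z + 1 ≠ c → k z = 0 := by
    intro z hz
    refine Finset.sum_eq_zero fun i _ => if_neg ?_
    rintro rfl
    exact hz (L.lvl_b i)
  have hksum : ∑ z, L.C.d z L.t * k z = y * L.φ x L.t := by
    rw [← hg]
    simp only [k, Finset.mul_sum]
    rw [Finset.sum_comm]
    refine Finset.sum_congr rfl fun i _ => ?_
    rw [Finset.sum_eq_single (L.b i), if_pos rfl, ← mul_assoc, hε, mul_comm]
    · intro z _ hz
      rw [if_neg hz, mul_zero]
    · exact fun h => absurd (Finset.mem_univ _) h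
  have hfs : L.F.Supp c (Pi.single x y) := by
    have := L.F.supp_single x y
    rwa [hx] at this
  have hu : L.cone.dᵀ *ᵥ (L.restrict (Pi.single x y) k : L.cone.ι → _) = 0 := by
    have h := L.G_supp_zero (LevelComplex.Supp.d_mulVec (L.G_supp_restrict hfs hk)) 0 (by
      refine (L.cone_sum_eq _ _).trans ?_
      rw [hksum, Finset.sum_eq_single x, Pi.single_eq_same, mul_comm, sub_self]
      · intro z _ hz
        rw [Pi.single_eq_of_ne hz, mul_zero]
      · exact fun h => absurd (Finset.mem_univ _) h)
    exact h.trans (Pi.single_zero (M := fun _ : L.G.ι => _) _)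
  obtain ⟨w, hw, hw'⟩ := L.cone_dual_exact c (by omega) (L.restrict (Pi.single x y) k) (by
      rintro (z | z) h
      · exact hfs z.1 h
      · exact hk z.1 h) hu
  refine ⟨L.extF w, ?_⟩
  funext z
  by_cases hz : L.F.lvl z = c
  · have hzk : L.KeepF z := L.keepF_of_two_le (by omega)
    have e : (L.cone.dᵀ *ᵥ w) (Sum.inl ⟨z, hzk⟩) = (Pi.single x y : L.F.ι → _) z :=
      congrFun hw' (Sum.inl ⟨z, hzk⟩)
    rw [← e]
    refine Eq.trans ?_ (L.cone_sum _).symm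
    have e0 : ∑ y : {y // L.KeepC y}, L.cone.dᵀ (Sum.inl ⟨z, hzk⟩) (Sum.inr y) *
        w (Sum.inr y) = 0 := Finset.sum_eq_zero fun _ _ => zero_mul _
    refine Eq.trans ?_ ((add_zero _).symm.trans (congrArg₂ (· + ·) rfl e0.symm))
    refine ((sum_subtype_eq L.KeepF (fun x => L.F.d x z * L.extF w x) fun x hx =>
      mul_eq_zero_of_right _ (dif_neg hx)).symm).trans (Finset.sum_congr rfl fun x _ => ?_)
    exact congrArg (L.F.d x.1 z * ·) (dif_pos x.2)
  · rw [hfs z hz]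
    refine Finset.sum_eq_zero fun a _ => ?_
    show L.F.d a z * L.extF w a = 0
    by_contra h
    have h1 := L.F.lvl_eq a z (left_ne_zero_of_mul h)
    refine right_ne_zero_of_mul h ?_
    unfold extF
    split_ifs with ha
    · refine hw _ ?_
      show L.F.lvl a + 1 ≠ c
      omega
    · rfl

/-- An element carrying `J` into `(α)` kills the only homology of the dual of `F`, so it is null
homotopic there. Transposing the homotopy makes it null homotopic on `F`, which means that it kills
`R/I`. -/
theorem I_eq_colon :
    L.I = (Ideal.span (Set.range L.α)).colon (L.J : Set (MvPolynomial (Fin n) K)) := by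
  ext y
  rw [Submodule.mem_colon]
  constructor
  · intro hy j hj
    rw [smul_eq_mul, mul_comm]
    exact L.mem_J_iff_mul.1 hj y hy
  · intro hy
    have hex := L.F.dual_exactAbove c L.res.lvl_le fun l hl u hu hdu =>
      L.F.dual_exact_of_weaklyRegularSeq 0 (fun _ => Nat.zero_le _) L.res.exact L.α L.regular
        L.exists_F_preimage l (by omega) u hu hdu
    obtain ⟨s, -, hs⟩ := (L.F.dual c L.res.lvl_le).exists_homotopy 0 (fun _ => Nat.zero_le _) hex y
      (fun x hx => L.exists_top_preimage hy x (by
        have h1 : c - L.F.lvl x = 0 := hx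
        have := L.res.lvl_le x
        omega))
    let s' : Matrix L.F.ι L.F.ι (MvPolynomial (Fin n) K) := s
    have e : L.F.d * s'ᵀ + s'ᵀ * L.F.d = y • (1 : Matrix L.F.ι L.F.ι _) := by
      have := congrArg Matrix.transpose hs
      rw [transpose_add, transpose_mul, transpose_mul, transpose_smul, transpose_one] at this
      rw [add_comm]
      exact this
    rw [L.res.mem_iff]
    refine ⟨fun x => s'ᵀ x L.o', ?_⟩
    funext x
    have e1 := congrFun (congrFun e x) L.o'
    have e2 : (s'ᵀ * L.F.d) x L.o' = 0 := Finset.sum_eq_zero fun z _ =>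
      mul_eq_zero_of_right _ (L.F.d_eq_zero (by rw [L.lvl_o']; omega))
    rw [Matrix.add_apply, e2, add_zero] at e1
    refine e1.trans ?_
    rw [Matrix.smul_apply, Matrix.one_apply, Pi.single_apply]
    split_ifs <;> simp

end LinkData

/-! ### Regular sequences of forms: height, permutation, general position -/

section RegularSequences

open RingTheory.Sequence

theorem ofList_take_ofFn {R : Type*} [CommRing R] {m : ℕ} (α : Fin m → R) (i : Fin m) :
    Ideal.ofList ((List.ofFn α).take i) = Ideal.span (α '' {j | j < i}) := by
  refine congrArg Ideal.span ?_
  ext r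
  simp only [Set.mem_ofPred_eq, Set.mem_image]
  rw [List.mem_take_iff_getElem]
  constructor
  · rintro ⟨j, hj, rfl⟩
    rw [List.length_ofFn] at hj
    have h1 : j < m := by omega
    have h2 : j < (i : ℕ) := by omega
    exact ⟨⟨j, h1⟩, h2, by rw [List.getElem_ofFn]⟩
  · rintro ⟨j, hj, rfl⟩
    have h2 : (j : ℕ) < (i : ℕ) := hj
    exact ⟨j, by rw [List.length_ofFn]; omega, by rw [List.getElem_ofFn]⟩

theorem ofList_ofFn {R : Type*} [CommRing R] {m : ℕ} (α : Fin m → R) :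
    Ideal.ofList (List.ofFn α) = Ideal.span (Set.range α) := by
  refine congrArg Ideal.span ?_
  ext r
  simp [List.mem_ofFn]

theorem isWeaklyRegular_ofFn_iff {R : Type*} [CommRing R] {m : ℕ} (α : Fin m → R) :
    IsWeaklyRegular R (List.ofFn α) ↔ WeaklyRegularSeq α := by
  have key : ∀ i : Fin m, IsSMulRegular
      (R ⧸ (Ideal.ofList ((List.ofFn α).take i) • ⊤ : Submodule R R)) (α i) ↔
      ∀ r, r * α i ∈ Ideal.span (α '' {j | j < i}) → r ∈ Ideal.span (α '' {j | j < i}) := by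
    intro i
    rw [isSMulRegular_quotient_iff_mem_of_smul_mem, ofList_take_ofFn, smul_eq_mul, Ideal.mul_top]
    simp only [smul_eq_mul, mul_comm]
  constructor
  · intro h i
    rw [← key]
    have := h.regular_mod_prev i (by simp)
    rwa [List.getElem_ofFn] at this
  · intro h
    refine ⟨fun i hi => ?_⟩
    have hi' : i < m := by simpa using hi
    have := (key ⟨i, hi'⟩).2 (h ⟨i, hi'⟩)
    rwa [List.getElem_ofFn]

theorem WeaklyRegularSeq.of_neg {R : Type*} [CommRing R] {m : ℕ} {α β : Fin m → R}
    (h : WeaklyRegularSeq α) (hβ : ∀ i, β i = α i ∨ β i = -α i) : WeaklyRegularSeq β := by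
  have hspan : ∀ i : Fin m, Ideal.span (β '' {j | j < i}) = Ideal.span (α '' {j | j < i}) := by
    intro i
    apply le_antisymm <;> rw [Ideal.span_le]
    · rintro _ ⟨j, hj, rfl⟩
      have : α j ∈ Ideal.span (α '' {j | j < i}) := Ideal.subset_span ⟨j, hj, rfl⟩
      rcases hβ j with h | h <;> rw [h]
      · exact this
      · exact neg_mem this
    · rintro _ ⟨j, hj, rfl⟩
      have : β j ∈ Ideal.span (β '' {j | j < i}) := Ideal.subset_span ⟨j, hj, rfl⟩
      rcases hβ j with h | h
      · rwa [h] at this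
      · rw [h] at this
        exact neg_mem_iff.1 this
  intro i r hr
  rw [hspan] at hr ⊢
  refine h i r ?_
  rcases hβ i with h | h
  · rwa [h] at hr
  · rw [h, mul_neg] at hr
    exact neg_mem_iff.1 hr

theorem WeaklyRegularSeq.update_last {R : Type*} [CommRing R] {m : ℕ} {α : Fin (m + 1) → R}
    (h : WeaklyRegularSeq α) (v : R)
    (hv : ∀ r, r * v ∈ Ideal.span (α '' {j | j < Fin.last m}) →
      r ∈ Ideal.span (α '' {j | j < Fin.last m})) :
    WeaklyRegularSeq (Function.update α (Fin.last m) v) := by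
  have himg : ∀ i, Function.update α (Fin.last m) v '' {j | j < i} = α '' {j | j < i} := by
    intro i
    refine Set.image_congr fun j hj => ?_
    have h1 : j < i := hj
    exact Function.update_of_ne (h1.trans_le (Fin.le_last i)).ne _ _
  intro i r hr
  rw [himg] at hr ⊢
  by_cases hi : i = Fin.last m
  · subst hi
    rw [Function.update_self] at hr
    exact hv r hr
  · rw [Function.update_of_ne hi] at hr
    exact h i r hr

/-- Outside the zero divisors modulo `Q`, membership in `Q` cancels. -/
theorem mem_of_forall_associatedPrime {R : Type*} [CommRing R] [IsNoetherianRing R]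
    (Q : Ideal R) (v : R) (hv : ∀ P ∈ associatedPrimes R (R ⧸ Q), v ∉ P) (r : R)
    (hr : r * v ∈ Q) : r ∈ Q := by
  by_contra h
  have h1 : v ∈ {r : R | ∃ x : R ⧸ Q, x ≠ 0 ∧ r • x = 0} := by
    refine ⟨Ideal.Quotient.mk Q r, fun h' => h (Ideal.Quotient.eq_zero_iff_mem.1 h'), ?_⟩
    rw [Algebra.smul_def]
    show Ideal.Quotient.mk Q v * Ideal.Quotient.mk Q r = 0
    rw [← map_mul, Ideal.Quotient.eq_zero_iff_mem, mul_comm]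
    exact hr
  rw [← biUnion_associatedPrimes_eq_zero_divisors R (R ⧸ Q)] at h1
  obtain ⟨P, hP, hvP⟩ := Set.mem_iUnion₂.1 h1
  exact hv P hP hvP

theorem notMem_associatedPrime {R : Type*} [CommRing R] [IsNoetherianRing R]
    (Q : Ideal R) (v : R) (hv : ∀ r, r * v ∈ Q → r ∈ Q) (P : Ideal R)
    (hP : P ∈ associatedPrimes R (R ⧸ Q)) : v ∉ P := by
  intro hvP
  have h1 : v ∈ ⋃ p ∈ associatedPrimes R (R ⧸ Q), (p : Set R) := Set.mem_iUnion₂.2 ⟨P, hP, hvP⟩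
  rw [biUnion_associatedPrimes_eq_zero_divisors R (R ⧸ Q)] at h1
  obtain ⟨x, hx, hx'⟩ := h1
  obtain ⟨r, rfl⟩ := Ideal.Quotient.mk_surjective x
  refine hx (Ideal.Quotient.eq_zero_iff_mem.2 (hv r ?_))
  rw [Algebra.smul_def] at hx'
  have : Ideal.Quotient.mk Q (v * r) = 0 := by rw [map_mul]; exact hx'
  rw [mul_comm]
  exact Ideal.Quotient.eq_zero_iff_mem.1 this

/-- A minimal prime over the first `j` elements is an associated prime, so the next element avoids
it. A prime containing that element is therefore strictly larger, and the height grows by one each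
time. -/
theorem le_height_of_weaklyRegularSeq {R : Type*} [CommRing R] [IsNoetherianRing R] {m : ℕ}
    {α : Fin m → R} (hα : WeaklyRegularSeq α) (j : ℕ) (hj : j ≤ m) (P : Ideal R) [P.IsPrime]
    (hP : Ideal.span (α '' {i | (i : ℕ) < j}) ≤ P) : (j : ℕ∞) ≤ P.height := by
  induction j generalizing P with
  | zero => simp
  | succ j ih =>
    rw [LevelComplex.span_image_lt_succ α (by omega)] at hP
    obtain ⟨q, hq, hqP⟩ := Ideal.exists_minimalPrimes_le (le_sup_left.trans hP)
    have : q.IsPrime := hq.1.1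
    have h1 := ih (by omega) q hq.1.2
    have hq' : q ∈ associatedPrimes R (R ⧸ Ideal.span (α '' {i | (i : ℕ) < j})) := by
      apply Module.associatedPrimes.minimalPrimes_annihilator_subset_associatedPrimes
      rwa [Ideal.annihilator_quotient]
    have h2 := notMem_associatedPrime _ (α ⟨j, by omega⟩) (hα ⟨j, by omega⟩) q hq'
    have h3 : α ⟨j, by omega⟩ ∈ P := hP (Ideal.mem_sup_right (Ideal.mem_span_singleton_self _))
    have h4 : q < P := lt_of_le_of_ne hqP fun h => h2 (h ▸ h3)
    calc ((j + 1 : ℕ) : ℕ∞) = (j : ℕ∞) + 1 := by push_cast; rfl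
      _ ≤ q.height + 1 := by gcongr
      _ ≤ P.height := Ideal.height_add_one_le_of_lt_of_isPrime h4

variable {K : Type*} [Field K] {n : ℕ}

/-- A proper ideal of `K[x_1, …, x_n]` containing a regular sequence of length `n` has height
`n`. -/
theorem height_eq_of_weaklyRegularSeq {α : Fin n → MvPolynomial (Fin n) K}
    (hα : WeaklyRegularSeq α) (J : Ideal (MvPolynomial (Fin n) K)) (hJ : J ≠ ⊤)
    (h : ∀ i, α i ∈ J) : J.height = n := by
  apply le_antisymm
  · have h1 := Ideal.height_le_ringKrullDim_of_ne_top hJ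
    rw [MvPolynomial.ringKrullDim_of_isNoetherianRing, ringKrullDim_eq_zero_of_field, zero_add,
      Nat.card_fin] at h1
    exact_mod_cast h1
  · rw [Ideal.height_eq_inf_minimalPrimes]
    refine le_iInf₂ fun P hP => ?_
    have : P.IsPrime := hP.1.1
    refine le_height_of_weaklyRegularSeq hα n le_rfl P ?_
    rw [Ideal.span_le]
    rintro _ ⟨i, -, rfl⟩
    exact hP.1.2 (h i)

theorem weaklyRegularSeq_X :
    WeaklyRegularSeq (fun i : Fin n => (MvPolynomial.X i : MvPolynomial (Fin n) K)) := by
  intro i r hr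
  have e : (fun i : Fin n => (MvPolynomial.X i : MvPolynomial (Fin n) K)) '' {j | j < i} =
    MvPolynomial.X '' {j | j < i} := rfl
  rw [e, MvPolynomial.mem_ideal_span_X_image] at hr ⊢
  intro m hm
  obtain ⟨j, hj, hj'⟩ := hr (m + Finsupp.single i 1) (by
    rw [MvPolynomial.mem_support_iff, MvPolynomial.coeff_mul_X]
    exact MvPolynomial.mem_support_iff.1 hm)
  refine ⟨j, hj, ?_⟩
  have hji : j ≠ i := ne_of_lt hj
  rwa [Finsupp.add_apply, Finsupp.single_eq_of_ne hji, add_zero] at hj'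

theorem isHomogeneous_ofList {l : List (MvPolynomial (Fin n) K)}
    (hl : ∀ f ∈ l, ∃ m : ℕ, 0 < m ∧ f.IsHomogeneous m) : IsHomogeneousIdeal (Ideal.ofList l) := by
  let _ : GradedAlgebra (MvPolynomial.homogeneousSubmodule (Fin n) K) :=
    MvPolynomial.gradedAlgebra
  refine Ideal.homogeneous_span _ _ fun f hf => ?_
  obtain ⟨m, -, hm⟩ := hl f hf
  exact ⟨m, hm⟩

/-- A graded form of Krull's intersection theorem: the component of degree `k` of `a ^ (k + 1) * z`
vanishes, so that of `x` lies in `Q`. -/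
theorem mem_of_forall_mem_sup_pow {Q : Ideal (MvPolynomial (Fin n) K)} (hQ : IsHomogeneousIdeal Q)
    {a : MvPolynomial (Fin n) K} {d : ℕ} (hd : 0 < d) (ha : a.IsHomogeneous d)
    {x : MvPolynomial (Fin n) K} (hx : ∀ N, ∃ z, x - a ^ N * z ∈ Q) : x ∈ Q := by
  refine (MvPolynomial.mem_iff_homogeneousComponent_mem hQ x).2 fun k => ?_
  obtain ⟨z, hz⟩ := hx (k + 1)
  have h1 := MvPolynomial.homogeneousComponent_mem_of_mem hQ hz k
  rwa [map_sub, homogeneousComponent_mul_of_lt (ha.pow (k + 1)) z (by nlinarith), sub_zero] at h1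

/-- `prototype_perm` asks for a Nakayama property: the submodule `M` of the quotient by `rs` is zero
if `M = a M`. Elements of such an `M` are divisible by all powers of `a`, and positivity of degrees
finishes the argument. -/
theorem WeaklyRegularSeq.perm {m : ℕ} {α : Fin m → MvPolynomial (Fin n) K}
    (hα : WeaklyRegularSeq α) (hd : ∀ i, ∃ d : ℕ, 0 < d ∧ (α i).IsHomogeneous d)
    (σ : Equiv.Perm (Fin m)) : WeaklyRegularSeq (α ∘ σ) := by
  rw [← isWeaklyRegular_ofFn_iff] at hα ⊢
  have hl : ∀ f ∈ List.ofFn α, ∃ d : ℕ, 0 < d ∧ f.IsHomogeneous d := by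
    intro f hf
    obtain ⟨i, rfl⟩ := (List.mem_ofFn' _ _).1 hf
    exact hd i
  refine hα.prototype_perm (σ.ofFn_comp_perm α).symm ?_
  intro a b rs hrs M hM
  have hsub := hrs.subset
  obtain ⟨d, hd, ha⟩ := hl a (hsub List.mem_cons_self)
  have hQ : IsHomogeneousIdeal (Ideal.ofList rs) := isHomogeneous_ofList fun f hf =>
    hl f (hsub (List.mem_cons_of_mem _ (List.mem_cons_of_mem _ hf)))
  have hpow : ∀ N : ℕ, ∀ y ∈ M, ∃ z ∈ M, y = a ^ N • z := by
    intro N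
    induction N with
    | zero => exact fun y hy => ⟨y, hy, by simp⟩
    | succ N ih =>
      intro y hy
      rw [hM] at hy
      obtain ⟨z, hz, rfl⟩ := (Submodule.mem_smul_pointwise_iff_exists _ _ _).1 hy
      obtain ⟨w, hw, rfl⟩ := ih z hz
      exact ⟨w, hw, by rw [pow_succ', mul_smul]⟩
  rw [eq_bot_iff]
  intro y hy
  obtain ⟨x, rfl⟩ := Submodule.mkQ_surjective _ y
  rw [Submodule.mem_bot, Submodule.mkQ_apply, Submodule.Quotient.mk_eq_zero, smul_eq_mul,
    Ideal.mul_top]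
  refine mem_of_forall_mem_sup_pow hQ hd ha fun N => ?_
  obtain ⟨z, -, hz⟩ := hpow N _ hy
  obtain ⟨z, rfl⟩ := Submodule.mkQ_surjective _ z
  refine ⟨z, ?_⟩
  rw [← map_smul, ← sub_eq_zero, ← map_sub, Submodule.mkQ_apply, Submodule.Quotient.mk_eq_zero,
    smul_eq_mul, Ideal.mul_top] at hz
  exact hz

/-- Each ideal in `S` meets the linear forms in a proper subspace, and a vector space over an
infinite field is not a finite union of these. -/
theorem exists_linearForm [Infinite K] (S : Finset (Ideal (MvPolynomial (Fin n) K)))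
    (hS : ∀ P ∈ S, ∃ i, MvPolynomial.X i ∉ P) :
    ∃ l : MvPolynomial (Fin n) K, l.IsHomogeneous 1 ∧ ∀ P ∈ S, l ∉ P := by
  classical
  let ψ : (Fin n → K) →ₗ[K] MvPolynomial (Fin n) K :=
    Fintype.linearCombination K fun i => (MvPolynomial.X i : MvPolynomial (Fin n) K)
  let V : Ideal (MvPolynomial (Fin n) K) → Submodule K (Fin n → K) := fun P =>
    (P.restrictScalars K).comap ψ
  have h := Subspace.biUnion_ne_univ_of_top_notMem (k := K) (E := Fin n → K) (s := S.image V) (by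
    intro h
    obtain ⟨P, hP, hPV⟩ := Finset.mem_image.1 h
    obtain ⟨i, hi⟩ := hS P hP
    refine hi ?_
    have h1 : Pi.single i 1 ∈ V P := by rw [hPV]; trivial
    have h2 : ψ (Pi.single i 1) ∈ P := h1
    rwa [Fintype.linearCombination_apply_single, one_smul] at h2)
  obtain ⟨u, hu⟩ := (Set.ne_univ_iff_exists_notMem _).1 h
  refine ⟨ψ u, ?_, fun P hP hl => hu (Set.mem_iUnion₂.2 ⟨V P, Finset.mem_image_of_mem V hP, hl⟩)⟩
  rw [Fintype.linearCombination_apply]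
  refine MvPolynomial.IsHomogeneous.sum _ _ _ fun i _ => ?_
  rw [MvPolynomial.smul_eq_C_mul]
  exact (MvPolynomial.isHomogeneous_X K i).C_mul _

theorem mem_of_X_mem {P : Ideal (MvPolynomial (Fin n) K)} (hP : ∀ i, MvPolynomial.X i ∈ P)
    {f : MvPolynomial (Fin n) K} {d : ℕ} (hd : 0 < d) (hf : f.IsHomogeneous d) : f ∈ P := by
  have h1 : f ∈ Ideal.span (MvPolynomial.X '' (Set.univ : Set (Fin n))) := by
    rw [MvPolynomial.mem_ideal_span_X_image]
    intro m hm
    have h2 := hf (MvPolynomial.mem_support_iff.1 hm)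
    by_contra h
    push Not at h
    have : m = 0 := Finsupp.ext fun i => h i (Set.mem_univ i)
    rw [this] at h2
    simp at h2
    omega
  refine (Ideal.span_le.2 ?_) h1
  rintro _ ⟨i, -, rfl⟩
  exact hP i

/-- General position: `f + g v` is a nonzerodivisor modulo `Q` for a suitable form `g`. -/
theorem exists_isHomogeneous_add_mul [Infinite K] (Q : Ideal (MvPolynomial (Fin n) K))
    {v : MvPolynomial (Fin n) K} {d : ℕ} (hd : 0 < d) (hvd : v.IsHomogeneous d)
    (hv : ∀ r, r * v ∈ Q → r ∈ Q) (f : MvPolynomial (Fin n) K) (e : ℕ) :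
    ∃ g : MvPolynomial (Fin n) K, g.IsHomogeneous e ∧ ∀ r, r * (f + g * v) ∈ Q → r ∈ Q := by
  classical
  have hfin := associatedPrimes.finite (MvPolynomial (Fin n) K) (MvPolynomial (Fin n) K ⧸ Q)
  have hvP := notMem_associatedPrime Q v hv
  -- An associated prime containing all variables would contain `v`, a form of positive degree.
  obtain ⟨l, hl, hlP⟩ := exists_linearForm hfin.toFinset (by
    intro P hP
    by_contra h
    push Not at h
    exact hvP P (hfin.mem_toFinset.1 hP) (mem_of_X_mem h hd hvd))
  let B : Set K := ⋃ P ∈ associatedPrimes (MvPolynomial (Fin n) K) (MvPolynomial (Fin n) K ⧸ Q),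
    {t : K | f + MvPolynomial.C t * l ^ e * v ∈ P}
  -- Each associated prime excludes at most one scalar: the difference of two bad elements is a
  -- nonzero scalar times `l ^ e * v`, and neither `l` nor `v` lies in the prime.
  have hB : B.Finite := by
    refine hfin.biUnion fun P hP => Set.Subsingleton.finite ?_
    intro t ht s hs
    have hPp : P.IsPrime := (AssociatedPrimes.mem_iff.1 hP).isPrime
    by_contra hts
    have h1 : (f + MvPolynomial.C t * l ^ e * v) - (f + MvPolynomial.C s * l ^ e * v) ∈ P :=
      Ideal.sub_mem _ ht hs
    have h2 : MvPolynomial.C ((t - s)⁻¹) *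
        ((f + MvPolynomial.C t * l ^ e * v) - (f + MvPolynomial.C s * l ^ e * v)) = l ^ e * v := by
      have h3 : MvPolynomial.C (σ := Fin n) ((t - s)⁻¹) *
          (MvPolynomial.C t - MvPolynomial.C s) = 1 := by
        rw [← MvPolynomial.C_sub, ← MvPolynomial.C_mul, inv_mul_cancel₀ (sub_ne_zero.2 hts),
          MvPolynomial.C_1]
      linear_combination l ^ e * v * h3
    have h4 : l ^ e * v ∈ P := h2 ▸ Ideal.mul_mem_left _ _ h1
    rcases hPp.mem_or_mem h4 with h | h
    · exact hlP P (hfin.mem_toFinset.2 hP) (hPp.mem_of_pow_mem _ h)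
    · exact hvP P hP h
  obtain ⟨t, ht⟩ := hB.exists_notMem
  refine ⟨MvPolynomial.C t * l ^ e, ?_, mem_of_forall_associatedPrime Q _ fun P hP h => ?_⟩
  · have := (hl.pow e).C_mul t
    rwa [one_mul] at this
  · exact ht (Set.mem_iUnion₂.2 ⟨P, hP, h⟩)

/-- General position handles the last element only; a transposition brings `i` to the end and back.
-/
theorem WeaklyRegularSeq.exists_update [Infinite K] {m : ℕ} {α : Fin m → MvPolynomial (Fin n) K}
    (hα : WeaklyRegularSeq α) (hd : ∀ i, ∃ d : ℕ, 0 < d ∧ (α i).IsHomogeneous d) (i : Fin m)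
    (f : MvPolynomial (Fin n) K) (e : ℕ)
    (hf : ∃ d : ℕ, 0 < d ∧ ∀ g : MvPolynomial (Fin n) K, g.IsHomogeneous e →
      (f + g * α i).IsHomogeneous d) :
    ∃ g : MvPolynomial (Fin n) K, g.IsHomogeneous e ∧
      WeaklyRegularSeq (Function.update α i (f + g * α i)) := by
  obtain _ | m := m
  · exact i.elim0
  let σ := Equiv.swap i (Fin.last m)
  have h1 := hα.perm hd σ
  obtain ⟨d, hdpos, hdi⟩ := hd i
  have hσ : (α ∘ σ) (Fin.last m) = α i := by simp [σ]
  have h2 := h1 (Fin.last m)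
  rw [hσ] at h2
  obtain ⟨g, hg, hg'⟩ := exists_isHomogeneous_add_mul _ hdpos hdi h2 f e
  refine ⟨g, hg, ?_⟩
  have h3 := h1.update_last _ hg'
  obtain ⟨d', hd', hfd⟩ := hf
  have h4 := h3.perm (by
    intro j
    by_cases hj : j = Fin.last m
    · subst hj
      rw [Function.update_self]
      exact ⟨d', hd', hfd g hg⟩
    · rw [Function.update_of_ne hj]
      exact hd _) σ
  convert h4 using 1
  funext j
  by_cases hj : j = i
  · subst hj
    simp [σ]
  · have hj' : σ j ≠ Fin.last m := fun h => hj (σ.injective (h.trans (by simp [σ])))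
    rw [Function.update_of_ne hj, Function.comp_apply, Function.update_of_ne hj',
      Function.comp_apply]
    simp [σ]

/-- A regular sequence of forms may be replaced by one of prescribed larger degrees, each new
element being a given form plus a multiple of the old one. -/
theorem WeaklyRegularSeq.exists_add_mul [Infinite K] {m : ℕ}
    {α : Fin m → MvPolynomial (Fin n) K} (hα : WeaklyRegularSeq α) {d : Fin m → ℕ}
    (hd : ∀ i, 0 < d i) (hαd : ∀ i, (α i).IsHomogeneous (d i)) (e : Fin m → ℕ)
    (f : Fin m → MvPolynomial (Fin n) K) (hf : ∀ i, (f i).IsHomogeneous (d i + e i))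
    (S : Finset (Fin m)) :
    ∃ g : Fin m → MvPolynomial (Fin n) K, (∀ i, (g i).IsHomogeneous (e i)) ∧
      WeaklyRegularSeq fun i => if i ∈ S then f i + g i * α i else α i := by
  classical
  induction S using Finset.induction_on with
  | empty => exact ⟨0, fun i => MvPolynomial.isHomogeneous_zero _ _ _, by simpa using hα⟩
  | insert i S hi ih =>
    obtain ⟨g, hg, hreg⟩ := ih
    have hsum : ∀ j, ∀ g' : MvPolynomial (Fin n) K, g'.IsHomogeneous (e j) →
        (f j + g' * α j).IsHomogeneous (d j + e j) := fun j g' hg' =>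
      (hf j).add (add_comm (e j) (d j) ▸ hg'.mul (hαd j))
    obtain ⟨g', hg', hreg'⟩ := hreg.exists_update (by
      intro j
      by_cases hj : j ∈ S
      · simp only [hj, if_true]
        exact ⟨d j + e j, by have := hd j; omega, hsum j _ (hg j)⟩
      · simp only [hj, if_false]
        exact ⟨d j, hd j, hαd j⟩) i (f i) (e i) ⟨d i + e i, by have := hd i; omega, by
          simp only [hi, if_false]
          exact hsum i⟩
    refine ⟨Function.update g i g', fun j => ?_, ?_⟩
    · by_cases hj : j = i
      · subst hj; rwa [Function.update_self]
      · rw [Function.update_of_ne hj]; exact hg j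
    · convert hreg' using 1
      funext j
      by_cases hj : j = i
      · subst hj
        simp [hi]
      · simp [hj]

end RegularSequences

/-! ### Unipotent change of basis -/

section BaseChange

variable {K : Type*} [Field K] {n : ℕ}

/-- Change of basis by the unipotent matrix `1 + N` with `N ^ 2 = 0`. -/
noncomputable def GradedComplex.baseChange (F : GradedComplex n K)
    (N : Matrix F.ι F.ι (MvPolynomial (Fin n) K)) (hN : N * N = 0)
    (hlvl : ∀ x y, N x y ≠ 0 → F.lvl x = F.lvl y)
    (hhom : ∀ x y, IsHomogeneousOfIntDegree (N x y) (F.deg y - F.deg x)) :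
    GradedComplex n K where
  ι := F.ι
  lvl := F.lvl
  d := (1 - N) * F.d * (1 + N)
  lvl_eq x y h := by
    obtain ⟨z, -, hz⟩ := Finset.exists_ne_zero_of_sum_ne_zero h
    obtain ⟨w, -, hw⟩ := Finset.exists_ne_zero_of_sum_ne_zero (left_ne_zero_of_mul hz)
    have h1 : F.lvl x = F.lvl w := by
      by_cases hxw : x = w
      · rw [hxw]
      · refine hlvl x w fun h' => left_ne_zero_of_mul hw ?_
        simp [Matrix.one_apply_ne hxw, h']
    have h2 : F.lvl z = F.lvl y := by
      by_cases hxw : z = y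
      · rw [hxw]
      · refine hlvl z y fun h' => right_ne_zero_of_mul hz ?_
        simp [Matrix.one_apply_ne hxw, h']
    have h3 := F.lvl_eq w z (right_ne_zero_of_mul hw)
    omega
  d_mul_d := by
    have h1 : (1 + N) * (1 - N) = 1 := by
      rw [add_mul, one_mul, mul_sub, mul_one, hN]; abel
    calc (1 - N) * F.d * (1 + N) * ((1 - N) * F.d * (1 + N))
        = (1 - N) * F.d * ((1 + N) * (1 - N)) * F.d * (1 + N) := by
          simp only [Matrix.mul_assoc]
      _ = 0 := by
          rw [h1, Matrix.mul_one, Matrix.mul_assoc (1 - N), F.d_mul_d, Matrix.mul_zero,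
            Matrix.zero_mul]
  deg := F.deg
  homogeneous x y := by
    have hone : ∀ x y, IsHomogeneousOfIntDegree ((1 : Matrix F.ι F.ι (MvPolynomial (Fin n) K)) x y)
        (F.deg y - F.deg x) := by
      intro x y
      by_cases h : x = y
      · subst h
        rw [Matrix.one_apply_eq, sub_self]
        exact IsHomogeneousOfIntDegree.one
      · rw [Matrix.one_apply_ne h]
        exact IsHomogeneousOfIntDegree.zero _
    refine IsHomogeneousOfIntDegree.sum _ _ fun z _ => ?_
    have h1 : IsHomogeneousOfIntDegree (((1 - N) * F.d) x z) (F.deg z - F.deg x) := by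
      refine IsHomogeneousOfIntDegree.sum _ _ fun w _ => ?_
      have h2 : IsHomogeneousOfIntDegree ((1 - N) x w) (F.deg w - F.deg x) := by
        rw [Matrix.sub_apply, sub_eq_add_neg]
        exact (hone x w).add (hhom x w).neg
      have h3 := h2.mul (F.homogeneous w z)
      rwa [show F.deg w - F.deg x + (F.deg z - F.deg w) = F.deg z - F.deg x by ring] at h3
    have h2 : IsHomogeneousOfIntDegree ((1 + N) z y) (F.deg y - F.deg z) :=
      (hone z y).add (hhom z y)
    have h3 := h1.mul h2
    rwa [show F.deg z - F.deg x + (F.deg y - F.deg z) = F.deg y - F.deg x by ring] at h3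

/-- Since `N ^ 2 = 0`, the inverse of `1 + N` is `1 - N`. The condition `hNo` makes `1 + N` fix the
generator of `F_0`, so the resolved ideal stays the same. -/
theorem IsResolution.baseChange {F : GradedComplex n K} {I : Ideal (MvPolynomial (Fin n) K)}
    {c : ℕ} {o : F.ι} (h : IsResolution F I c o)
    (N : Matrix F.ι F.ι (MvPolynomial (Fin n) K)) (hN : N * N = 0)
    (hlvl : ∀ x y, N x y ≠ 0 → F.lvl x = F.lvl y)
    (hhom : ∀ x y, IsHomogeneousOfIntDegree (N x y) (F.deg y - F.deg x))
    (hNo : ∀ x, N x o = 0) : IsResolution (F.baseChange N hN hlvl hhom) I c o := by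
  have e1 : (1 + N) * (1 - N) = 1 := by
    rw [add_mul, one_mul, mul_sub, mul_one, hN]; abel
  have e2 : (1 - N) * (1 + N) = 1 := by
    rw [sub_mul, one_mul, mul_add, mul_one, hN]; abel
  have hsupp : ∀ {m v}, F.Supp m v → F.Supp m (N *ᵥ v) := by
    intro m v hv x hx
    refine Finset.sum_eq_zero fun y _ => ?_
    by_contra h'
    have h1 := hlvl x y (left_ne_zero_of_mul h')
    exact right_ne_zero_of_mul h' (hv y (by omega))
  have hd : ∀ v : F.ι → MvPolynomial (Fin n) K,
      (F.baseChange N hN hlvl hhom).d *ᵥ v = (1 - N) *ᵥ (F.d *ᵥ ((1 + N) *ᵥ v)) := by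
    intro v
    rw [mulVec_mulVec, mulVec_mulVec]
    rfl
  have hcancel : ∀ u v : F.ι → MvPolynomial (Fin n) K,
      (1 - N) *ᵥ u = v ↔ u = (1 + N) *ᵥ v := by
    intro u v
    constructor
    · rintro rfl
      rw [mulVec_mulVec, e1, one_mulVec]
    · rintro rfl
      rw [mulVec_mulVec, e2, one_mulVec]
  refine ⟨?_, h.lvl_le, h.lvl_eq_zero, h.deg_o, ?_⟩
  · have key : ∀ m, 0 < m → ∀ v : F.ι → MvPolynomial (Fin n) K, F.Supp m v →
        (1 - N) *ᵥ (F.d *ᵥ ((1 + N) *ᵥ v)) = 0 → ∃ w : F.ι → MvPolynomial (Fin n) K,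
          F.Supp (m + 1) w ∧ (1 - N) *ᵥ (F.d *ᵥ ((1 + N) *ᵥ w)) = v := by
      intro m hm v hv hdv
      rw [hcancel, mulVec_zero] at hdv
      obtain ⟨w, hw, hw'⟩ := h.exact m hm ((1 + N) *ᵥ v)
        (by rw [add_mulVec, one_mulVec]; exact hv.add (hsupp hv)) hdv
      refine ⟨(1 - N) *ᵥ w, ?_, ?_⟩
      · rw [sub_mulVec, one_mulVec]
        exact hw.sub (hsupp hw)
      · rw [hcancel, mulVec_mulVec w, e1, one_mulVec, hw']
    intro m hm v hv hdv
    obtain ⟨w, hw, hw'⟩ := key m hm v hv ((hd v).symm.trans hdv)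
    exact ⟨w, hw, (hd w).trans hw'⟩
  · intro f
    rw [h.mem_iff]
    have hs : (1 + N) *ᵥ (Pi.single o f : F.ι → _) = Pi.single o f := by
      rw [add_mulVec, one_mulVec, Matrix.mulVec_single]
      funext x
      simp [hNo]
    constructor
    · rintro ⟨w, hw⟩
      have hw' : (1 + N) *ᵥ ((1 - N) *ᵥ w) = w := by rw [mulVec_mulVec w, e1, one_mulVec]
      refine ⟨(1 - N) *ᵥ w, (hd ((1 - N) *ᵥ w : F.ι → _)).trans ((hcancel _ _).2 ?_)⟩
      exact (congrArg _ hw').trans (hw.trans hs.symm)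
    · rintro ⟨w, hw⟩
      exact ⟨(1 + N) *ᵥ w, ((hcancel _ _).1 ((hd w).symm.trans hw)).trans hs⟩

end BaseChange

/-! ### Degrees at the two ends of the linked resolution -/

namespace LinkData

variable {K : Type*} [Field K] {n c : ℕ} (L : LinkData n K c)

/-- The `i`-th element of the regular sequence as a basis element of the linked resolution. -/
def gen (i : Fin c) : L.G.ι := Sum.inr ⟨L.b i, L.keepC_of_lvl_add_one (L.lvl_b i)⟩

theorem gen_injective : Function.Injective L.gen := fun _ _ h =>
  L.koszul.b_injective (congrArg Subtype.val (Sum.inr_injective h))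

theorem G_lvl_gen (i : Fin c) : L.G.lvl (L.gen i) = 1 := by
  have h := L.lvl_b i
  show c + 1 - (L.C.lvl (L.b i) + 1) = 1
  omega

theorem G_deg_gen (i : Fin c) : L.G.deg (L.gen i) = L.δ i := by
  show ∑ j, L.δ j - L.C.deg (L.b i) = _
  rw [L.koszul.deg_b]
  ring

theorem G_d_gen (i : Fin c) : L.G.d L.bot (L.gen i) = L.α i ∨ L.G.d L.bot (L.gen i) = -L.α i := by
  have e : L.G.d L.bot (L.gen i) = -L.C.d (L.b i) L.t := rfl
  rw [e]
  rcases L.koszul.d_t i with h | h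
  · right; rw [h]
  · left; rw [h, neg_neg]

theorem G_regular : WeaklyRegularSeq fun i => L.G.d L.bot (L.gen i) :=
  L.regular.of_neg L.G_d_gen

/-- A basis element of the linked resolution as one of `F` or `C`. -/
def toSum : L.G.ι → L.F.ι ⊕ L.C.ι := Sum.map Subtype.val Subtype.val

theorem toSum_injective : Function.Injective L.toSum :=
  Sum.map_injective.2 ⟨Subtype.val_injective, Subtype.val_injective⟩

theorem G_deg_eq : L.G.deg = Sum.elim (fun x => ∑ i, L.δ i - L.F.deg x)
    (fun y => ∑ i, L.δ i - L.C.deg y) ∘ L.toSum := by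
  funext p
  rcases p with x | y <;> rfl

theorem G_lvl_eq_one_cases {p : L.G.ι} (hp : L.G.lvl p = 1) :
    (∃ x, ∃ hx : L.KeepF x, L.F.lvl x = c ∧ p = (Sum.inl ⟨x, hx⟩ : L.ConeIdx)) ∨
      ∃ i, p = L.gen i := by
  rcases p with ⟨x, hx⟩ | ⟨y, hy⟩
  · refine Or.inl ⟨x, hx, ?_, rfl⟩
    have h1 : c + 1 - L.F.lvl x = 1 := hp
    omega
  · have h1 : c + 1 - (L.C.lvl y + 1) = 1 := hp
    obtain ⟨i, rfl⟩ := (L.koszul.lvl_add_one y).1 (by omega)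
    exact Or.inr ⟨i, rfl⟩

/-- The degrees of the generators of the linked ideal. -/
theorem G_degrees_one :
    (Finset.univ.filter fun p => L.G.lvl p = 1).val.map L.G.deg =
      (Finset.univ.filter fun x => L.F.lvl x = c).val.map (fun x => ∑ i, L.δ i - L.F.deg x) +
        (Finset.univ : Finset (Fin c)).val.map L.δ := by
  have h2 := L.two_le
  have key : (Finset.univ.filter fun p => L.G.lvl p = 1).val.map L.toSum =
      (Finset.univ.filter fun x => L.F.lvl x = c).val.map Sum.inl +
        (Finset.univ : Finset (Fin c)).val.map (fun i => Sum.inr (L.b i)) := by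
    refine (Multiset.Nodup.ext ((Finset.nodup _).map L.toSum_injective)
      (Multiset.nodup_add.2 ⟨(Finset.nodup _).map Sum.inl_injective,
        (Finset.nodup _).map (Sum.inr_injective.comp L.koszul.b_injective), ?_⟩)).2 ?_
    · rw [Multiset.disjoint_left]
      intro p hp hp'
      obtain ⟨x, -, rfl⟩ := Multiset.mem_map.1 hp
      obtain ⟨i, -, h⟩ := Multiset.mem_map.1 hp'
      exact Sum.inr_ne_inl h
    · intro q
      rw [Multiset.mem_add, Multiset.mem_map, Multiset.mem_map, Multiset.mem_map]
      constructor
      · rintro ⟨p, hp, rfl⟩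
        rcases L.G_lvl_eq_one_cases (Finset.mem_filter.1 hp).2 with ⟨x, hx, hxc, rfl⟩ | ⟨i, rfl⟩
        · exact Or.inl ⟨x, Finset.mem_filter.2 ⟨Finset.mem_univ _, hxc⟩, rfl⟩
        · exact Or.inr ⟨i, Finset.mem_univ i, rfl⟩
      · rintro (⟨x, hx, rfl⟩ | ⟨i, -, rfl⟩)
        · have hxc : L.F.lvl x = c := (Finset.mem_filter.1 hx).2
          refine ⟨(Sum.inl ⟨x, L.keepF_of_two_le (by omega)⟩ : L.ConeIdx),
            Finset.mem_filter.2 ⟨Finset.mem_univ _, ?_⟩, rfl⟩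
          show c + 1 - L.F.lvl x = 1
          omega
        · exact ⟨L.gen i, Finset.mem_filter.2 ⟨Finset.mem_univ _, L.G_lvl_gen i⟩, rfl⟩
  rw [G_deg_eq, ← Multiset.map_map, key, Multiset.map_add, Multiset.map_map, Multiset.map_map]
  congr 1
  refine Multiset.map_congr rfl fun i _ => ?_
  exact L.G_deg_gen i

/-- The degrees of the top free module in the linked resolution. -/
theorem G_degrees_top :
    (Finset.univ.filter fun p => L.G.lvl p = c).val.map L.G.deg =
      (Finset.univ.filter fun x => L.F.lvl x = 1 ∧ ∀ i, L.U i ≠ some x).val.map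
        (fun x => ∑ i, L.δ i - L.F.deg x) := by
  have h2 := L.two_le
  have key : (Finset.univ.filter fun p => L.G.lvl p = c).val.map L.toSum =
      (Finset.univ.filter fun x => L.F.lvl x = 1 ∧ ∀ i, L.U i ≠ some x).val.map Sum.inl := by
    refine (Multiset.Nodup.ext ((Finset.nodup _).map L.toSum_injective)
      ((Finset.nodup _).map Sum.inl_injective)).2 ?_
    intro q
    rw [Multiset.mem_map, Multiset.mem_map]
    constructor
    · rintro ⟨p, hp, rfl⟩
      have hp' := (Finset.mem_filter.1 hp).2
      rcases p with ⟨x, hx⟩ | ⟨y, hy⟩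
      · have h1 : c + 1 - L.F.lvl x = c := hp'
        have h3 := hx.1
        exact ⟨x, Finset.mem_filter.2 ⟨Finset.mem_univ _, by omega, hx.2⟩, rfl⟩
      · have h1 : c + 1 - (L.C.lvl y + 1) = c := hp'
        have h3 := hy.1
        omega
    · rintro ⟨x, hx, rfl⟩
      obtain ⟨hx1, hx2⟩ := (Finset.mem_filter.1 hx).2
      refine ⟨(Sum.inl ⟨x, by omega, hx2⟩ : L.ConeIdx),
        Finset.mem_filter.2 ⟨Finset.mem_univ _, ?_⟩, rfl⟩
      show c + 1 - L.F.lvl x = c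
      omega
  rw [G_deg_eq, ← Multiset.map_map, key, Multiset.map_map]
  rfl

end LinkData

/-! ### Links along general combinations of generators -/

section RegularGenerators

variable {K : Type*} [Field K] {n c : ℕ}

theorem IsHomogeneousOfIntDegree.isHomogeneous {f : MvPolynomial (Fin n) K} {e : ℤ} {m : ℕ}
    (h : IsHomogeneousOfIntDegree f e) (hm : e = m) : f.IsHomogeneous m := by
  obtain rfl | ⟨k, hk, hf⟩ := h
  · exact MvPolynomial.isHomogeneous_zero _ _ _
  · obtain rfl : k = m := by omega
    exact hf

theorem IsHomogeneousOfIntDegree.of_isHomogeneous {f : MvPolynomial (Fin n) K} {e : ℤ} {m : ℕ}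
    (h : f.IsHomogeneous m) (hm : e = m) : IsHomogeneousOfIntDegree f e :=
  Or.inr ⟨m, hm.symm, h⟩

theorem isHomogeneousRegularSequence_ofFn {α : Fin c → MvPolynomial (Fin n) K}
    (hα : WeaklyRegularSeq α) (hhom : ∀ i, ∃ m : ℕ, (α i).IsHomogeneous m)
    (hne : Ideal.span (Set.range α) ≠ ⊤) : IsHomogeneousRegularSequence (List.ofFn α) := by
  refine ⟨⟨(isWeaklyRegular_ofFn_iff α).2 hα, ?_⟩, ?_⟩
  · rw [ofList_ofFn, smul_eq_mul, Ideal.mul_top]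
    exact hne.symm
  · intro f hf
    obtain ⟨i, rfl⟩ := (List.mem_ofFn' _ _).1 hf
    exact hhom i

/-- With generators of positive degree, every element of the ideal has constant term zero. -/
theorem IsResolution.ne_top {F : GradedComplex n K} {I : Ideal (MvPolynomial (Fin n) K)} {o : F.ι}
    (h : IsResolution F I c o) (hpos : ∀ x, F.lvl x = 1 → 0 < F.deg x) : I ≠ ⊤ := by
  intro hI
  have h1 : (1 : MvPolynomial (Fin n) K) ∈ I := hI ▸ Submodule.mem_top
  obtain ⟨w, hw⟩ := (h.mem_iff 1).1 h1
  have h2 : ∑ x, F.d o x * w x = 1 := (congrFun hw o).trans (Pi.single_eq_same o _)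
  have h3 := congrArg MvPolynomial.constantCoeff h2
  rw [map_sum, map_one] at h3
  refine zero_ne_one (h3.symm.trans ?_).symm
  refine Finset.sum_eq_zero fun x _ => ?_
  rw [map_mul]
  by_cases hx : F.lvl x = 1
  · have h4 := F.homogeneous o x
    have h5 := hpos x hx
    rw [h.deg_o, sub_zero] at h4
    obtain h4 | ⟨m, hm, hf⟩ := h4
    · rw [h4, map_zero, zero_mul]
    · rw [MvPolynomial.constantCoeff_eq, hf.coeff_eq_zero (by simp; omega), zero_mul]
  · rw [F.d_eq_zero (by rw [(h.lvl_eq_zero o).2 rfl]; exact hx), map_zero, zero_mul]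

/-- The basis elements `T i` of `F` in level one are mapped to a regular sequence. -/
structure RegularGenerators (F : GradedComplex n K) (o : F.ι) (T : Fin c → F.ι) : Prop where
  injective : Function.Injective T
  lvl_eq : ∀ i, F.lvl (T i) = 1
  regular : WeaklyRegularSeq fun i => F.d o (T i)

theorem LinkData.regularGenerators (L : LinkData n K c) :
    RegularGenerators L.G L.bot L.gen :=
  ⟨L.gen_injective, L.G_lvl_gen, L.G_regular⟩

theorem LinkData.homogeneouslyLinked (L : LinkData n K c) (hI : L.I ≠ ⊤) :
    HomogeneouslyLinked L.J L.I := by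
  refine ⟨L.isResolution.isHomogeneousIdeal, L.res.isHomogeneousIdeal, List.ofFn L.α,
    isHomogeneousRegularSequence_ofFn L.regular (fun i => ?_) ?_, ?_, ?_, ?_⟩
  · have h := L.G.homogeneous L.bot (L.gen i)
    rcases L.G_d_gen i with e | e
    · rw [e] at h
      exact h.exists_isHomogeneous
    · have h2 := h.neg
      rw [e, neg_neg] at h2
      exact h2.exists_isHomogeneous
  · intro h
    exact hI (top_le_iff.1 (h.symm.le.trans L.span_le))
  · rw [ofList_ofFn]
    refine le_inf (fun f hf => ?_) L.span_le
    rw [L.mem_J_iff_mul]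
    exact fun r _ => Ideal.mul_mem_right _ _ hf
  · rw [ofList_ofFn]; rfl
  · rw [ofList_ofFn]; exact L.I_eq_colon

/-- A link along general linear combinations of the basis elements `U i` and `T i`. -/
theorem RegularGenerators.exists_linkData [Infinite K] {F : GradedComplex n K}
    {I : Ideal (MvPolynomial (Fin n) K)} {o : F.ι} (hF : IsResolution F I c o) {T : Fin c → F.ι}
    (hT : RegularGenerators F o T) (hc : 2 ≤ c) (U : Fin c → Option F.ι)
    (hU1 : ∀ i x, U i = some x → F.lvl x = 1)
    (hUinj : ∀ i j x, U i = some x → U j = some x → i = j)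
    (hUT : ∀ i j, U i = some (T j) → i = j) (hU2 : c = 2 → ∀ i, U i = none)
    (δ : Fin c → ℤ) (hδ : ∀ i x, U i = some x → δ i = F.deg x) (hpos : ∀ i, 0 < F.deg (T i))
    (hTδ : ∀ i, F.deg (T i) ≤ δ i) :
    ∃ L : LinkData n K c, L.I = I ∧ L.δ = δ ∧
      (Finset.univ.filter fun x => L.F.lvl x = c).val.map L.F.deg =
        (Finset.univ.filter fun x => F.lvl x = c).val.map F.deg ∧
      (Finset.univ.filter fun x => L.F.lvl x = 1 ∧ ∀ i, L.U i ≠ some x).val.map L.F.deg =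
        (Finset.univ.filter fun x => F.lvl x = 1 ∧ ∀ i, U i ≠ some x).val.map F.deg := by
  classical
  have hlo : F.lvl o = 0 := (hF.lvl_eq_zero o).2 rfl
  have hTo : ∀ i, T i ≠ o := fun i h => by have := hT.lvl_eq i; rw [h, hlo] at this; omega
  have hUo : ∀ i, U i ≠ some o := fun i h => by have := hU1 i o h; omega
  have hdT : ∀ i, (F.d o (T i)).IsHomogeneous (F.deg (T i)).toNat := fun i => by
    refine (F.homogeneous o (T i)).isHomogeneous ?_
    have := hpos i
    rw [hF.deg_o]
    omega
  -- Indices with `U i = some (T i)` keep `T i`. At the others the element becomes the image of `U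
  -- i` plus `g i` times that of `T i`, with zero in place of `U i` when nothing is chosen.
  obtain ⟨g, hg, hreg⟩ := hT.regular.exists_add_mul (d := fun i => (F.deg (T i)).toNat)
    (fun i => by have := hpos i; omega) hdT (fun i => (δ i - F.deg (T i)).toNat)
    (fun i => (U i).elim 0 (F.d o)) (fun i => by
      rcases hUi : U i with _ | x
      · exact MvPolynomial.isHomogeneous_zero _ _ _
      · refine (F.homogeneous o x).isHomogeneous ?_
        have h1 := hδ i x hUi
        have h2 := hpos i
        have h3 := hTδ i
        rw [hF.deg_o]
        omega) (Finset.univ.filter fun i => U i ≠ some (T i))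
  set β : Fin c → MvPolynomial (Fin n) K := fun i =>
    if i ∈ Finset.univ.filter fun i => U i ≠ some (T i) then
      (U i).elim 0 (F.d o) + g i * F.d o (T i) else F.d o (T i) with hβ
  have hgi : ∀ i, IsHomogeneousOfIntDegree (g i) (δ i - F.deg (T i)) := fun i =>
    .of_isHomogeneous (hg i) (by have := hTδ i; omega)
  have hβδ : ∀ i, IsHomogeneousOfIntDegree (β i) (δ i) := by
    intro i
    rw [hβ]
    dsimp only
    split_ifs with h
    · refine IsHomogeneousOfIntDegree.add ?_ ?_
      · rcases hUi : U i with _ | x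
        · exact .zero _
        · have h1 := F.homogeneous o x
          rwa [hF.deg_o, sub_zero, ← hδ i x hUi] at h1
      · have h1 := (hgi i).mul (F.homogeneous o (T i))
        rwa [hF.deg_o, sub_zero, sub_add_cancel] at h1
    · rw [Finset.mem_filter, not_and, not_not] at h
      have h1 := F.homogeneous o (T i)
      rwa [hF.deg_o, sub_zero, ← hδ i _ (h (Finset.mem_univ i))] at h1
  -- In the new basis `U i` becomes `U i + g i • T i`, so the chosen general elements are images of
  -- basis elements. By `hUT` a `T j` equal to some `U i` has `i = j`, and such indices are left
  -- out; hence `N * N = 0`.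
  let N : Matrix F.ι F.ι (MvPolynomial (Fin n) K) := Matrix.of fun y x =>
    ∑ i, if U i = some x ∧ U i ≠ some (T i) ∧ y = T i then g i else 0
  have hNapp : ∀ y x, N y x =
      ∑ i, if U i = some x ∧ U i ≠ some (T i) ∧ y = T i then g i else 0 := fun _ _ => rfl
  have hN0 : ∀ y x, N y x ≠ 0 → ∃ i, U i = some x ∧ U i ≠ some (T i) ∧ y = T i := by
    intro y x h
    rw [hNapp] at h
    obtain ⟨i, -, hi⟩ := Finset.exists_ne_zero_of_sum_ne_zero h
    exact ⟨i, by by_contra h'; exact hi (if_neg h')⟩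
  have hNN : N * N = 0 := by
    ext y x
    rw [Matrix.mul_apply, Matrix.zero_apply]
    congr 1
    refine Finset.sum_eq_zero fun z _ => ?_
    by_contra h
    obtain ⟨i, hi1, hi2, -⟩ := hN0 _ _ (left_ne_zero_of_mul h)
    obtain ⟨j, -, -, rfl⟩ := hN0 _ _ (right_ne_zero_of_mul h)
    obtain rfl := hUT i j hi1
    exact hi2 hi1
  have hNlvl : ∀ x y, N x y ≠ 0 → F.lvl x = F.lvl y := by
    intro x y h
    obtain ⟨i, hi1, -, rfl⟩ := hN0 _ _ h
    rw [hT.lvl_eq, hU1 i y hi1]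
  have hNhom : ∀ x y, IsHomogeneousOfIntDegree (N x y) (F.deg y - F.deg x) := by
    intro x y
    rw [hNapp]
    refine IsHomogeneousOfIntDegree.sum _ _ fun i _ => ?_
    split_ifs with h
    · rw [h.2.2, ← hδ i y h.1]
      exact hgi i
    · exact .zero _
  have hNo : ∀ x, N x o = 0 := by
    intro x
    by_contra h
    obtain ⟨i, hi, -⟩ := hN0 _ _ h
    exact hUo i hi
  have hoN : ∀ x, N o x = 0 := by
    intro x
    by_contra h
    obtain ⟨i, -, -, hi⟩ := hN0 _ _ h
    exact hTo i hi.symm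
  have hF' := hF.baseChange N hNN hNlvl hNhom hNo
  have hd' : ∀ x, ((1 - N) * F.d * (1 + N)) o x = F.d o x + ∑ z, F.d o z * N z x := by
    intro x
    have h1 : ∀ z, ((1 - N) * F.d) o z = F.d o z := by
      intro z
      rw [sub_mul, one_mul, Matrix.sub_apply, Matrix.mul_apply]
      simp [hoN]
    rw [mul_add, mul_one, Matrix.add_apply, h1, Matrix.mul_apply]
    simp only [h1]
  have hdU : ∀ i x, U i = some x → ((1 - N) * F.d * (1 + N)) o x = β i := by
    intro i x hx
    rw [hd']
    have h1 : ∀ z, N z x = if U i ≠ some (T i) ∧ z = T i then g i else 0 := by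
      intro z
      rw [hNapp, Finset.sum_eq_single i]
      · simp [hx]
      · intro j _ hj
        exact if_neg fun h => hj (hUinj j i x h.1 hx)
      · exact fun h => absurd (Finset.mem_univ i) h
    simp only [h1, hβ, Finset.mem_filter, Finset.mem_univ, true_and]
    by_cases h2 : U i = some (T i)
    · have h3 : x = T i := Option.some.inj (hx.symm.trans h2)
      simp [h2, h3]
    · have h3 : x ≠ T i := fun h => h2 (hx.trans (congrArg some h))
      simp [h3, hx, mul_comm]
  have hdT' : ∀ i, U i = none → ((1 - N) * F.d * (1 + N)) o (T i) = F.d o (T i) := by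
    intro i hi
    rw [hd', add_eq_left]
    refine Finset.sum_eq_zero fun z _ => ?_
    by_contra h
    obtain ⟨j, hj, -⟩ := hN0 _ _ (right_ne_zero_of_mul h)
    rw [hUT j i hj, hi] at hj
    exact Option.some_ne_none _ hj.symm
  have hsingle : ∀ {x : F.ι} {r : MvPolynomial (Fin n) K} {e : ℤ},
      IsHomogeneousOfIntDegree r (e - F.deg x) → ∀ y : F.ι,
      IsHomogeneousOfIntDegree ((Pi.single x r : F.ι → _) y) (e - F.deg y) := by
    intro x r e hr y
    by_cases hy : y = x
    · subst hy
      rwa [Pi.single_eq_same]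
    · rw [Pi.single_eq_of_ne hy]
      exact .zero _
  obtain ⟨C, oC, t, a, b, hC⟩ := exists_isKoszul β δ hreg hβδ
  -- A chosen index is sent to a basis element and will cancel; an index with nothing chosen is sent
  -- to `g i • T i` and will not.
  let gcol : Fin c → F.ι → MvPolynomial (Fin n) K := fun i =>
    (U i).elim (Pi.single (T i) (g i)) fun x => Pi.single x 1
  obtain ⟨φ, hφ1, hφ2, hφ3, hφ4, hφ5⟩ := exists_comparison hF' hC gcol (fun i => by
      rcases hUi : U i with _ | x
      · simp only [gcol, hUi, Option.elim]
        have := F.supp_single (T i) (g i)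
        rwa [hT.lvl_eq] at this
      · simp only [gcol, hUi, Option.elim]
        have := F.supp_single x (1 : MvPolynomial (Fin n) K)
        rwa [hU1 i x hUi] at this) (fun i => by
      rcases hUi : U i with _ | x
      · simp only [gcol, hUi, Option.elim]
        refine (hF'.mulVec_single (hT.lvl_eq i) (g i)).trans (congrArg _ ?_)
        refine (congrArg (· * g i) (hdT' i hUi)).trans ?_
        simp [hβ, hUi, mul_comm]
      · simp only [gcol, hUi, Option.elim]
        refine (hF'.mulVec_single (hU1 i x hUi) 1).trans (congrArg _ ?_)
        rw [mul_one]
        exact hdU i x hUi) (fun i y => by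
      rcases hUi : U i with _ | x
      · simp only [gcol, hUi, Option.elim]
        exact hsingle (hgi i) y
      · simp only [gcol, hUi, Option.elim]
        refine hsingle ?_ y
        rw [hδ i x hUi, sub_self]
        exact .one)
  refine ⟨{ I := I
            F := F.baseChange N hNN hNlvl hNhom
            o' := o
            res := hF'
            α := β
            regular := hreg
            δ := δ
            C := C
            o := oC
            t := t
            a := a
            b := b
            koszul := hC
            φ := φ
            φ_lvl := hφ1
            φ_comm := hφ2
            φ_hom := hφ3
            φ_o := hφ4
            U := U
            U_lvl := hU1
            U_inj := hUinj
            φ_U := fun i x hx y => by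
              rw [hφ5]
              simp only [gcol, hx, Option.elim]
              rfl
            two_le := hc
            U_eq_none := hU2 }, rfl, rfl, rfl, rfl⟩

end RegularGenerators

/-! ### Choosing generators for prescribed parts -/

section Multisets

theorem Multiset.exists_le_of_le_map {α β : Type*} {f : α → β} {s : Multiset β} {t : Multiset α}
    (h : s ≤ t.map f) : ∃ u ≤ t, u.map f = s := by
  induction s using Quotient.inductionOn with | _ l
  induction t using Quotient.inductionOn with | _ l'
  obtain ⟨l₁, h1, h2⟩ := (Multiset.coe_le.1 h : l.Subperm (l'.map f))
  obtain ⟨l₂, h3, rfl⟩ := List.sublist_map_iff.1 h2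
  exact ⟨l₂, Multiset.coe_le.2 h3.subperm, Multiset.coe_eq_coe.2 h1⟩

theorem Multiset.eq_of_filter_ne_zero_eq {s t : Multiset ℕ} (hc : s.card = t.card)
    (h : s.filter (· ≠ 0) = t.filter (· ≠ 0)) : s = t := by
  have key : ∀ u : Multiset ℕ, u.filter (· ≠ 0) +
      Multiset.replicate (u.card - (u.filter (· ≠ 0)).card) 0 = u := by
    intro u
    have h1 := Multiset.filter_add_not (· ≠ 0) u
    have h2 : u.filter (fun a => ¬ a ≠ 0) =
        Multiset.replicate (u.card - (u.filter (· ≠ 0)).card) 0 := by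
      rw [Multiset.eq_replicate]
      refine ⟨?_, fun b hb => not_not.1 (Multiset.mem_filter.1 hb).2⟩
      have h3 := congrArg Multiset.card h1
      rw [Multiset.card_add] at h3
      omega
    rw [← h2, h1]
  rw [← key s, ← key t, h, hc]

/-- A chosen generator that is some `T j` must keep the index `j`; this is what makes the later
change of basis square-zero, and it keeps the degree of `T i` below that of the element replacing
it. -/
theorem exists_choice {X : Type*} [DecidableEq X] {c : ℕ} {T : Fin c → X}
    (hT : Function.Injective T) (V : Finset X) (hV : V.card ≤ c) :
    ∃ U : Fin c → Option X, (Finset.univ : Finset (Fin c)).val.filterMap U = V.val ∧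
      (∀ i j x, U i = some x → U j = some x → i = j) ∧ ∀ i j, U i = some (T j) → i = j := by
  classical
  -- A set of exactly `c` elements containing `V` admits a numbering that agrees with `T` wherever
  -- `T` takes values in `V`; the numbers of elements outside `V` become `none`.
  obtain ⟨t, hVt, ht, htc⟩ := Finset.exists_subsuperset_card_eq
    (Finset.subset_union_left (s₁ := V) (s₂ := Finset.univ.image T)) hV (by
      refine le_trans ?_ (Finset.card_le_card Finset.subset_union_right)
      rw [Finset.card_image_of_injective _ hT, Finset.card_univ, Fintype.card_fin])
  obtain ⟨g, hg⟩ := Finset.exists_equiv_extend_of_card_eq (α := Fin c) (t := t)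
    (by rw [Fintype.card_fin, htc]) (s := Finset.univ.filter fun i => T i ∈ V) (f := T)
    (by
      intro x hx
      obtain ⟨i, hi, rfl⟩ := Finset.mem_image.1 hx
      exact hVt (Finset.mem_filter.1 hi).2) hT.injOn
  have hU : ∀ i x, (if (g i : X) ∈ V then some (g i : X) else none) = some x ↔
      (g i : X) = x ∧ x ∈ V := by
    intro i x
    split_ifs with h
    · rw [Option.some.injEq]
      exact ⟨fun h' => ⟨h', h' ▸ h⟩, fun h' => h'.1⟩
    · exact iff_of_false id fun h' => h (h'.1 ▸ h'.2)
  have hinj : ∀ i j x, (if (g i : X) ∈ V then some (g i : X) else none) = some x →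
      (if (g j : X) ∈ V then some (g j : X) else none) = some x → i = j := by
    intro i j x hi hj
    exact g.injective (Subtype.ext (((hU i x).1 hi).1.trans ((hU j x).1 hj).1.symm))
  refine ⟨fun i => if (g i : X) ∈ V then some (g i : X) else none, ?_, hinj, ?_⟩
  · refine (Multiset.Nodup.ext (Multiset.Nodup.filterMap _ ?_ (Finset.nodup _)) V.nodup).2 ?_
    · intro i j x hi hj
      exact hinj i j x hi hj
    · intro x
      rw [Multiset.mem_filterMap]
      constructor
      · rintro ⟨i, -, hi⟩
        exact ((hU i x).1 hi).2
      · intro hx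
        refine ⟨g.symm ⟨x, hVt hx⟩, Finset.mem_univ (g.symm ⟨x, hVt hx⟩), ?_⟩
        rw [hU]
        simp only [Equiv.apply_symm_apply, true_and]
        exact hx
  · intro i j hij
    obtain ⟨h1, h2⟩ := (hU i _).1 hij
    refine g.injective (Subtype.ext (h1.trans (hg j ?_).symm))
    exact Finset.mem_filter.2 ⟨Finset.mem_univ _, h2⟩

/-- The indices with `U i = none` supply the zeros of `s`; the cardinality fixes how many there are.
-/
theorem map_elim_eq {X : Type*} {c : ℕ} (U : Fin c → Option X) (V : Multiset X)
    (hUV : (Finset.univ : Finset (Fin c)).val.filterMap U = V) (w : X → ℕ) {s : Multiset ℕ}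
    (hs : s.card = c) (hw : V.map w = s.filter (· ≠ 0)) :
    (Finset.univ : Finset (Fin c)).val.map (fun i => (U i).elim 0 w) = s := by
  refine Multiset.eq_of_filter_ne_zero_eq ?_ ?_
  · rw [Multiset.card_map, hs]
    exact Finset.card_fin c
  · have h1 : ∀ x ∈ V, w x ≠ 0 := by
      intro x hx
      have h2 : w x ∈ V.map w := Multiset.mem_map_of_mem w hx
      rw [hw] at h2
      exact (Multiset.mem_filter.1 h2).2
    have key : ∀ u : Multiset (Fin c), (∀ x ∈ u.filterMap U, w x ≠ 0) →
        (u.map fun i => (U i).elim 0 w).filter (· ≠ 0) = (u.filterMap U).map w := by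
      intro u
      induction u using Multiset.induction_on with
      | empty => exact fun _ => rfl
      | cons i u ih =>
        intro hu
        rw [Multiset.map_cons]
        rcases hi : U i with _ | x
        · rw [Multiset.filterMap_cons_none _ _ hi] at hu ⊢
          rw [Multiset.filter_cons_of_neg _ (by simp), ih hu]
        · rw [Multiset.filterMap_cons_some _ _ _ hi] at hu ⊢
          rw [Option.elim_some, Multiset.filter_cons_of_pos (p := (· ≠ 0)) _ (hu x (Multiset.mem_cons_self _ _)),
            ih fun y hy => hu y (Multiset.mem_cons_of_mem hy), Multiset.map_cons]
    rw [key _ (by rwa [hUV]), hUV, hw]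

end Multisets

/-! ### Realizing one step of the linkage formula -/

section Realization

variable {K : Type*} [Field K] {c : ℕ}

/-- The ideal `I` with resolution `F` realizes the pair of partitions `(lam, mu)`, and its `c`
generators `T i` of lowest degrees form a regular sequence. -/
structure Realization {K : Type*} [Field K] {c : ℕ} (lam mu : Multiset ℕ)
    (I : Ideal (MvPolynomial (Fin c) K)) (F : GradedComplex c K) (o : F.ι)
    (T : Fin c → F.ι) : Prop where
  res : IsResolution F I c o
  licci : IsHomogeneouslyLicci I
  gens : RegularGenerators F o T
  lowest : ∀ i x, F.lvl x = 1 → (∀ j, x ≠ T j) → F.deg (T i) ≤ F.deg x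
  pos : ∀ x, F.lvl x = 1 → 0 < F.deg x
  deg_one : (Finset.univ.filter fun x => F.lvl x = 1).val.map F.deg =
    lam.map fun l : ℕ => (mu.sum : ℤ) + 1 - (l : ℤ)
  deg_top : (Finset.univ.filter fun x => F.lvl x = c).val.map F.deg =
    mu.map fun m : ℕ => (mu.sum : ℤ) + (c : ℤ) - 2 + (m : ℤ)

/-- `hlow` says that the parts `l + p` dominate those of `mu₂`, so the new regular sequence consists
of generators of lowest degrees and the result can be linked again. `hlt` makes the new generator
degrees positive, and `hc2` rules out cancellation in codimension two. -/
theorem Realization.exists_link [Infinite K] {lam₂ mu₂ : Multiset ℕ}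
    {I : Ideal (MvPolynomial (Fin c) K)} {F : GradedComplex c K} {o : F.ι} {T : Fin c → F.ι}
    (h : Realization lam₂ mu₂ I F o T) (hc : 2 ≤ c) {lam mu lam' : Multiset ℕ} {p : ℤ}
    (hcard : lam'.card = c) (hle : lam'.filter (· ≠ 0) ≤ lam₂)
    (hp : p = ((c : ℤ) - 2) * (mu₂.sum : ℤ) + 1 - (lam'.sum : ℤ))
    (hmu : mu = lam₂ - lam'.filter (· ≠ 0)) (hsum : (mu.sum : ℤ) = mu₂.sum + p)
    (hlam : lam.map (fun a : ℕ => (a : ℤ)) =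
      lam'.map (fun a : ℕ => (a : ℤ) + p) + mu₂.map fun a : ℕ => (a : ℤ))
    (hlow : ∀ l ∈ lam', ∀ m ∈ mu₂, (m : ℤ) ≤ l + p) (hlt : ∀ l ∈ lam, l ≤ mu.sum)
    (hc2 : c = 2 → ∀ l ∈ lam', l = 0) :
    ∃ (J : Ideal (MvPolynomial (Fin c) K)) (G : GradedComplex c K) (o' : G.ι) (S : Fin c → G.ι),
      Realization lam mu J G o' S := by
  classical
  set k₂ : ℤ := Nat.cast mu₂.sum with hk₂
  -- Inverts `l ↦ k₂ + 1 - l`: the part of `lam₂` carried by the generator `x`.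
  let w : F.ι → ℕ := fun x => (k₂ + 1 - F.deg x).toNat
  have hw : (Finset.univ.filter fun x => F.lvl x = 1).val.map w = lam₂ := by
    have h1 := congrArg (Multiset.map fun e : ℤ => (k₂ + 1 - e).toNat) h.deg_one
    rw [Multiset.map_map, Multiset.map_map] at h1
    refine h1.trans ((Multiset.map_congr rfl fun l _ => ?_).trans (Multiset.map_id lam₂))
    change (k₂ + 1 - (k₂ + 1 - (l : ℤ))).toNat = l
    omega
  have hdeg : ∀ x, F.lvl x = 1 → F.deg x = k₂ + 1 - w x := by
    intro x hx
    have h1 : F.deg x ∈ (Finset.univ.filter fun x => F.lvl x = 1).val.map F.deg :=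
      Multiset.mem_map_of_mem _ (Finset.mem_filter.2 ⟨Finset.mem_univ x, hx⟩)
    rw [h.deg_one] at h1
    obtain ⟨l, -, hl⟩ := Multiset.mem_map.1 h1
    simp only [w]
    omega
  obtain ⟨v, hv, hvw⟩ := Multiset.exists_le_of_le_map (hle.trans_eq hw.symm)
  let V : Finset F.ι := ⟨v, Multiset.nodup_of_le hv (Finset.nodup _)⟩
  have hV1 : ∀ x ∈ V, F.lvl x = 1 := fun x hx =>
    (Finset.mem_filter.1 (Multiset.mem_of_le hv hx)).2
  obtain ⟨U, hUV, hUinj, hUT⟩ := exists_choice h.gens.injective V (by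
    have h1 := congrArg Multiset.card hvw
    rw [Multiset.card_map] at h1
    exact h1.le.trans ((Multiset.card_le_card (Multiset.filter_le _ _)).trans_eq hcard))
  have hmem : ∀ x, (∃ i, U i = some x) ↔ x ∈ V := by
    intro x
    have h1 : x ∈ (Finset.univ : Finset (Fin c)).val.filterMap U ↔ x ∈ V := by rw [hUV]; rfl
    rw [← h1, Multiset.mem_filterMap]
    exact exists_congr fun i => (and_iff_right (Finset.mem_univ i)).symm
  have hUw := map_elim_eq U v hUV w hcard hvw
  have hU1 : ∀ i x, U i = some x → F.lvl x = 1 := fun i x hx => hV1 x ((hmem x).1 ⟨i, hx⟩)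
  -- A zero of `lam'` is an index with nothing chosen, hence a form of degree `k₂ + 1`. That is at
  -- least the degree of `T i`, since parts are nonnegative.
  obtain ⟨L, hLI, hLδ, hLc, hL1⟩ := h.gens.exists_linkData h.res hc U hU1 hUinj hUT
    (fun h2 i => by
      rcases hUi : U i with _ | x
      · rfl
      · have h1 : w x ∈ v.map w := Multiset.mem_map_of_mem w ((hmem x).1 ⟨i, hUi⟩)
        rw [hvw, Multiset.mem_filter] at h1
        exact absurd (hc2 h2 _ h1.1) h1.2)
    (fun i => k₂ + 1 - ((U i).elim 0 w : ℕ)) (fun i x hx => by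
      rw [hx, hdeg x (hU1 i x hx)]; rfl) (fun i => h.pos _ (h.gens.lvl_eq i)) (fun i => by
      rcases hUi : U i with _ | x
      · rw [hdeg _ (h.gens.lvl_eq i)]
        simp
      · have h1 : k₂ + 1 - ((some x).elim 0 w : ℕ) = F.deg x := (hdeg x (hU1 i x hUi)).symm
        rw [h1]
        by_cases hx : ∃ j, x = T j
        · obtain ⟨j, rfl⟩ := hx
          rw [hUT i j hUi]
        · exact h.lowest i x (hU1 i x hUi) fun j hj => hx ⟨j, hj⟩)
  have hδ : ∀ i, L.δ i = k₂ + 1 - ((U i).elim 0 w : ℕ) := fun i => congrFun hLδ i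
  -- By the choice of `p` this equals `mu.sum + k₂ + c - 1`. Subtracting from it turns a top degree
  -- `k₂ + c - 2 + m` into `mu.sum + 1 - m` and a generator degree `k₂ + 1 - l` into `mu.sum + c - 2
  -- + l`.
  have hδsum : ∑ i, L.δ i = c * (k₂ + 1) - lam'.sum := by
    have h1 : ∑ i : Fin c, (U i).elim 0 w = lam'.sum := congrArg Multiset.sum hUw
    rw [← h1, Finset.sum_congr rfl fun i _ => hδ i, Finset.sum_sub_distrib]
    simp
  have hcong : ∀ f : ℤ → ℤ, (Finset.univ : Finset (Fin c)).val.map (fun i => f ((U i).elim 0 w : ℕ))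
      = lam'.map fun l : ℕ => f l := by
    intro f
    rw [← hUw, Multiset.map_map]
    rfl
  have hone : (Finset.univ.filter fun x => L.G.lvl x = 1).val.map L.G.deg =
      lam.map fun l : ℕ => (mu.sum : ℤ) + 1 - (l : ℤ) := by
    have h1 : lam.map (fun l : ℕ => (mu.sum : ℤ) + 1 - (l : ℤ)) =
        (lam.map fun a : ℕ => (a : ℤ)).map fun l => (mu.sum : ℤ) + 1 - l := by
      rw [Multiset.map_map]; rfl
    have h2 : (Finset.univ.filter fun x => L.F.lvl x = c).val.map
        (fun x => ∑ i, L.δ i - L.F.deg x) =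
        ((Finset.univ.filter fun x => L.F.lvl x = c).val.map L.F.deg).map
          fun e => ∑ i, L.δ i - e := by
      rw [Multiset.map_map]; rfl
    rw [L.G_degrees_one, h1, hlam, h2, hLc, h.deg_top, Multiset.map_add, Multiset.map_map,
      Multiset.map_map, Multiset.map_map, add_comm]
    congr 1
    · have h3 := hcong fun l => (mu.sum : ℤ) + 1 - (l + p)
      refine Eq.trans (Multiset.map_congr rfl fun i _ => ?_) h3
      rw [hδ, hsum]
      ring
    · refine Multiset.map_congr rfl fun m _ => ?_
      simp only [Function.comp]
      rw [hδsum, hsum, hp]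
      ring
  have htop : (Finset.univ.filter fun x => L.G.lvl x = c).val.map L.G.deg =
      mu.map fun m : ℕ => (mu.sum : ℤ) + (c : ℤ) - 2 + (m : ℤ) := by
    have h2 : (Finset.univ.filter fun x => L.F.lvl x = 1 ∧ ∀ i, L.U i ≠ some x).val.map
        (fun x => ∑ i, L.δ i - L.F.deg x) =
        ((Finset.univ.filter fun x => L.F.lvl x = 1 ∧ ∀ i, L.U i ≠ some x).val.map L.F.deg).map
          fun e => ∑ i, L.δ i - e := by
      rw [Multiset.map_map]; rfl
    have h3 : (Finset.univ.filter fun x => F.lvl x = 1 ∧ ∀ i, U i ≠ some x).val.map w = mu := by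
      have h4 : (Finset.univ.filter fun x => F.lvl x = 1).val =
          v + (Finset.univ.filter fun x => F.lvl x = 1 ∧ ∀ i, U i ≠ some x).val := by
        refine (Multiset.Nodup.ext (Finset.nodup _) (Multiset.nodup_add.2
          ⟨V.nodup, Finset.nodup _, ?_⟩)).2 fun x => ?_
        · rw [Multiset.disjoint_left]
          intro x hx hx'
          obtain ⟨i, hi⟩ := (hmem x).2 hx
          exact (Finset.mem_filter.1 hx').2.2 i hi
        · rw [Multiset.mem_add]
          constructor
          · intro hx
            by_cases hxV : x ∈ V
            · exact Or.inl hxV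
            · refine Or.inr (Finset.mem_filter.2 ⟨Finset.mem_univ _, (Finset.mem_filter.1 hx).2,
                fun i hi => hxV ((hmem x).1 ⟨i, hi⟩)⟩)
          · rintro (hx | hx)
            · exact Multiset.mem_of_le hv hx
            · exact Finset.mem_filter.2 ⟨Finset.mem_univ _, (Finset.mem_filter.1 hx).2.1⟩
      rw [h4, Multiset.map_add, hvw] at hw
      rw [hmu, ← hw, add_tsub_cancel_left]
    rw [L.G_degrees_top, h2, hL1, Multiset.map_map]
    conv_rhs => rw [← h3]
    rw [Multiset.map_map, h3]
    refine Multiset.map_congr rfl fun x hx => ?_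
    simp only [Function.comp]
    rw [hdeg x (Finset.mem_filter.1 hx).2.1, hδsum, hsum, hp]
    ring
  have hGpos : ∀ x, L.G.lvl x = 1 → 0 < L.G.deg x := by
    intro x hx
    have h1 : L.G.deg x ∈ (Finset.univ.filter fun x => L.G.lvl x = 1).val.map L.G.deg :=
      Multiset.mem_map_of_mem _ (Finset.mem_filter.2 ⟨Finset.mem_univ x, hx⟩)
    rw [hone] at h1
    obtain ⟨l, hl, hl'⟩ := Multiset.mem_map.1 h1
    have := hlt l hl
    omega
  refine ⟨L.J, L.G, L.bot, L.gen, L.isResolution, ?_, L.regularGenerators, ?_, hGpos, hone, htop⟩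
  · obtain ⟨J', hJ', hci⟩ := h.licci
    refine ⟨J', Relation.ReflTransGen.head ?_ hJ', hci⟩
    have h1 := L.homogeneouslyLinked (hLI ▸ h.res.ne_top h.pos)
    rwa [hLI] at h1
  · intro i x hx hxT
    rcases L.G_lvl_eq_one_cases hx with ⟨y, hy, hyc, rfl⟩ | ⟨j, rfl⟩
    · rw [L.G_deg_gen, hδ]
      have h1 : L.F.deg y ∈ (Finset.univ.filter fun x => L.F.lvl x = c).val.map L.F.deg :=
        Multiset.mem_map_of_mem _ (Finset.mem_filter.2 ⟨Finset.mem_univ y, hyc⟩)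
      rw [hLc, h.deg_top] at h1
      obtain ⟨m, hm, hm'⟩ := Multiset.mem_map.1 h1
      have h2 : (U i).elim 0 w ∈ lam' := hUw ▸ Multiset.mem_map_of_mem _ (Finset.mem_univ i)
      have h3 := hlow _ h2 m hm
      change _ ≤ ∑ i, L.δ i - L.F.deg y
      rw [← hm', hδsum]
      linarith
    · exact absurd rfl (hxT j)

end Realization

/-! ### From one matrix to a sequence of free modules -/

section GradedFreeResolution

variable {K : Type*} [Field K] {n c : ℕ}

theorem GradedComplex.submatrix_mulVec (F : GradedComplex n K) (i : ℕ)
    {u : F.ι → MvPolynomial (Fin n) K} (hu : F.Supp (i + 1) u) (x : {x // F.lvl x = i}) :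
    ((F.d.submatrix Subtype.val Subtype.val :
      Matrix {x // F.lvl x = i} {x // F.lvl x = i + 1} (MvPolynomial (Fin n) K)) *ᵥ
        fun y => u y.1) x = (F.d *ᵥ u) x.1 := by
  change ∑ y : {x // F.lvl x = i + 1}, F.d x.1 y.1 * u y.1 = ∑ y, F.d x.1 y * u y
  rw [← Finset.sum_subtype (Finset.univ.filter fun y => F.lvl y = i + 1) (by simp)
    (fun y => F.d x.1 y * u y)]
  refine Finset.sum_filter_of_ne fun y _ hy => ?_
  by_contra h
  exact right_ne_zero_of_mul hy (hu y h)

theorem GradedComplex.exists_supp_restrict (F : GradedComplex n K) (i : ℕ)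
    (v : {x // F.lvl x = i} → MvPolynomial (Fin n) K) :
    ∃ u, F.Supp i u ∧ (fun y : {x // F.lvl x = i} => u y.1) = v := by
  refine ⟨fun x => if h : F.lvl x = i then v ⟨x, h⟩ else 0, fun x hx => dif_neg hx, ?_⟩
  funext y
  exact dif_pos y.2

/-- A resolution in the form of a single matrix as a sequence of free modules. -/
def IsResolution.toGradedFreeResolution {F : GradedComplex n K}
    {I : Ideal (MvPolynomial (Fin n) K)} {o : F.ι} (h : IsResolution F I c o) :
    GradedFreeResolution I c where
  ι i := {x // F.lvl x = i}
  deg _ x := F.deg x.1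
  d _ := F.d.submatrix Subtype.val Subtype.val
  homogeneous _ x y := F.homogeneous x.1 y.1
  card_zero := Fintype.card_eq_one_iff.2
    ⟨⟨o, (h.lvl_eq_zero o).2 rfl⟩, fun x => Subtype.ext ((h.lvl_eq_zero _).1 x.2)⟩
  deg_zero x := by
    rw [(h.lvl_eq_zero _).1 x.2, h.deg_o]
  isEmpty_of_lt i hi := ⟨fun x => by
    have h1 := h.lvl_le x.1
    have h2 := x.2
    omega⟩
  exact i := by
    intro v
    rw [Matrix.mulVecLin_apply]
    obtain ⟨u, hu, rfl⟩ := F.exists_supp_restrict (i + 1) v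
    constructor
    · intro hv
      have h1 : F.d *ᵥ u = 0 := by
        funext x
        by_cases hx : F.lvl x = i
        · exact (F.submatrix_mulVec i hu ⟨x, hx⟩).symm.trans (congrFun hv ⟨x, hx⟩)
        · exact hu.d_mulVec x hx
      obtain ⟨w, hw, rfl⟩ := h.exact (i + 1) (Nat.succ_pos i) u hu h1
      exact ⟨fun y => w y.1, funext fun x => F.submatrix_mulVec (i + 1) hw x⟩
    · rintro ⟨w, hw⟩
      obtain ⟨w, hws, rfl⟩ := F.exists_supp_restrict (i + 1 + 1) w
      have h1 : u = F.d *ᵥ w := by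
        funext x
        by_cases hx : F.lvl x = i + 1
        · exact (congrFun hw ⟨x, hx⟩).symm.trans (F.submatrix_mulVec (i + 1) hws ⟨x, hx⟩)
        · exact (hu x hx).trans (hws.d_mulVec x hx).symm
      funext x
      refine (F.submatrix_mulVec i hu x).trans ?_
      rw [h1, F.d_mulVec_d_mulVec]
      rfl
  mem_iff f := by
    rw [h.mem_iff]
    have hlo := (h.lvl_eq_zero o).2 rfl
    constructor
    · rintro ⟨w, hw⟩
      obtain ⟨u, hu, hu'⟩ := F.exists_supp_restrict 1 fun x => w x.1
      have h1 : ∀ x, F.lvl x = 1 → u x = w x := fun x hx => congrFun hu' ⟨x, hx⟩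
      refine ⟨fun x => u x.1, funext fun x => (F.submatrix_mulVec 0 hu x).trans ?_⟩
      have hx := (h.lvl_eq_zero _).1 x.2
      have h2 := congrFun hw x.1
      rw [hx, Pi.single_eq_same] at h2
      rw [hx, ← h2]
      refine Finset.sum_congr rfl fun y _ => ?_
      by_cases hy : F.lvl y = 1
      · rw [h1 y hy]
      · have h3 : F.d o y = 0 := F.d_eq_zero (by rw [hlo]; exact hy)
        change F.d o y * u y = F.d o y * w y
        rw [h3, zero_mul, zero_mul]
    · rintro ⟨w, hw⟩
      obtain ⟨u, hu, rfl⟩ := F.exists_supp_restrict 1 w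
      refine ⟨u, funext fun x => ?_⟩
      by_cases hx : x = o
      · subst hx
        rw [Pi.single_eq_same]
        exact (F.submatrix_mulVec 0 hu ⟨x, hlo⟩).symm.trans (congrFun hw ⟨x, hlo⟩)
      · rw [Pi.single_eq_of_ne hx]
        exact (LevelComplex.Supp.d_mulVec (n := 0) hu) x fun h' => hx ((h.lvl_eq_zero _).1 h')

theorem IsResolution.degrees_toGradedFreeResolution {F : GradedComplex n K}
    {I : Ideal (MvPolynomial (Fin n) K)} {o : F.ι} (h : IsResolution F I c o) (i : ℕ) :
    h.toGradedFreeResolution.degrees i =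
      (Finset.univ.filter fun x => F.lvl x = i).val.map F.deg := by
  have h1 : (Finset.univ : Finset {x // F.lvl x = i}).val.map Subtype.val =
      (Finset.univ.filter fun x => F.lvl x = i).val :=
    (Multiset.Nodup.ext ((Finset.nodup _).map Subtype.val_injective) (Finset.nodup _)).2
      fun x => by simp
  rw [← h1, Multiset.map_map]
  rfl

end GradedFreeResolution

/-! ### The first realization: the ideal of the variables -/

section PointIdeal

variable {K : Type*} [Field K] {c : ℕ}

/-- The resolution `0 → R → R` of the zero ring. -/
noncomputable def GradedComplex.unit (n : ℕ) (K : Type*) [Field K] : GradedComplex n K where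
  ι := Bool
  lvl b := if b then 1 else 0
  d := Matrix.of fun a b => if a = false ∧ b = true then 1 else 0
  lvl_eq a b h := by
    have h1 : a = false ∧ b = true := by
      by_contra h'
      exact h (if_neg h')
    simp [h1.1, h1.2]
  d_mul_d := by
    ext a b
    simp [Matrix.mul_apply]
  deg _ := 0
  homogeneous a b := by
    rw [Matrix.of_apply]
    split_ifs
    · exact .one
    · exact .zero _

theorem GradedComplex.unit_forall {n : ℕ} {p : (GradedComplex.unit n K).ι → Prop}
    (h0 : p (false : Bool)) (h1 : p (true : Bool)) (x : (GradedComplex.unit n K).ι) : p x :=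
  match (x : Bool) with
  | false => h0
  | true => h1

theorem isResolution_unit (hc : 2 ≤ c) :
    IsResolution (GradedComplex.unit c K) ⊤ c (false : Bool) where
  exact m hm v hv hdv := by
    refine ⟨0, fun _ _ => rfl, ?_⟩
    have h1 := congrFun hdv (false : Bool)
    have h2 : v (false : Bool) = 0 := hv (false : Bool) (by simp [GradedComplex.unit]; omega)
    have h3 : v (true : Bool) = 0 := by
      refine Eq.trans ?_ h1
      change _ = ∑ b : Bool, _
      simp [GradedComplex.unit]
    rw [mulVec_zero]
    exact funext (GradedComplex.unit_forall h2.symm h3.symm)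
  lvl_le := GradedComplex.unit_forall (Nat.zero_le c) (by change 1 ≤ c; omega)
  lvl_eq_zero := GradedComplex.unit_forall (iff_of_true rfl rfl)
    (iff_of_false Nat.one_ne_zero (fun h => Bool.false_ne_true h.symm))
  deg_o := rfl
  mem_iff f := by
    refine iff_of_true trivial ⟨fun b : Bool => if b then f else 0, ?_⟩
    refine funext (GradedComplex.unit_forall ?_ ?_)
    · refine Eq.trans (b := f) ?_ rfl
      change ∑ b : Bool, _ = _
      simp [GradedComplex.unit]
    · refine Eq.trans (b := 0) ?_ rfl
      change ∑ b : Bool, _ = _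
      simp [GradedComplex.unit]

/-- The unit ideal, resolved by `0 → R → R`, is linked along the variables. The link is `(x_1, …,
x_c) : R = (x_1, …, x_c)`, itself a complete intersection, and the general construction supplies its
resolution together with regular generators of lowest degrees. -/
theorem exists_realization_replicate (hc : 2 ≤ c) :
    ∃ (J : Ideal (MvPolynomial (Fin c) K)) (G : GradedComplex c K) (o' : G.ι) (S : Fin c → G.ι),
      Realization (Multiset.replicate c 1) {1} J G o' S := by
  have hF := isResolution_unit (K := K) hc
  have hX : ∀ i : Fin c, IsHomogeneousOfIntDegree
      (MvPolynomial.X i : MvPolynomial (Fin c) K) 1 := fun i =>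
    .of_isHomogeneous (MvPolynomial.isHomogeneous_X _ _) rfl
  obtain ⟨C, oC, t, a, b, hC⟩ := exists_isKoszul
    (fun i : Fin c => (MvPolynomial.X i : MvPolynomial (Fin c) K)) (fun _ => 1)
    weaklyRegularSeq_X hX
  obtain ⟨φ, hφ1, hφ2, hφ3, hφ4, -⟩ := exists_comparison hF hC
    (fun i (x : Bool) => if x then MvPolynomial.X i else 0)
    (fun i => GradedComplex.unit_forall (fun _ => rfl) fun h => absurd rfl h)
    (fun i => by
      refine funext (GradedComplex.unit_forall ?_ ?_)
      · refine Eq.trans (b := MvPolynomial.X i) ?_ rfl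
        change ∑ b : Bool, _ = _
        simp [GradedComplex.unit]
      · refine Eq.trans (b := 0) ?_ rfl
        change ∑ b : Bool, _ = _
        simp [GradedComplex.unit])
    (fun i => GradedComplex.unit_forall (.zero _) (hX i))
  let L : LinkData c K c :=
    { I := ⊤
      F := GradedComplex.unit c K
      o' := (false : Bool)
      res := hF
      α := MvPolynomial.X
      regular := weaklyRegularSeq_X
      δ := fun _ => 1
      C := C
      o := oC
      t := t
      a := a
      b := b
      koszul := hC
      φ := φ
      φ_lvl := hφ1
      φ_comm := hφ2
      φ_hom := hφ3
      φ_o := hφ4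
      U := fun _ => none
      U_lvl := fun _ _ h => absurd h.symm (Option.some_ne_none _)
      U_inj := fun _ _ _ h => absurd h.symm (Option.some_ne_none _)
      φ_U := fun _ _ h => absurd h.symm (Option.some_ne_none _)
      two_le := hc
      U_eq_none := fun _ _ => rfl }
  have hlvl : ∀ x : L.F.ι, L.F.lvl x ≠ c :=
    GradedComplex.unit_forall (by change 0 ≠ c; omega) (by change 1 ≠ c; omega)
  have hgen : ∀ x, L.G.lvl x = 1 → ∃ i, x = L.gen i := fun x hx =>
    (L.G_lvl_eq_one_cases hx).resolve_left fun ⟨y, _, hyc, _⟩ => hlvl y hyc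
  have hJ : L.J = Ideal.span (Set.range L.α) := by
    ext f
    rw [L.mem_J_iff_mul]
    exact ⟨fun h => mul_one f ▸ h 1 trivial, fun h r _ => Ideal.mul_mem_right _ _ h⟩
  have hdeg : ∀ x, L.G.lvl x = 1 → L.G.deg x = 1 := by
    intro x hx
    obtain ⟨i, rfl⟩ := hgen x hx
    exact L.G_deg_gen i
  have hne := L.isResolution.ne_top fun x hx => by rw [hdeg x hx]; exact one_pos
  refine ⟨L.J, L.G, L.bot, L.gen, L.isResolution, ⟨L.J, .refl, List.ofFn L.α, ?_, ?_⟩,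
    L.regularGenerators, ?_, ?_, ?_, ?_⟩
  · exact isHomogeneousRegularSequence_ofFn L.regular
      (fun i => ⟨1, MvPolynomial.isHomogeneous_X _ _⟩) (hJ ▸ hne)
  · rw [ofList_ofFn, hJ]
  · intro i x hx hxT
    obtain ⟨j, rfl⟩ := hgen x hx
    exact absurd rfl (hxT j)
  · intro x hx
    rw [hdeg x hx]
    exact one_pos
  · rw [L.G_degrees_one, Finset.filter_false_of_mem fun x _ => hlvl x]
    simp [L, Multiset.map_const']
  · have h1 : (Finset.univ.filter fun x : L.F.ι => L.F.lvl x = 1 ∧ ∀ i, L.U i ≠ some x) =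
        {(true : Bool)} := by
      refine Finset.ext (GradedComplex.unit_forall ?_ ?_)
      · refine iff_of_false (fun h => ?_) fun h => ?_
        · exact Nat.zero_ne_one (Finset.mem_filter.1 h).2.1
        · exact Bool.false_ne_true (Finset.mem_singleton.1 h)
      · refine iff_of_true (Finset.mem_filter.2 ⟨Finset.mem_univ _, rfl, fun i h => ?_⟩)
          (Finset.mem_singleton_self _)
        exact absurd h.symm (Option.some_ne_none _)
    rw [L.G_degrees_top, h1]
    refine (Multiset.map_singleton _ (true : Bool)).trans ?_
    rw [Multiset.map_singleton, Multiset.sum_singleton]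
    refine congrArg _ ?_
    change ∑ i : Fin c, (1 : ℤ) - 0 = _
    simp only [Finset.sum_const, Finset.card_univ, Fintype.card_fin, nsmul_eq_mul, mul_one]
    push_cast
    ring

end PointIdeal

/-! ### Increasing reflections from an antidominant vector -/

section Reflections

/-- The elements obtained from `v₀` by increasing simple reflections; `n` is the height gained. -/
inductive Ascent {I M : Type*} [AddCommGroup M] (φ : I → M →+ ℤ) (r : I → M) (v₀ : M) :
    ℕ → M → Prop
  | base : Ascent φ r v₀ 0 v₀
  | step {n : ℕ} {v : M} (i : I) (m : ℕ) : Ascent φ r v₀ n v → φ i v = -(m : ℤ) →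
      Ascent φ r v₀ (n + m) (v + (m : ℤ) • r i)

variable {I M : Type*} [AddCommGroup M] {φ : I → M →+ ℤ} {r : I → M} {v₀ : M}

/-- Induction on the height gained, looking at the last step, along `j`. For `j = i` it is undone;
for `i` and `j` orthogonal the two steps commute; for `i` and `j` adjacent the braid relation
replaces them. -/
theorem Ascent.descend (hself : ∀ i, φ i (r i) = 2)
    (hoff : ∀ i j, i ≠ j → φ i (r j) = 0 ∧ φ j (r i) = 0 ∨ φ i (r j) = -1 ∧ φ j (r i) = -1)
    (h₀ : ∀ i, φ i v₀ ≤ 0) (n : ℕ) : ∀ {v : M}, Ascent φ r v₀ n v → ∀ (i : I) (m : ℕ), 0 < m →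
      φ i v = m → ∃ n', n' + m = n ∧ Ascent φ r v₀ n' (v - (m : ℤ) • r i) := by
  induction n using Nat.strong_induction_on with
  | _ n ih =>
    intro v hv
    induction hv with
    | base =>
      intro i m hm h
      have := h₀ i
      omega
    | @step n₀ u j y hu hy ih' =>
      intro i x hx hxv
      -- A step of height zero does not lower the height, so here the induction on the derivation is
      -- needed.
      rcases Nat.eq_zero_or_pos y with rfl | hy0
      · simp only [Nat.cast_zero, zero_smul, add_zero] at hxv ⊢
        exact ih' ih i x hx hxv
      rw [map_add, map_zsmul, smul_eq_mul] at hxv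
      by_cases hij : i = j
      · subst hij
        rw [hself] at hxv
        obtain rfl : x = y := by omega
        exact ⟨n₀, rfl, by rwa [add_sub_cancel_right]⟩
      rcases hoff i j hij with ⟨h1, h2⟩ | ⟨h1, h2⟩
      · rw [h1, mul_zero, add_zero] at hxv
        obtain ⟨n₁, hn₁, h3⟩ := ih n₀ (by omega) hu i x hx hxv
        refine ⟨n₁ + y, by omega, ?_⟩
        have h4 := h3.step j y (by rw [map_sub, map_zsmul, h2, smul_zero, sub_zero, hy])
        rwa [show u + (y : ℤ) • r j - (x : ℤ) • r i = u - (x : ℤ) • r i + (y : ℤ) • r j by abel]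
      -- Braid relation: `u` descends by `x + y` along `i` and by `x` along `j`, then climbs by `y`
      -- along `i` and by `x + y` along `j`.
      · rw [h1] at hxv
        obtain ⟨n₁, hn₁, h3⟩ := ih n₀ (by omega) hu i (x + y) (by omega) (by push_cast; linarith)
        obtain ⟨n₂, hn₂, h4⟩ := ih n₁ (by omega) h3 j x hx (by
          rw [map_sub, map_zsmul, h2, hy, smul_eq_mul]; push_cast; ring)
        have h5 := h4.step i y (by
          rw [map_sub, map_sub, map_zsmul, map_zsmul, hself, h1, smul_eq_mul, smul_eq_mul]
          push_cast
          linarith)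
        have h6 := h5.step j (x + y) (by
          rw [map_add, map_sub, map_sub, map_zsmul, map_zsmul, map_zsmul, hself, h2, hy,
            smul_eq_mul, smul_eq_mul, smul_eq_mul]
          push_cast
          ring)
        refine ⟨n₂ + y + (x + y), by omega, ?_⟩
        convert h6 using 1
        push_cast
        module

/-- The set of elements obtained by increasing reflections is closed under all reflections. -/
theorem Ascent.reflect (hself : ∀ i, φ i (r i) = 2)
    (hoff : ∀ i j, i ≠ j → φ i (r j) = 0 ∧ φ j (r i) = 0 ∨ φ i (r j) = -1 ∧ φ j (r i) = -1)
    (h₀ : ∀ i, φ i v₀ ≤ 0) {n : ℕ} {v : M} (hv : Ascent φ r v₀ n v) (i : I) :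
    ∃ n', Ascent φ r v₀ n' (v - φ i v • r i) := by
  rcases le_or_gt (φ i v) 0 with h | h
  · have h1 := hv.step i (φ i v).natAbs (by omega)
    refine ⟨n + (φ i v).natAbs, ?_⟩
    convert h1 using 1
    rw [sub_eq_add_neg, ← neg_smul]
    congr 2
    omega
  · obtain ⟨n', -, h1⟩ := hv.descend hself hoff h₀ n i (φ i v).natAbs (by omega) (by omega)
    refine ⟨n', ?_⟩
    rwa [Int.natCast_natAbs, abs_of_pos h] at h1

end Reflections

/-! ### The three-armed diagram of linkage and its orbit -/

section LinkageVectors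

/-- The simple reflections of the star-shaped diagram governing linkage in codimension `c`. -/
inductive LinkNode (c : ℕ) : Type
  | E (i : ℕ) (hi : i + 1 < c)
  | a (i : ℕ)
  | b (i : ℕ)
  | A
  | B

/-- The coordinates describing a pair of linked decorations: `k₁` and `k₂` are the sums of the
two second partitions `b` and `a`, and `e` holds the differences between `k₁` and the parts chosen
for the link. -/
inductive LinkCoord : Type
  | k₁
  | k₂
  | e (i : ℕ)
  | a (i : ℕ)
  | b (i : ℕ)
  deriving DecidableEq

namespace LinkNode

open LinkCoord

variable {c : ℕ}

/-- The value at a coordinate, as a homomorphism. -/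
def coord (x : LinkCoord) : (LinkCoord → ℤ) →+ ℤ := Pi.evalAddMonoidHom (fun _ => ℤ) x

@[simp] theorem coord_apply (x : LinkCoord) (v : LinkCoord → ℤ) : coord x v = v x := rfl

/-- The linear form of a simple reflection. -/
def form : LinkNode c → (LinkCoord → ℤ) →+ ℤ
  | .E i _ => coord (e i) - coord (e (i + 1))
  | .a i => coord (LinkCoord.a (i + 1)) - coord (LinkCoord.a i)
  | .b i => coord (LinkCoord.b (i + 1)) - coord (LinkCoord.b i)
  | .A => coord (e (c - 1)) + coord (LinkCoord.a 0) -
      coord k₁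
  | .B => coord (e (c - 1)) + coord (LinkCoord.b 0) -
      coord k₂

/-- The root of a simple reflection. -/
def root : LinkNode c → LinkCoord → ℤ
  | .E i _ => Pi.single (e i) 1 - Pi.single (e (i + 1)) 1
  | .a i => Pi.single (LinkCoord.a (i + 1)) 1 - Pi.single (LinkCoord.a i) 1
  | .b i => Pi.single (LinkCoord.b (i + 1)) 1 - Pi.single (LinkCoord.b i) 1
  | .A => Pi.single (e (c - 1)) 1 + Pi.single (LinkCoord.a 0) 1 + Pi.single k₂ 1
  | .B => Pi.single (e (c - 1)) 1 + Pi.single (LinkCoord.b 0) 1 + Pi.single k₁ 1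

theorem form_root_self (i : LinkNode c) : form i (root i) = 2 := by
  rcases i with ⟨i, hi⟩ | i | i | _ | _ <;> simp [form, root]

/-- The diagram is simply laced. Its arms are the chain of the `E i`, the chain `A, a 0, a 1, …` and
the chain `B, b 0, b 1, …`, the last two attached to the final `E`. `A` and `B` are orthogonal
because their common entry at `e (c - 1)` cancels against `k₁` or `k₂`. -/
theorem form_root_of_ne (i j : LinkNode c) (h : i ≠ j) :
    form i (root j) = 0 ∧ form j (root i) = 0 ∨ form i (root j) = -1 ∧ form j (root i) = -1 := by
  rcases i with ⟨i, hi⟩ | i | i | _ | _ <;> rcases j with ⟨j, hj⟩ | j | j | _ | _ <;>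
    simp [form, root, Pi.single_apply] at h ⊢ <;> grind

/-- The starting point: the decoration `((1), ∅)` linked along its only part. -/
def origin : LinkCoord → ℤ := -Pi.single (e 0) 1

theorem form_origin (hc : 2 ≤ c) (i : LinkNode c) : form i origin ≤ 0 := by
  rcases i with ⟨i, hi⟩ | i | i | _ | _ <;> simp [form, origin, Pi.single_apply] <;> grind

/-- The orbit of the starting point. -/
def Orbit (c : ℕ) (v : LinkCoord → ℤ) : Prop :=
  ∃ n, Ascent (form (c := c)) root origin n v

theorem Orbit.reflect (hc : 2 ≤ c) {v : LinkCoord → ℤ} (hv : Orbit c v) (i : LinkNode c) :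
    Orbit c (v - form i v • root i) :=
  hv.elim fun _ h => h.reflect form_root_self form_root_of_ne (form_origin hc) i

/-- Positivity in the orbit. -/
theorem Orbit.nonneg (hc : 2 ≤ c) {v : LinkCoord → ℤ} (hv : Orbit c v) :
    (∀ i, 0 ≤ v (LinkCoord.a i)) ∧ (∀ i, 0 ≤ v (LinkCoord.b i)) ∧ (∀ i, i < c → v (e i) ≤ v k₁) ∧
      (∀ i, i < c → v (e i) ≤ v k₂) ∧ ((∀ i, i < c → 0 ≤ v (e i)) ∨
        v k₁ = 0 ∧ v k₂ = 0 ∧ (∀ i, v (LinkCoord.a i) = 0) ∧ (∀ i, v (LinkCoord.b i) = 0) ∧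
          ∃ i₀, i₀ < c ∧ v (e i₀) = -1 ∧ ∀ i, i < c → i ≠ i₀ → v (e i) = 0) := by
  obtain ⟨n, hv⟩ := hv
  induction hv with
  | base =>
    refine ⟨?_, ?_, ?_, ?_, Or.inr ⟨?_, ?_, ?_, ?_, 0, ?_⟩⟩ <;>
      simp [origin, Pi.single_apply] <;> grind
  | @step n v i m hv hm ih =>
    obtain ⟨h1, h2, h3, h4, h5⟩ := ih
    rcases i with ⟨i, hi⟩ | i | i | _ | _
    · simp only [form, AddMonoidHom.sub_apply, coord_apply] at hm
      have h6 := h3 i (by omega)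
      have h7 := h3 (i + 1) hi
      have h8 := h4 i (by omega)
      have h9 := h4 (i + 1) hi
      simp only [Pi.add_apply, Pi.smul_apply, root, Pi.sub_apply, Pi.single_apply, smul_eq_mul,
        reduceCtorEq, if_false, e.injEq, sub_zero, mul_zero, add_zero]
      refine ⟨h1, h2, by grind, by grind, ?_⟩
      rcases h5 with h5 | ⟨h10, h11, h12, h13, i₀, h14, h15, h16⟩
      · have h10 := h5 i (by omega)
        have h11 := h5 (i + 1) hi
        exact Or.inl (by grind)
      · have h17 := h16 i (by omega)
        have h18 := h16 (i + 1) hi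
        -- The step interchanges two neighbouring entries. Being increasing, it can move the entry
        -- `-1` from `i` to `i + 1` but not back.
        refine Or.inr ⟨h10, h11, h12, h13, if i₀ = i then i + 1 else i₀, ?_, ?_, ?_⟩ <;> grind
    · simp only [form, AddMonoidHom.sub_apply, coord_apply] at hm
      have h6 := h1 i
      have h7 := h1 (i + 1)
      simp only [Pi.add_apply, Pi.smul_apply, root, Pi.sub_apply, Pi.single_apply, smul_eq_mul,
        reduceCtorEq, if_false, LinkCoord.a.injEq, sub_zero, mul_zero, add_zero]
      exact ⟨by grind, h2, h3, h4, h5.imp id fun ⟨h8, h9, h10, h11, h12⟩ =>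
        ⟨h8, h9, by grind, h11, h12⟩⟩
    · simp only [form, AddMonoidHom.sub_apply, coord_apply] at hm
      have h6 := h2 i
      have h7 := h2 (i + 1)
      simp only [Pi.add_apply, Pi.smul_apply, root, Pi.sub_apply, Pi.single_apply, smul_eq_mul,
        reduceCtorEq, if_false, LinkCoord.b.injEq, sub_zero, mul_zero, add_zero]
      exact ⟨h1, by grind, h3, h4, h5.imp id fun ⟨h8, h9, h10, h11, h12⟩ =>
        ⟨h8, h9, h10, by grind, h12⟩⟩
    · simp only [form, AddMonoidHom.sub_apply, AddMonoidHom.add_apply, coord_apply] at hm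
      have h6 := h1 0
      have h7 := h3 (c - 1) (by omega)
      have h8 := h4 (c - 1) (by omega)
      simp only [Pi.add_apply, Pi.smul_apply, root, Pi.single_apply, smul_eq_mul,
        reduceCtorEq, if_false, e.injEq, LinkCoord.a.injEq, if_true, zero_add, mul_one, mul_zero,
        add_zero]
      -- The new `e (c - 1)` is `k₁ - a 0 ≤ k₁`, and `k₂` grows by the same amount as `e (c - 1)`.
      refine ⟨by grind, h2, by grind, by grind, ?_⟩
      rcases h5 with h5 | ⟨h10, h11, h12, h13, i₀, h14, h15, h16⟩
      · exact Or.inl (by grind)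
      · have h17 := h12 0
        have h18 := h16 (c - 1) (by omega)
        -- With the entry `-1` in the last place the step has height one and leaves the exceptional
        -- family for good; otherwise its height is zero.
        by_cases h19 : c - 1 = i₀
        · exact Or.inl (by grind)
        · exact Or.inr ⟨h10, by grind, by grind, h13, i₀, by grind⟩
    · simp only [form, AddMonoidHom.sub_apply, AddMonoidHom.add_apply, coord_apply] at hm
      have h6 := h2 0
      have h7 := h3 (c - 1) (by omega)
      have h8 := h4 (c - 1) (by omega)
      simp only [Pi.add_apply, Pi.smul_apply, root, Pi.single_apply, smul_eq_mul,
        reduceCtorEq, if_false, e.injEq, LinkCoord.b.injEq, if_true, zero_add, mul_one, mul_zero,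
        add_zero]
      refine ⟨h1, by grind, by grind, by grind, ?_⟩
      rcases h5 with h5 | ⟨h10, h11, h12, h13, i₀, h14, h15, h16⟩
      · exact Or.inl (by grind)
      · have h17 := h13 0
        have h18 := h16 (c - 1) (by omega)
        by_cases h19 : c - 1 = i₀
        · exact Or.inl (by grind)
        · exact Or.inr ⟨by grind, h11, h12, by grind, i₀, by grind⟩

/-- Exchanging the roles of the two linked decorations. -/
def swapCoord : LinkCoord → LinkCoord
  | k₁ => k₂
  | k₂ => k₁
  | e i => e i
  | .a i => .b i
  | .b i => .a i

/-- Exchanging the two infinite arms is an automorphism of the diagram, with its forms and roots,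
and it fixes the origin. -/
theorem Orbit.swap {v : LinkCoord → ℤ} (hv : Orbit c v) : Orbit c (v ∘ swapCoord) := by
  obtain ⟨n, hv⟩ := hv
  induction hv with
  | base =>
    refine ⟨0, ?_⟩
    convert Ascent.base (φ := form (c := c)) (r := root) using 1
    funext x
    rcases x with _ | _ | i | i | i <;> simp [origin, swapCoord, Pi.single_apply]
  | @step n v i m hv hm ih =>
    obtain ⟨n', ih⟩ := ih
    let i' : LinkNode c := match i with
      | .E i hi => .E i hi
      | .a i => .b i
      | .b i => .a i
      | .A => .B
      | .B => .A
    have h1 : form i' (v ∘ swapCoord) = form i v := by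
      rcases i with ⟨i, hi⟩ | i | i | _ | _ <;> rfl
    have h2 : root i' = root i ∘ swapCoord := by
      funext x
      rcases i with ⟨i, hi⟩ | i | i | _ | _ <;> rcases x with _ | _ | x | x | x <;>
        simp [i', root, swapCoord, Pi.single_apply]
    refine ⟨n' + m, ?_⟩
    have h3 := ih.step i' m (h1.trans hm)
    rw [h2] at h3
    exact h3

end LinkNode

end LinkageVectors

/-! ### Reordering the parts as reflections -/

section LinkVectorOfLists

open LinkCoord

variable {c : ℕ}

theorem List.getD_append_cons_cons (x y : List ℕ) (p q j : ℕ) :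
    (x ++ q :: p :: y).getD j 0 = if j = x.length then q else if j = x.length + 1 then p else
      (x ++ p :: q :: y).getD j 0 := by
  simp only [List.getD_eq_getElem?_getD, List.getElem?_append, List.getElem?_cons]
  grind

/-- The coordinates of a decoration whose partitions are listed as `l` and `m`, together with its
link along the first `c` entries of `l`. -/
def linkVector (c : ℕ) (l m : List ℕ) : LinkCoord → ℤ
  | k₁ => m.sum
  | k₂ => (l.drop c).sum
  | e i => if i < c then (m.sum : ℤ) - l.getD i 0 else 0
  | a j => l.getD (c + j) 0
  | b j => m.getD j 0

/-- A transposition of neighbours among the first `c` entries is some `E`, one beyond them some `a`.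
The one across the border is `A`, and it also changes the sum `k₂` of the unchosen parts. -/
theorem linkVector_swap (hc : 2 ≤ c) (x y m : List ℕ) (p q : ℕ) :
    ∃ i : LinkNode c, linkVector c (x ++ q :: p :: y) m =
      linkVector c (x ++ p :: q :: y) m -
        LinkNode.form i (linkVector c (x ++ p :: q :: y) m) • LinkNode.root i := by
  have hg := List.getD_append_cons_cons x y p q
  have hp : (x ++ p :: q :: y).getD x.length 0 = p := by simp
  have hq : (x ++ p :: q :: y).getD (x.length + 1) 0 = q := by simp
  have hs : (((x ++ q :: p :: y).drop c).sum : ℤ) = ((x ++ p :: q :: y).drop c).sum +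
      if x.length + 1 = c then (p : ℤ) - q else 0 := by
    rw [List.drop_append, List.drop_append]
    rcases lt_trichotomy (x.length + 1) c with h | h | h
    · obtain ⟨d, hd⟩ : ∃ d, c - x.length = d + 1 + 1 := ⟨c - x.length - 2, by omega⟩
      rw [if_neg h.ne, hd]
      simp
    · have hd : c - x.length = 1 := by omega
      rw [if_pos h, hd]
      simp
      ring
    · have hd : c - x.length = 0 := by omega
      rw [if_neg h.ne', hd]
      simp
      ring
  generalize x ++ p :: q :: y = l at *
  generalize x ++ q :: p :: y = l' at *
  generalize x.length = s at *
  rcases lt_trichotomy (s + 1) c with h | h | h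
  · refine ⟨.E s h, funext fun z => ?_⟩
    rcases z with _ | _ | j | j | j <;>
      simp [linkVector, LinkNode.form, LinkNode.root, Pi.single_apply, -Nat.cast_list_sum,
        -List.getD_eq_getElem?_getD, -zsmul_eq_mul] <;> grind
  · refine ⟨.A, funext fun z => ?_⟩
    rcases z with _ | _ | j | j | j <;>
      simp [linkVector, LinkNode.form, LinkNode.root, Pi.single_apply, -Nat.cast_list_sum,
        -List.getD_eq_getElem?_getD, -zsmul_eq_mul] <;> grind
  · refine ⟨.a (s - c), funext fun z => ?_⟩
    rcases z with _ | _ | j | j | j <;>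
      simp [linkVector, LinkNode.form, LinkNode.root, Pi.single_apply, -Nat.cast_list_sum,
        -List.getD_eq_getElem?_getD, -zsmul_eq_mul] <;> grind

theorem LinkNode.Orbit.perm (hc : 2 ≤ c) {l l' m : List ℕ} (h : l.Perm l') :
    ∀ x : List ℕ, LinkNode.Orbit c (linkVector c (x ++ l) m) →
      LinkNode.Orbit c (linkVector c (x ++ l') m) := by
  induction h with
  | nil => exact fun _ => id
  | @cons a l l' _ ih =>
    intro x hx
    have h1 := ih (x ++ [a])
    simp only [List.append_assoc, List.singleton_append] at h1
    exact h1 hx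
  | swap p q y =>
    intro x hx
    obtain ⟨i, hi⟩ := linkVector_swap hc x y m q p
    rw [hi]
    exact hx.reflect hc i
  | trans _ _ ih₁ ih₂ => exact fun x hx => ih₂ x (ih₁ x hx)

theorem linkVector_append_replicate (l m : List ℕ) (s : ℕ) :
    linkVector c (l ++ List.replicate s 0) m = linkVector c l m := by
  have hg : ∀ j, (l ++ List.replicate s 0).getD j 0 = l.getD j 0 := by
    intro j
    simp only [List.getD_eq_getElem?_getD, List.getElem?_append, List.getElem?_replicate]
    grind
  have hs : ((l ++ List.replicate s 0).drop c).sum = (l.drop c).sum := by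
    simp [List.drop_append]
  funext x
  rcases x with _ | _ | j | j | j <;> simp only [linkVector, hg, hs]

/-- After padding with zeros, two listings of the same positive parts are permutations of each
other. -/
theorem LinkNode.Orbit.of_filter_eq (hc : 2 ≤ c) {l l' m : List ℕ}
    (h : (l : Multiset ℕ).filter (· ≠ 0) = (l' : Multiset ℕ).filter (· ≠ 0))
    (hl : LinkNode.Orbit c (linkVector c l m)) : LinkNode.Orbit c (linkVector c l' m) := by
  have hr : ∀ s : ℕ, (Multiset.replicate s 0).filter (· ≠ 0) = 0 := fun s =>
    Multiset.filter_eq_nil.2 fun a ha => not_not.2 (Multiset.eq_of_mem_replicate ha)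
  have h1 : (l ++ List.replicate l'.length 0).Perm (l' ++ List.replicate l.length 0) := by
    rw [← Multiset.coe_eq_coe]
    refine Multiset.eq_of_filter_ne_zero_eq ?_ ?_
    · simp [add_comm]
    · rw [← Multiset.coe_add, ← Multiset.coe_add, Multiset.filter_add, Multiset.filter_add, h,
        Multiset.coe_replicate, Multiset.coe_replicate, hr, hr]
  have h2 := LinkNode.Orbit.perm hc (m := m) h1 []
  rw [List.nil_append, List.nil_append, linkVector_append_replicate,
    linkVector_append_replicate] at h2
  exact h2 hl

end LinkVectorOfLists

/-! ### Invariants, positivity and maximal choices -/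

section Decorations

variable {c : ℕ}

/-- The linkage formula, in terms of natural numbers. -/
theorem link_eq_filter {lam' mu lam₂ : Multiset ℕ} {p : ℤ}
    (h : lam₂.map (fun a : ℕ => (a : ℤ)) =
      (lam'.map (fun a : ℕ => (a : ℤ) + p) + mu.map (fun a : ℕ => (a : ℤ))).filter (· ≠ 0)) :
    (∀ a ∈ lam', 0 ≤ (a : ℤ) + p) ∧
      lam₂ = (lam'.map (fun a : ℕ => ((a : ℤ) + p).toNat) + mu).filter (· ≠ 0) := by
  have h1 : ∀ a ∈ lam', 0 ≤ (a : ℤ) + p := by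
    intro a ha
    by_cases h0 : (a : ℤ) + p = 0
    · exact h0.ge
    · have h2 : (a : ℤ) + p ∈ lam₂.map (fun a : ℕ => (a : ℤ)) := by
        rw [h, Multiset.mem_filter]
        exact ⟨Multiset.mem_add.2 (Or.inl (Multiset.mem_map_of_mem _ ha)), h0⟩
      obtain ⟨b, -, hb⟩ := Multiset.mem_map.1 h2
      omega
  refine ⟨h1, Multiset.map_injective (f := fun a : ℕ => (a : ℤ)) Nat.cast_injective ?_⟩
  have h2 : lam'.map (fun a : ℕ => (a : ℤ) + p) =
      (lam'.map (fun a : ℕ => ((a : ℤ) + p).toNat)).map fun a : ℕ => (a : ℤ) := by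
    rw [Multiset.map_map]
    exact Multiset.map_congr rfl fun a ha => (Int.toNat_of_nonneg (h1 a ha)).symm
  rw [h, h2, ← Multiset.map_add, Multiset.filter_map]
  refine congrArg _ (Multiset.filter_congr fun a _ => ?_)
  simp

theorem link_cast {lam' mu lam₂ : Multiset ℕ} {p : ℤ} (h1 : ∀ a ∈ lam', 0 ≤ (a : ℤ) + p)
    (h : lam₂ = (lam'.map (fun a : ℕ => ((a : ℤ) + p).toNat) + mu).filter (· ≠ 0)) :
    lam₂.map (fun a : ℕ => (a : ℤ)) =
      (lam'.map (fun a : ℕ => (a : ℤ) + p) + mu.map (fun a : ℕ => (a : ℤ))).filter (· ≠ 0) := by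
  have h2 : lam'.map (fun a : ℕ => (a : ℤ) + p) =
      (lam'.map (fun a : ℕ => ((a : ℤ) + p).toNat)).map fun a : ℕ => (a : ℤ) := by
    rw [Multiset.map_map]
    exact Multiset.map_congr rfl fun a ha => (Int.toNat_of_nonneg (h1 a ha)).symm
  rw [h, h2, ← Multiset.map_add, Multiset.filter_map]
  refine congrArg _ (Multiset.filter_congr fun a _ => ?_)
  simp

theorem Multiset.sum_map_filter_ne_zero {s : Multiset ℕ} {f : ℕ → ℤ} (hf : f 0 = 0) :
    ((s.filter (· ≠ 0)).map f).sum = (s.map f).sum := by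
  induction s using Multiset.induction_on with
  | empty => rfl
  | cons a s ih =>
    by_cases ha : a = 0
    · rw [Multiset.filter_cons_of_neg (p := (· ≠ 0)) _ (not_not.2 ha), ih, Multiset.map_cons, Multiset.sum_cons,
        ha, hf, zero_add]
    · rw [Multiset.filter_cons_of_pos (p := (· ≠ 0)) _ ha, Multiset.map_cons, Multiset.map_cons,
        Multiset.sum_cons, Multiset.sum_cons, ih]

theorem Multiset.sum_map_cast (s : Multiset ℕ) : (s.map fun a : ℕ => (a : ℤ)).sum = (s.sum : ℕ) := by
  induction s using Multiset.induction_on with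
  | empty => rfl
  | cons a s ih => rw [Multiset.map_cons, Multiset.sum_cons, Multiset.sum_cons, ih, Nat.cast_add]

theorem Multiset.sum_map_toNat {s : Multiset ℕ} {p : ℤ} (h : ∀ a ∈ s, 0 ≤ (a : ℤ) + p)
    (f : ℤ → ℤ) : ((s.map fun a : ℕ => ((a : ℤ) + p).toNat).map fun b : ℕ => f b).sum =
      (s.map fun a : ℕ => f (a + p)).sum := by
  rw [Multiset.map_map]
  refine congrArg _ (Multiset.map_congr rfl fun a ha => ?_)
  rw [Function.comp_apply, Int.toNat_of_nonneg (h a ha)]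

/-- The numerical invariants of decorations. -/
theorem IsDecoration.invariants {lam mu : Multiset ℕ} (h : IsDecoration c lam mu) :
    0 ∉ lam ∧ 0 ∉ mu ∧ (lam.sum : ℤ) = ((c : ℤ) - 1) * (mu.sum : ℕ) + 1 ∧
      (lam.map fun a : ℕ => (a : ℤ) ^ 2).sum + (mu.map fun a : ℕ => (a : ℤ) ^ 2).sum =
        ((c : ℤ) - 2) * (mu.sum : ℕ) ^ 2 + 2 * (mu.sum : ℕ) + 1 := by
  induction h with
  | unit => simp
  | @link lam mu lam₂ mu₂ _ hl ih =>
    obtain ⟨h1, h2, h3, h4⟩ := ih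
    obtain ⟨lam', p, hcard, hle, hp, hmu, h0, hlam⟩ := hl
    obtain ⟨hpos, hlam₂⟩ := link_eq_filter hlam
    have h5 : lam'.filter (· ≠ 0) + mu₂ = lam := by rw [hmu, add_tsub_cancel_of_le hle]
    have h6 : ∀ f : ℕ → ℤ, f 0 = 0 → (lam.map f).sum = (lam'.map f).sum + (mu₂.map f).sum := by
      intro f hf
      rw [← h5, Multiset.map_add, Multiset.sum_add, Multiset.sum_map_filter_ne_zero hf]
    have h7 : ∀ f : ℤ → ℤ, f 0 = 0 → (lam₂.map fun a : ℕ => f a).sum =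
        (lam'.map fun a : ℕ => f (a + p)).sum + (mu.map fun a : ℕ => f a).sum := by
      intro f hf
      rw [hlam₂, Multiset.sum_map_filter_ne_zero (f := fun a : ℕ => f a) hf, Multiset.map_add,
        Multiset.sum_add, Multiset.sum_map_toNat hpos]
    have h8 := h6 (fun a => (a : ℤ)) rfl
    have h9 := h6 (fun a => (a : ℤ) ^ 2) rfl
    have h10 := h7 (fun a => a) rfl
    have h11 := h7 (fun a => a ^ 2) rfl
    have h12 : (lam'.map fun a : ℕ => (a : ℤ) + p).sum = (lam'.sum : ℕ) + c * p := by
      rw [Multiset.sum_map_add, Multiset.sum_map_cast, Multiset.map_const', hcard,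
        Multiset.sum_replicate, nsmul_eq_mul]
    have h13 : (lam'.map fun a : ℕ => ((a : ℤ) + p) ^ 2).sum =
        (lam'.map fun a : ℕ => (a : ℤ) ^ 2).sum + 2 * p * (lam'.sum : ℕ) + c * p ^ 2 := by
      have e : ∀ a : ℕ, ((a : ℤ) + p) ^ 2 = (a : ℤ) ^ 2 + 2 * p * a + p ^ 2 := fun a => by ring
      simp only [e]
      rw [Multiset.sum_map_add, Multiset.sum_map_add, Multiset.sum_map_mul_left,
        Multiset.sum_map_cast, Multiset.map_const', hcard, Multiset.sum_replicate, nsmul_eq_mul]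
    simp only [Multiset.sum_map_cast] at h8 h10
    refine ⟨h0, fun h => h1 (Multiset.mem_of_le (hmu.trans_le tsub_le_self) h), ?_, ?_⟩
    · rw [h10, h12]
      rw [h8] at h3
      have e : (mu₂.sum : ℤ) = (c - 1) * (mu.sum : ℕ) + 1 - (lam'.sum : ℕ) := by linarith
      rw [e, hp]
      ring
    · rw [h11, h13]
      rw [h8] at h3
      rw [h9] at h4
      -- The linear invariant says exactly that a link changes `|μ|` by `p`; this is what makes the
      -- quadratic one persist.
      have e : (mu₂.sum : ℤ) = (mu.sum : ℕ) + p := by rw [hp]; linarith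
      have e2 : (lam'.sum : ℤ) = (c - 2) * (mu.sum : ℕ) + 1 - p := by rw [hp]; ring
      rw [e, e2]
      linear_combination h4

end Decorations

section Decorations

variable {c : ℕ}

open LinkCoord LinkNode

/-- The entries `e i` are common to both decorations: `k₁ - l = k₂ - (l + p)` because `p = k₂ - k₁`.
So linking only exchanges the other coordinates. -/
theorem linkVector_swapCoord {lam' mu : Multiset ℕ} {m₂ : List ℕ} {p : ℤ} (hcard : lam'.card = c)
    (hpos : ∀ a ∈ lam', 0 ≤ (a : ℤ) + p) (hp : (m₂.sum : ℤ) = (mu.sum : ℕ) + p) :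
    linkVector c (lam'.toList ++ m₂) mu.toList ∘ swapCoord =
      linkVector c (lam'.toList.map (fun a : ℕ => ((a : ℤ) + p).toNat) ++ mu.toList) m₂ := by
  have hlen : lam'.toList.length = c := by rw [Multiset.length_toList, hcard]
  have hmu : mu.toList.sum = mu.sum := by rw [Multiset.sum_toList]
  funext x
  rcases x with _ | _ | i | j | j
  · simp only [Function.comp_apply, swapCoord, linkVector, List.drop_left' hlen]
  · have h1 : (lam'.toList.map fun a : ℕ => ((a : ℤ) + p).toNat).length = c := by
      rw [List.length_map, hlen]
    simp only [Function.comp_apply, swapCoord, linkVector, List.drop_left' h1]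
  · simp only [Function.comp_apply, swapCoord, linkVector]
    split_ifs with hi
    · have hi1 : i < lam'.toList.length := by omega
      have hi2 : i < (lam'.toList.map fun a : ℕ => ((a : ℤ) + p).toNat).length := by
        rwa [List.length_map]
      rw [List.getD_append _ _ _ _ hi1, List.getD_append _ _ _ _ hi2,
        List.getD_eq_getElem _ _ hi1, List.getD_eq_getElem _ _ hi2, List.getElem_map,
        Int.toNat_of_nonneg (hpos _ (Multiset.mem_toList.1 (List.getElem_mem hi1))), hmu, hp]
      ring
    · rfl
  · have h1 : (lam'.toList.map fun a : ℕ => ((a : ℤ) + p).toNat).length = c := by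
      rw [List.length_map, hlen]
    simp only [Function.comp_apply, swapCoord, linkVector]
    rw [List.getD_append_right _ _ _ _ (by omega), h1, Nat.add_sub_cancel_left]
  · simp only [Function.comp_apply, swapCoord, linkVector]
    rw [List.getD_append_right _ _ _ _ (by omega), hlen, Nat.add_sub_cancel_left]

theorem Multiset.filter_ne_zero_eq_self {s : Multiset ℕ} (h : 0 ∉ s) :
    s.filter (· ≠ 0) = s :=
  Multiset.filter_eq_self.2 fun _ ha h0 => h (h0 ▸ ha)

/-- Quantifying over all listings lets a link be performed with its chosen parts in front. It is
then an exchange of the two arms, and any other listing differs by reflections. -/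
theorem IsDecoration.orbit (hc : 2 ≤ c) {lam mu : Multiset ℕ} (h : IsDecoration c lam mu) :
    ∀ l m : List ℕ, (l : Multiset ℕ).filter (· ≠ 0) = lam → (m : Multiset ℕ) = mu →
      Orbit c (linkVector c l m) := by
  induction h with
  | unit =>
    intro l m hl hm
    obtain rfl : m = [] := by simpa using hm
    refine Orbit.of_filter_eq hc (l := [1]) (hl.symm ▸ by rfl) ⟨0, ?_⟩
    convert Ascent.base (φ := form (c := c)) (r := root) using 1
    funext x
    rcases x with _ | _ | i | j | j
    · rfl
    · obtain ⟨d, rfl⟩ : ∃ d, c = d + 1 := ⟨c - 1, by omega⟩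
      simp [linkVector, origin]
    · rcases i with _ | i
      · simp [linkVector, origin]
        omega
      · simp [linkVector, origin]
    · obtain ⟨d, hd⟩ : ∃ d, c + j = d + 1 := ⟨c + j - 1, by omega⟩
      simp [linkVector, origin, hd]
    · simp [linkVector, origin]
  | @link lam mu lam₂ mu₂ hdec hl ih =>
    intro l₂ m₂ hl₂ hm₂
    obtain ⟨h1, h2, h3, -⟩ := hdec.invariants
    obtain ⟨lam', p, hcard, hle, hp, hmu, h0, hlam⟩ := hl
    obtain ⟨hpos, hlam₂⟩ := link_eq_filter hlam
    have h5 : lam'.filter (· ≠ 0) + mu₂ = lam := by rw [hmu, add_tsub_cancel_of_le hle]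
    have h6 : 0 ∉ mu₂ := fun h => h1 (Multiset.mem_of_le (hmu.trans_le tsub_le_self) h)
    have h7 : (m₂.sum : ℤ) = (mu.sum : ℕ) + p := by
      have e1 : lam.sum = lam'.sum + mu₂.sum := by
        have := Multiset.sum_map_filter_ne_zero (s := lam') (f := fun a : ℕ => (a : ℤ)) rfl
        rw [Multiset.sum_map_cast, Multiset.sum_map_cast] at this
        rw [← h5, Multiset.sum_add]
        omega
      have e2 : m₂.sum = mu₂.sum := by rw [← hm₂, Multiset.sum_coe]
      rw [e2, hp]
      rw [e1] at h3
      push_cast at h3 ⊢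
      linarith
    have h8 := ih (lam'.toList ++ m₂) mu.toList (by
      rw [← Multiset.coe_add, Multiset.coe_toList, hm₂, Multiset.filter_add,
        Multiset.filter_ne_zero_eq_self h6, h5]) (Multiset.coe_toList mu)
    have h9 := h8.swap
    rw [linkVector_swapCoord hcard hpos h7] at h9
    refine Orbit.of_filter_eq hc ?_ h9
    rw [hl₂, hlam₂, ← Multiset.coe_add, Multiset.coe_toList, ← Multiset.map_coe,
      Multiset.coe_toList]

theorem Multiset.sum_filter_ne_zero (s : Multiset ℕ) : (s.filter (· ≠ 0)).sum = s.sum := by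
  have := Multiset.sum_map_filter_ne_zero (s := s) (f := fun a : ℕ => (a : ℤ)) rfl
  rw [Multiset.sum_map_cast, Multiset.sum_map_cast] at this
  exact_mod_cast this

theorem Multiset.eq_zero_of_sum_eq_zero {s : Multiset ℕ} (h0 : 0 ∉ s) (h : s.sum = 0) : s = 0 :=
  Multiset.eq_zero_of_forall_notMem fun a ha => h0 (Multiset.sum_eq_zero_iff.1 h a ha ▸ ha)

theorem Multiset.eq_singleton_of_sum_eq_one {s : Multiset ℕ} (h0 : 0 ∉ s) (h : s.sum = 1) :
    s = {1} := by
  obtain ⟨a, ha⟩ := Multiset.exists_mem_of_ne_zero (s := s) (by rintro rfl; simp at h)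
  obtain ⟨t, rfl⟩ := Multiset.exists_cons_of_mem ha
  rw [Multiset.mem_cons, not_or] at h0
  rw [Multiset.sum_cons] at h
  have h1 := h0.1
  rw [Multiset.eq_zero_of_sum_eq_zero h0.2 (by omega), show a = 1 by omega]
  rfl

/-- Positivity of decorations. -/
theorem IsDecoration.le_sum (hc : 2 ≤ c) {lam mu : Multiset ℕ} (h : IsDecoration c lam mu)
    (hne : ¬ (lam = {1} ∧ mu = 0)) {lam' : Multiset ℕ} (hcard : lam'.card = c)
    (hle : lam'.filter (· ≠ 0) ≤ lam) {a : ℕ} (ha : a ∈ lam') :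
    a ≤ mu.sum ∧ mu.sum ≤ (lam - lam'.filter (· ≠ 0)).sum + a := by
  obtain ⟨h1, h2, h3, -⟩ := h.invariants
  have hlen : lam'.toList.length = c := by rw [Multiset.length_toList, hcard]
  have h6 : 0 ∉ lam - lam'.filter (· ≠ 0) := fun h => h1 (Multiset.mem_of_le tsub_le_self h)
  -- With the chosen parts listed first, `e i` is `mu.sum` minus a chosen part and `k₂` is the sum
  -- of the rest; the claims are `0 ≤ e i` and `e i ≤ k₂`.
  obtain ⟨-, -, -, h7, h8⟩ := (h.orbit hc (lam'.toList ++ (lam - lam'.filter (· ≠ 0)).toList)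
    mu.toList (by
      rw [← Multiset.coe_add, Multiset.coe_toList, Multiset.coe_toList, Multiset.filter_add,
        Multiset.filter_ne_zero_eq_self h6, add_tsub_cancel_of_le hle])
    (Multiset.coe_toList mu)).nonneg hc
  obtain ⟨i, hi, rfl⟩ := List.getElem_of_mem (Multiset.mem_toList.2 ha)
  have hic : i < c := by omega
  have h9 := h7 i hic
  simp only [linkVector, if_pos hic, List.drop_left' hlen, Multiset.sum_toList] at h9 h8
  rw [List.getD_append _ _ _ _ hi, List.getD_eq_getElem _ _ hi] at h9
  refine ⟨?_, by omega⟩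
  -- The exceptional vectors have `mu.sum = 0`, which by the linear invariant leaves only `((1),
  -- ∅)`.
  rcases h8 with h8 | ⟨h10, -⟩
  · have h10 := h8 i hic
    rw [if_pos hic, List.getD_append _ _ _ _ hi, List.getD_eq_getElem _ _ hi] at h10
    omega
  · have h11 : mu = 0 := Multiset.eq_zero_of_sum_eq_zero h2 (by exact_mod_cast h10)
    refine absurd ⟨Multiset.eq_singleton_of_sum_eq_one h1 ?_, h11⟩ hne
    rw [h11, Multiset.sum_zero, Nat.cast_zero, mul_zero, zero_add] at h3
    exact_mod_cast h3

theorem exists_max_choice (c : ℕ) (lam : Multiset ℕ) :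
    ∃ lam' : Multiset ℕ, lam'.card = c ∧ lam'.filter (· ≠ 0) ≤ lam ∧
      ∀ s : Multiset ℕ, s.card = c → s.filter (· ≠ 0) ≤ lam → s.sum ≤ lam'.sum := by
  let S : Set ℕ := {n | ∃ s : Multiset ℕ, s.card = c ∧ s.filter (· ≠ 0) ≤ lam ∧ s.sum = n}
  have hb : BddAbove S := by
    refine ⟨lam.sum, ?_⟩
    rintro n ⟨s, -, hs, rfl⟩
    rw [← Multiset.sum_filter_ne_zero s]
    obtain ⟨t, rfl⟩ := Multiset.le_iff_exists_add.1 hs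
    rw [Multiset.sum_add]
    omega
  have hne : S.Nonempty := by
    refine ⟨_, Multiset.replicate c 0, Multiset.card_replicate c 0, ?_, rfl⟩
    rw [Multiset.filter_eq_nil.2 fun a ha => not_not.2 (Multiset.eq_of_mem_replicate ha)]
    exact Multiset.zero_le _
  obtain ⟨lam', h1, h2, h3⟩ := Nat.sSup_mem hne hb
  exact ⟨lam', h1, h2, fun s hs hs' => h3 ▸ le_csSup hb ⟨s, hs, hs', rfl⟩⟩

theorem Multiset.filter_exchange_le {lam lam' : Multiset ℕ} {a h : ℕ}
    (hle : a ::ₘ lam'.filter (· ≠ 0) ≤ lam) :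
    (a ::ₘ lam'.erase h).filter (· ≠ 0) ≤ lam := by
  refine le_trans ?_ hle
  rw [← Multiset.singleton_add, ← Multiset.singleton_add, Multiset.filter_add]
  exact add_le_add (Multiset.filter_le _ _)
    (Multiset.filter_le_filter _ (Multiset.erase_le _ _))

theorem Multiset.sum_exchange {s : Multiset ℕ} {a h : ℕ} (hh : h ∈ s) :
    (a ::ₘ s.erase h).sum + h = a + s.sum := by
  conv_rhs => rw [← Multiset.cons_erase hh]
  rw [Multiset.sum_cons, Multiset.sum_cons]
  ring

theorem Multiset.card_exchange {s : Multiset ℕ} {a h : ℕ} (hh : h ∈ s) :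
    (a ::ₘ s.erase h).card = s.card := by
  conv_rhs => rw [← Multiset.cons_erase hh]
  rw [Multiset.card_cons, Multiset.card_cons]

/-- Otherwise exchanging `a` for `h` would give a choice of larger sum. -/
theorem le_of_mem_max_choice {lam lam' : Multiset ℕ} (hcard : lam'.card = c)
    (hle : lam'.filter (· ≠ 0) ≤ lam)
    (hmax : ∀ s : Multiset ℕ, s.card = c → s.filter (· ≠ 0) ≤ lam → s.sum ≤ lam'.sum)
    {a h : ℕ} (ha : a ∈ lam - lam'.filter (· ≠ 0)) (hh : h ∈ lam') : a ≤ h := by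
  have h1 := hmax (a ::ₘ lam'.erase h) ((Multiset.card_exchange hh).trans hcard)
    (Multiset.filter_exchange_le (by
      rw [← Multiset.singleton_add, ← tsub_add_cancel_of_le hle]
      exact add_le_add_left (Multiset.singleton_le.2 ha) _))
  have h2 := Multiset.sum_exchange (a := a) hh
  omega

theorem Multiset.sum_map_le_affine {s : Multiset ℕ} {f : ℕ → ℤ} {x y : ℤ}
    (h : ∀ a ∈ s, f a ≤ x * a + y) : (s.map f).sum ≤ x * (s.sum : ℕ) + y * (s.card : ℕ) := by
  induction s using Multiset.induction_on with
  | empty => simp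
  | cons a s ih =>
    have h1 := h a (Multiset.mem_cons_self a s)
    have h2 := ih fun b hb => h b (Multiset.mem_cons_of_mem hb)
    rw [Multiset.map_cons, Multiset.sum_cons, Multiset.sum_cons, Multiset.card_cons]
    push_cast [-Nat.cast_multiset_sum]
    linarith

/-- Used in codimension two, where the invariants force equality and hence all parts equal to one.
-/
theorem Multiset.sum_le_sum_sq (s : Multiset ℕ) :
    ((s.sum : ℕ) : ℤ) ≤ (s.map fun a : ℕ => (a : ℤ) ^ 2).sum ∧
      ((s.map fun a : ℕ => (a : ℤ) ^ 2).sum ≤ ((s.sum : ℕ) : ℤ) → ∀ a ∈ s, a ≤ 1) := by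
  induction s using Multiset.induction_on with
  | empty => simp
  | cons a s ih =>
    obtain ⟨h1, h2⟩ := ih
    rw [Multiset.map_cons, Multiset.sum_cons, Multiset.sum_cons]
    have h3 : (a : ℤ) ≤ (a : ℤ) ^ 2 := by nlinarith [Int.le_self_sq (a : ℤ)]
    push_cast [-Nat.cast_multiset_sum]
    refine ⟨by linarith, fun h b hb => ?_⟩
    rcases Multiset.mem_cons.1 hb with rfl | hb
    · have h4 : (b : ℤ) ^ 2 ≤ b := by linarith
      by_contra h5
      push Not at h5
      have h6 : (2 : ℤ) ≤ b := by exact_mod_cast h5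
      nlinarith
    · exact h2 (by linarith) b hb

end Decorations

/-! ### Descent along maximal links -/

section Greedy

variable {c : ℕ}

/-- A decoration linked along a choice of maximal sum. -/
structure GreedyLink (c : ℕ) (lam mu lam' : Multiset ℕ) : Prop where
  dec : IsDecoration c lam mu
  ne : ¬ (lam = {1} ∧ mu = 0)
  card_eq : lam'.card = c
  filter_le : lam'.filter (· ≠ 0) ≤ lam
  sum_le : ∀ s : Multiset ℕ, s.card = c → s.filter (· ≠ 0) ≤ lam → s.sum ≤ lam'.sum

namespace GreedyLink

variable {lam mu lam' : Multiset ℕ}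

theorem exists_mem (hc : 2 ≤ c) (h : GreedyLink c lam mu lam') : ∃ a, a ∈ lam' :=
  Multiset.card_pos_iff_exists_mem.1 (by rw [h.card_eq]; omega)

theorem sum_eq (h : GreedyLink c lam mu lam') :
    lam.sum = lam'.sum + (lam - lam'.filter (· ≠ 0)).sum := by
  conv_lhs => rw [← add_tsub_cancel_of_le h.filter_le]
  rw [Multiset.sum_add, Multiset.sum_filter_ne_zero]

theorem sum_rest (h : GreedyLink c lam mu lam') :
    ((lam - lam'.filter (· ≠ 0)).sum : ℤ) =
      (mu.sum : ℕ) + (((c : ℤ) - 2) * (mu.sum : ℕ) + 1 - (lam'.sum : ℕ)) := by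
  obtain ⟨-, -, h3, -⟩ := h.dec.invariants
  have h1 := h.sum_eq
  have h2 : (lam.sum : ℤ) = (lam'.sum : ℕ) + ((lam - lam'.filter (· ≠ 0)).sum : ℕ) := by
    rw [h1, Nat.cast_add]
  linarith

theorem zero_notMem_rest (h : GreedyLink c lam mu lam') : 0 ∉ lam - lam'.filter (· ≠ 0) :=
  fun h0 => h.dec.invariants.1 (Multiset.mem_of_le tsub_le_self h0)

/-- A zero among the largest parts means that nothing is left over. Positivity then forces `mu.sum =
0` and all chosen parts to vanish, against the linear invariant. -/
theorem zero_notMem (hc : 2 ≤ c) (h : GreedyLink c lam mu lam') : 0 ∉ lam' := by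
  intro h0
  have h1 : (lam - lam'.filter (· ≠ 0)).sum = 0 := by
    refine Multiset.sum_eq_zero fun a ha => ?_
    have := le_of_mem_max_choice h.card_eq h.filter_le h.sum_le ha h0
    omega
  have h2 := (h.dec.le_sum hc h.ne h.card_eq h.filter_le h0).2
  have h3 : mu.sum = 0 := by omega
  have h4 : lam'.sum = 0 := by
    refine Multiset.sum_eq_zero fun a ha => ?_
    have := (h.dec.le_sum hc h.ne h.card_eq h.filter_le ha).1
    omega
  have h5 := h.sum_rest
  rw [h1, h3, h4] at h5
  simp at h5

theorem filter_eq (hc : 2 ≤ c) (h : GreedyLink c lam mu lam') : lam'.filter (· ≠ 0) = lam' :=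
  Multiset.filter_ne_zero_eq_self (h.zero_notMem hc)

/-- If every `λ'_i + p` dominated `μ`, then bounding each square by an affine function of its part
would make the sum of squares smaller than the quadratic invariant allows. -/
theorem exists_lt (hc : 2 ≤ c) (h : GreedyLink c lam mu lam') :
    ∃ b ∈ mu, ∃ a ∈ lam', (a : ℤ) + (((c : ℤ) - 2) * (mu.sum : ℕ) + 1 - (lam'.sum : ℕ)) < b := by
  by_contra! hcon
  obtain ⟨a₀, ha₀⟩ := h.exists_mem hc
  obtain ⟨h₀, hh₀, hmin⟩ := lam'.toFinset.exists_min_image id ⟨a₀, Multiset.mem_toFinset.2 ha₀⟩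
  have hh₀' := Multiset.mem_toFinset.1 hh₀
  have hmin' : ∀ a ∈ lam', h₀ ≤ a := fun a ha => hmin a (Multiset.mem_toFinset.2 ha)
  obtain ⟨-, -, h3, h4⟩ := h.dec.invariants
  have hk : ∀ a ∈ lam', a ≤ mu.sum := fun a ha =>
    (h.dec.le_sum hc h.ne h.card_eq h.filter_le ha).1
  have h5 := h.sum_rest
  obtain ⟨p, hp⟩ : ∃ p : ℤ, p = ((c : ℤ) - 2) * (mu.sum : ℕ) + 1 - (lam'.sum : ℕ) := ⟨_, rfl⟩
  rw [← hp] at h5 hcon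
  have e1 : (lam.map fun a : ℕ => (a : ℤ) ^ 2).sum = (lam'.map fun a : ℕ => (a : ℤ) ^ 2).sum +
      ((lam - lam'.filter (· ≠ 0)).map fun a : ℕ => (a : ℤ) ^ 2).sum := by
    conv_lhs => rw [← add_tsub_cancel_of_le h.filter_le]
    rw [Multiset.map_add, Multiset.sum_add, Multiset.sum_map_filter_ne_zero (by simp)]
  -- From `(a - h₀) (a - k) ≤ 0` with `h₀` the least chosen part and `k = mu.sum`; the upper bound
  -- `a ≤ k` is positivity.
  have b1 := Multiset.sum_map_le_affine (s := lam') (f := fun a => (a : ℤ) ^ 2)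
    (x := h₀ + (mu.sum : ℕ)) (y := -(h₀ * (mu.sum : ℕ))) fun a ha => by
      have i1 : (h₀ : ℤ) ≤ a := by exact_mod_cast hmin' a ha
      have i2 : (a : ℤ) ≤ (mu.sum : ℕ) := by exact_mod_cast hk a ha
      nlinarith
  have b2 := Multiset.sum_map_le_affine (s := lam - lam'.filter (· ≠ 0))
    (f := fun a => (a : ℤ) ^ 2) (x := h₀) (y := 0) fun a ha => by
      have i1 : (a : ℤ) ≤ h₀ := by
        exact_mod_cast le_of_mem_max_choice h.card_eq h.filter_le h.sum_le ha hh₀'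
      nlinarith [Int.natCast_nonneg a]
  have b3 := Multiset.sum_map_le_affine (s := mu) (f := fun a => (a : ℤ) ^ 2) (x := h₀ + p)
    (y := 0) fun a ha => by
      have i1 := hcon a ha h₀ hh₀'
      nlinarith [Int.natCast_nonneg a]
  rw [h.card_eq] at b1
  rw [h5] at b2
  have i2 : (h₀ : ℤ) ≤ (mu.sum : ℕ) := by exact_mod_cast hk h₀ hh₀'
  have e2 : ((lam'.sum : ℕ) : ℤ) = ((c : ℤ) - 2) * (mu.sum : ℕ) + 1 - p := by rw [hp]; ring
  rw [e2] at b1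
  -- The three bounds add up to `(c - 2) k² + k + h₀`, while the invariant is `(c - 2) k² + 2k + 1`;
  -- so `k + 1 ≤ h₀`, contradicting `h₀ ≤ k`.
  nlinarith

end GreedyLink

variable {K : Type*} [Field K] [Infinite K]

/-- Every decoration except `((1), ∅)` is realized by a licci ideal. -/
theorem exists_realization (hc : 2 ≤ c) (n : ℕ) : ∀ {lam mu lam' : Multiset ℕ},
    GreedyLink c lam mu lam' → mu.sum + (lam - lam'.filter (· ≠ 0)).sum = n →
    ∃ (J : Ideal (MvPolynomial (Fin c) K)) (G : GradedComplex c K) (o' : G.ι) (S : Fin c → G.ι),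
      Realization lam mu J G o' S := by
  induction n using Nat.strong_induction_on with
  | _ n ih =>
    intro lam mu lam' h hn
    obtain ⟨h1, h2, h3, h4⟩ := h.dec.invariants
    obtain ⟨p, hp⟩ : ∃ p : ℤ, p = ((c : ℤ) - 2) * (mu.sum : ℕ) + 1 - (lam'.sum : ℕ) := ⟨_, rfl⟩
    have hA := h.sum_rest
    rw [← hp] at hA
    have hlam' := h.filter_eq hc
    have hle : ∀ a ∈ lam', a ≤ mu.sum ∧ mu.sum ≤ (lam - lam'.filter (· ≠ 0)).sum + a :=
      fun a ha => h.dec.le_sum hc h.ne h.card_eq h.filter_le ha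
    have hmaxA : ∀ a ∈ lam', ∀ b ∈ lam - lam'.filter (· ≠ 0), b ≤ a :=
      fun a ha b hb => le_of_mem_max_choice h.card_eq h.filter_le h.sum_le hb ha
    have hlt := h.exists_lt hc
    have h0A := h.zero_notMem_rest
    have hlamA : lam = lam' + (lam - lam'.filter (· ≠ 0)) := by
      conv_lhs => rw [← add_tsub_cancel_of_le h.filter_le, hlam']
      rw [hlam']
    obtain ⟨A, hAdef⟩ : ∃ A, A = lam - lam'.filter (· ≠ 0) := ⟨_, rfl⟩
    rw [← hAdef] at hA hle hmaxA h0A hlamA hn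
    rw [← hp] at hlt
    have hpos : ∀ a ∈ lam', 0 ≤ (a : ℤ) + p := fun a ha => by
      have h5 : ((mu.sum : ℕ) : ℤ) ≤ ((A.sum : ℕ) : ℤ) + a := by exact_mod_cast (hle a ha).2
      linarith
    obtain ⟨G, hG⟩ : ∃ G, G = lam'.map fun a : ℕ => ((a : ℤ) + p).toNat := ⟨_, rfl⟩
    obtain ⟨lam₂, hlam₂⟩ : ∃ lam₂, lam₂ = (G + mu).filter (· ≠ 0) := ⟨_, rfl⟩
    have hlam₂' : lam₂ = G.filter (· ≠ 0) + mu := by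
      rw [hlam₂, Multiset.filter_add, Multiset.filter_ne_zero_eq_self h2]
    have hGcard : G.card = c := by rw [hG, Multiset.card_map, h.card_eq]
    have hdec : IsDecoration c lam₂ A := by
      refine .link h.dec ⟨lam', p, h.card_eq, h.filter_le, hp, hAdef, ?_,
        link_cast hpos (hG ▸ hlam₂)⟩
      rw [hlam₂]
      exact fun h0 => (Multiset.mem_filter.1 h0).2 rfl
    -- The descent stops when the link is the unit ideal: then every chosen part equals `mu.sum =
    -- 1`, and the decoration is that of the ideal of the variables.
    by_cases hne : lam₂ = {1} ∧ A = 0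
    · obtain ⟨hl, rfl⟩ := hne
      have hk : ∀ a ∈ lam', a = mu.sum := fun a ha => by
        have := hle a ha
        rw [Multiset.sum_zero] at this
        omega
      rw [Multiset.sum_zero] at hA
      have hG0 : G.filter (· ≠ 0) = 0 := by
        rw [hG, Multiset.filter_eq_nil]
        intro g hg
        obtain ⟨a, ha, rfl⟩ := Multiset.mem_map.1 hg
        rw [hk a ha, not_not]
        rw [Nat.cast_zero] at hA
        rw [← hA]
        rfl
      rw [hG0, zero_add] at hlam₂'
      have hmu : mu = {1} := hlam₂'.symm.trans hl
      have hl' : lam' = Multiset.replicate c 1 := by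
        rw [Multiset.eq_replicate]
        refine ⟨h.card_eq, fun a ha => ?_⟩
        rw [hk a ha, hmu, Multiset.sum_singleton]
      rw [hlamA, add_zero, hl', hmu]
      exact exists_realization_replicate hc
    · obtain ⟨lam'', hcard, hle'', hmax⟩ := exists_max_choice c lam₂
      have hgl : GreedyLink c lam₂ A lam'' := ⟨hdec, hne, hcard, hle'', hmax⟩
      have hsum₂ : lam₂.sum = G.sum + mu.sum := by
        rw [hlam₂', Multiset.sum_add, Multiset.sum_filter_ne_zero]
      -- Some part of `mu` exceeds an entry of `G`, and exchanging them improves on `G`. So a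
      -- maximal choice in `lam₂` leaves a rest of sum less than `mu.sum`, and the measure drops.
      have hGlt : G.sum < lam''.sum := by
        obtain ⟨b, hb, a, ha, hab⟩ := hlt
        have hg : ((a : ℤ) + p).toNat ∈ G := hG ▸ Multiset.mem_map_of_mem _ ha
        have h5 := hmax (b ::ₘ G.erase ((a : ℤ) + p).toNat)
          ((Multiset.card_exchange hg).trans hGcard) (Multiset.filter_exchange_le (by
            rw [← Multiset.singleton_add, add_comm, hlam₂']
            exact add_le_add_right (Multiset.singleton_le.2 hb) _))
        have h6 := Multiset.sum_exchange (a := b) hg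
        have h7 := hpos a ha
        omega
      obtain ⟨I, F, o, T, hR⟩ := ih (A.sum + (lam₂ - lam''.filter (· ≠ 0)).sum) (by
        have := hgl.sum_eq
        omega) hgl rfl
      have hGsum : ((G.sum : ℕ) : ℤ) = (lam'.sum : ℕ) + c * p := by
        have h5 := Multiset.sum_map_toNat hpos fun a => a
        rw [← hG, Multiset.sum_map_cast, Multiset.sum_map_add, Multiset.sum_map_cast,
          Multiset.map_const', h.card_eq, Multiset.sum_replicate, nsmul_eq_mul] at h5
        exact h5
      have hGmem : ∀ g ∈ G, ∃ a ∈ lam', (g : ℤ) = a + p := by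
        intro g hg
        rw [hG] at hg
        obtain ⟨a, ha, rfl⟩ := Multiset.mem_map.1 hg
        exact ⟨a, ha, Int.toNat_of_nonneg (hpos a ha)⟩
      -- The link is run backwards, along `G` with shift `-p`. Its requirement on lowest degrees is
      -- the maximality of the choice `lam'`.
      refine hR.exists_link hc (lam' := G) (p := -p) hGcard (hlam₂' ▸ le_self_add) ?_ ?_ ?_ ?_ ?_
        ?_ ?_
      · rw [hGsum, hA, hp]
        ring
      · rw [hlam₂', add_tsub_cancel_left]
      · rw [hA]
        ring
      · conv_lhs => rw [hlamA]
        rw [Multiset.map_add, hG, Multiset.map_map]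
        refine congrArg (· + _) (Multiset.map_congr rfl fun a ha => ?_)
        rw [Function.comp_apply, Int.toNat_of_nonneg (hpos a ha)]
        ring
      · intro g hg b hb
        obtain ⟨a, ha, hga⟩ := hGmem g hg
        have h5 := hmaxA a ha b hb
        rw [hga]
        omega
      · intro l hl
        rw [hlamA, Multiset.mem_add] at hl
        rcases hl with hl | hl
        · exact (hle l hl).1
        · obtain ⟨a, ha⟩ := h.exists_mem hc
          exact (hmaxA a ha l hl).trans (hle a ha).1
      -- For `c = 2` the parts of `lam` and `mu` together have both sum and sum of squares `2k + 1`,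
      -- so all are one. Then `p = -1` and `G` consists of zeros.
      · rintro hc2 g hg
        obtain ⟨a, ha, hga⟩ := hGmem g hg
        have h5 := Multiset.sum_le_sum_sq lam
        have h6 := Multiset.sum_le_sum_sq mu
        have h7 : ((c : ℕ) : ℤ) = 2 := by exact_mod_cast hc2
        rw [h7] at h3 h4 hp
        have h8 : ∀ a ∈ lam', a = 1 := by
          intro a ha
          have h9 := h5.2 (by linarith) a (by rw [hlamA]; exact Multiset.mem_add.2 (Or.inl ha))
          have h10 : a ≠ 0 := fun h' => h.zero_notMem hc (h' ▸ ha)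
          omega
        have h9 : lam' = Multiset.replicate c 1 := Multiset.eq_replicate.2 ⟨h.card_eq, h8⟩
        rw [h9, Multiset.sum_replicate, hc2] at hp
        have h10 := h8 a ha
        simp at hp
        omega

end Greedy

theorem theorem9p8 {K : Type*} [Field K] [Infinite K] (c : ℕ) (hc : 2 ≤ c)
    (lam mu : Multiset ℕ) (hdec : IsDecoration c lam mu) (hne : ¬ (lam = {1} ∧ mu = 0)) :
    ∃ I : Ideal (MvPolynomial (Fin c) K),
      IsHomogeneousIdeal I ∧
      I.height = (c : ℕ∞) ∧
      IsHomogeneouslyLicci I ∧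
      ∃ F : GradedFreeResolution I c,
        F.degrees 1 = lam.map (fun l : ℕ => (mu.sum : ℤ) + 1 - (l : ℤ)) ∧
        F.degrees c = mu.map (fun m : ℕ => (mu.sum : ℤ) + (c : ℤ) - 2 + (m : ℤ)) := by
  obtain ⟨lam', h1, h2, h3⟩ := exists_max_choice c lam
  obtain ⟨I, F, o, T, h⟩ := exists_realization (K := K) hc _ ⟨hdec, hne, h1, h2, h3⟩ rfl
  -- The height is `c` because the ideal is proper and contains a regular sequence as long as the
  -- number of variables.
  exact ⟨I, h.res.isHomogeneousIdeal,
    height_eq_of_weaklyRegularSeq h.gens.regular I (h.res.ne_top h.pos) fun i => h.res.d_mem _,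
    h.licci, h.res.toGradedFreeResolution,
    (h.res.degrees_toGradedFreeResolution 1).trans h.deg_one,
    (h.res.degrees_toGradedFreeResolution c).trans h.deg_top⟩
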